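/- Let $m\ge 1$, $n=2m$, $\varepsilon=e^{2\pi i/n}$, and let $\mathbb D_n=\langle g,h \mid g^n=1,\ h^2=g^m,\ hgh^{-1}=g^{-1}\rangle$ be the dicyclic group of order $2n$. Let $c=\sum_{i\in\mathbb Z/n}c_ig^i\in\mathbb C[\mathbb D_n]$ with $c_0\neq 0$ and $c_i=c_{-i}$. Let $H_c$ be the quotient of the skew group algebra $\mathbb C\langle x,y\rangle\#\mathbb D_n$, where $gx=\varepsilon xg$, $gy=\varepsilon^{-1}yg$, $hx=yh$, $hy=-xh$, by the relation $xy-yx=c$. A trace on a complex algebra $A$ is a linear map $T:A\to\mathbb C$ with $T(ab)=T(ba)$. For $q\in\mathbb Z$ put $$k=\frac1{c_0}\Big(xy+\sum_{i=1}^{n-1}\frac{c_ig^i}{\varepsilon^i-1}\Big)-\frac12,\qquad e_q=\frac1n\sum_{i=0}^{n-1}\varepsilon^{iq}g^i,\qquad \alpha_q=\frac1{c_0}\sum_{i=1}^{n-1}\frac{c_i\varepsilon^{-iq}}{\varepsilon^i-1},$$ $$\mathbf P(X)=\prod_{q=0}^{n-1}\big(X-e^{\frac{2\pi i}n(\alpha_q-q-\frac12)}\big),\qquad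 r_q=\frac{\alpha_q-q-\frac12}{n}+\frac12,\qquad P(X)=\prod_{q=0}^{n-1}(X-r_q).$$ (Then $x^ny^ne_0=(c_0n)^nP(\tfrac kn+\tfrac12)e_0$.) Let $P_\circ=\prod(X-r_q)$ and $\mathbf P_\circ=\prod\big(X-e^{\frac{2\pi i}n(\alpha_q-q-\frac12)}\big)$, both products over those $0\le q<n$ with $|\operatorname{Re} r_q|\le\frac12$, and let $n_\circ=\deg P_\circ$. For a polynomial $G$ of degree at most $n-2$ with $G(X)=X^{n-2}G(X^{-1})$ put $$w_0(z)=e^{\frac{2\pi i}nz}\,\frac{G(e^{2\pi iz/n})}{\mathbf P(e^{2\pi iz/n})},\qquad w_q(z)=w_0(z-q).$$ Say that a trace $T$ on $H_c$ has a line formula with data $(G,(\Phi_q)_{q\in\mathbb Z})$ if, for all $q\in\mathbb Z$ and all $R\in\mathbb C[X]$, the integral below converges absolutely and $$T(R(k)e_q)=\int_{i\mathbb R}R(z)w_q(z)\,dz+\Phi_q(R),\qquad \Phi_q(R)=\sum_{\substack{i,j\in\mathbb Z\\ i\ne q}}a_{q,i,j}\,R\big(\alpha_i+q-i+nj-\tfrac12\big),$$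 where, for each $q$, only finitely many of the complex numbers $a_{q,i,j}$ are nonzero. 1. Suppose $\operatorname{Re}\alpha_i\notin\frac12+\mathbb Z$ for all $i$ (that is, no $\mathbf P(e^{\frac{2\pi i}n(z-q)})$, $q\in\mathbb Z$, has a zero on $i\mathbb R$). Then every trace $T$ on $H_c$ has a line formula. 2. If a trace $T$ on $H_c$ has a line formula in which $\Phi_0$ is identically zero, then $T$ is equivalent to a trace of the deformation constructed from $P_\circ$, in the following sense. First, $w_0$ is a weight for $P_\circ$: there is a polynomial $G_\circ$ of degree at most $n_\circ-2$ (so $G_\circ=0$ if $n_\circ=0$) with $G_\circ(X)=X^{n_\circ-2}G_\circ(X^{-1})$ and $G/\mathbf P=G_\circ/\mathbf P_\circ$. Second, let $A_{P_\circ}$ be the algebra with generators $u,v,z$ and relations $[z,u]=-u$, $[z,v]=v$, $uv=P_\circ(z+\frac12)$, $vu=P_\circ(z-\frac12)$ (the type A deformation constructed from $P_\circ$); it has the involutive automorphism $\sigma:z\mapsto-z,\ u\mapsto v,\ v\mapsto u$, whose fixed subalgebra is the type D deformation constructed from $P_\circ$. There is a $\sigma$-invariant trace $T_\circ$ on $A_{P_\circ}$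 (which therefore restricts to a trace on the fixed subalgebra) such that $T_\circ(R(z))=T(R(\tfrac kn)e_0)$ for all $R\in\mathbb C[X]$. -/

import Mathlib

noncomputable section

namespace TypeD

/-! Throughout, `m ≥ 1`, `n = 2 * m`, the dicyclic group of order `2 * n` is
`QuaternionGroup m` with `g = a 1`, `h = xa 0`, and the deformation parameter
`c = ∑ c_i g ^ i` is given by its coefficients `c : ZMod (2 * m) → ℂ`. -/

/-- The primitive `n`-th root of unity `exp (2πi / n)`. -/
def eps (m : ℕ) : ℂ := Complex.exp (2 * Real.pi * Complex.I / ((2 * m : ℕ) : ℂ))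

/-- Generators of the skew group algebra of the free algebra `ℂ⟨x, y⟩` with the dicyclic group. -/
inductive Gen (m : ℕ) : Type
  | x : Gen m
  | y : Gen m
  | grp (γ : QuaternionGroup m) : Gen m

/-- The generators, as elements of the free algebra. -/
abbrev fx (m : ℕ) : FreeAlgebra ℂ (Gen m) := FreeAlgebra.ι ℂ Gen.x
abbrev fy (m : ℕ) : FreeAlgebra ℂ (Gen m) := FreeAlgebra.ι ℂ Gen.y
abbrev fgrp {m : ℕ} (γ : QuaternionGroup m) : FreeAlgebra ℂ (Gen m) :=
  FreeAlgebra.ι ℂ (Gen.grp γ)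

/-- Defining relations of `H_c`: the group law, the action of `g` and `h` on `x` and `y`,
and `xy - yx = c`. -/
inductive Rel (m : ℕ) (c : ZMod (2 * m) → ℂ) :
    FreeAlgebra ℂ (Gen m) → FreeAlgebra ℂ (Gen m) → Prop
  | one : Rel m c (fgrp 1) 1
  | mul (γ δ : QuaternionGroup m) : Rel m c (fgrp γ * fgrp δ) (fgrp (γ * δ))
  | gx : Rel m c (fgrp (QuaternionGroup.a 1) * fx m)
      (eps m • (fx m * fgrp (QuaternionGroup.a 1)))
  | gy : Rel m c (fgrp (QuaternionGroup.a 1) * fy m)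
      ((eps m)⁻¹ • (fy m * fgrp (QuaternionGroup.a 1)))
  | hx : Rel m c (fgrp (QuaternionGroup.xa 0) * fx m) (fy m * fgrp (QuaternionGroup.xa 0))
  | hy : Rel m c (fgrp (QuaternionGroup.xa 0) * fy m) (-(fx m * fgrp (QuaternionGroup.xa 0)))
  | comm : Rel m c (fx m * fy m - fy m * fx m)
      (∑ i ∈ Finset.range (2 * m), c (i : ZMod (2 * m)) •
        fgrp (QuaternionGroup.a (i : ZMod (2 * m))))

/-- The algebra `H_c = (ℂ⟨x, y⟩ # 𝔻_n) / (xy - yx - c)`. -/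
abbrev H (m : ℕ) (c : ZMod (2 * m) → ℂ) : Type := RingQuot (Rel m c)

variable {m : ℕ} (c : ZMod (2 * m) → ℂ)

/-- The element `x` of `H_c`. -/
def x : H m c := RingQuot.mkAlgHom ℂ (Rel m c) (fx m)

/-- The element `y` of `H_c`. -/
def y : H m c := RingQuot.mkAlgHom ℂ (Rel m c) (fy m)

/-- The element `g ^ i` of `H_c`. -/
def gpow (i : ℕ) : H m c :=
  RingQuot.mkAlgHom ℂ (Rel m c) (fgrp (QuaternionGroup.a (i : ZMod (2 * m))))

/-- `k = (1 / c_0) (xy + ∑_{i = 1}^{n - 1} c_i g ^ i / (ε ^ i - 1)) - 1 / 2`. -/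
def k : H m c :=
  (c 0)⁻¹ • (x c * y c + ∑ i ∈ Finset.Ico 1 (2 * m),
    (c (i : ZMod (2 * m)) / (eps m ^ i - 1)) • gpow c i)
    - algebraMap ℂ (H m c) (1 / 2)

/-- `e_q = (1 / n) ∑_{i = 0}^{n - 1} ε ^ (i q) g ^ i`. -/
def e (q : ℤ) : H m c :=
  (((2 * m : ℕ) : ℂ)⁻¹) • ∑ i ∈ Finset.range (2 * m), (eps m ^ ((i : ℤ) * q)) • gpow c i

/-- `α_q = (1 / c_0) ∑_{i = 1}^{n - 1} c_i ε ^ (-i q) / (ε ^ i - 1)`. -/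
def alpha (q : ℤ) : ℂ :=
  (c 0)⁻¹ * ∑ i ∈ Finset.Ico 1 (2 * m),
    c (i : ZMod (2 * m)) * eps m ^ (-((i : ℤ) * q)) / (eps m ^ i - 1)

/-- A trace on a complex algebra. -/
def IsTrace {A : Type*} [Ring A] [Algebra ℂ A] (T : A →ₗ[ℂ] ℂ) : Prop :=
  ∀ a b : A, T (a * b) = T (b * a)

/-- `∏_{q ∈ s} (X - exp ((2πi / n) (α_q - q - 1 / 2)))`; the polynomial `𝐏` of the analytic
formula is the case `s = {0, …, n - 1}`. -/
def expPoly (s : Finset ℕ) : Polynomial ℂ :=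
  ∏ q ∈ s, (Polynomial.X - Polynomial.C (Complex.exp
    (2 * Real.pi * Complex.I / ((2 * m : ℕ) : ℂ) * (alpha c q - q - 1 / 2))))

/-- `G` has degree at most `d - 2` and `G(X) = X ^ (d - 2) G(1 / X)`
(so `G = 0` if `d < 2`). -/
def IsNumerator (d : ℕ) (G : Polynomial ℂ) : Prop :=
  (∀ i, d < i + 2 → G.coeff i = 0) ∧ (∀ i j, i + j + 2 = d → G.coeff i = G.coeff j)

/-- `w_0(z) = exp (2πi z / n) G(exp (2πi z / n)) / 𝐏(exp (2πi z / n))`. -/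
def weightZero (G : Polynomial ℂ) (z : ℂ) : ℂ :=
  Complex.exp (2 * Real.pi * Complex.I / ((2 * m : ℕ) : ℂ) * z) *
    (G.eval (Complex.exp (2 * Real.pi * Complex.I / ((2 * m : ℕ) : ℂ) * z)) /
      (expPoly c (Finset.range (2 * m))).eval
        (Complex.exp (2 * Real.pi * Complex.I / ((2 * m : ℕ) : ℂ) * z)))

/-- `w_q(z) = w_0(z - q)`. -/
def weight (G : Polynomial ℂ) (q : ℤ) (z : ℂ) : ℂ := weightZero c G (z - q)

/-- The finite sum `∑_{i, j} b_{i, j} R(α_i + q - i + n j - 1 / 2)`. -/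
def pointSum (q : ℤ) (b : ℤ × ℤ →₀ ℂ) (R : Polynomial ℂ) : ℂ :=
  b.sum fun p s => s * R.eval
    (alpha c p.1 + q - p.1 + ((2 * m : ℕ) : ℂ) * p.2 - 1 / 2)

/-- `T(R(k) e_q) = ∫_{iℝ} R(z) w_q(z) dz + ∑_{i ≠ q, j} a_{q, i, j} R(α_i + q - i + n j - 1 / 2)`
for all `q` and `R`, with absolutely convergent integrals (`z = i t`, `dz = i dt`). -/
structure HasLineFormula (T : H m c →ₗ[ℂ] ℂ) (G : Polynomial ℂ) (a : ℤ → ℤ × ℤ →₀ ℂ) :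
    Prop where
  numerator : IsNumerator (2 * m) G
  index_ne : ∀ q j : ℤ, a q (q, j) = 0
  integrable : ∀ (q : ℤ) (R : Polynomial ℂ), MeasureTheory.Integrable
    (fun t : ℝ => R.eval (Complex.I * t) * weight c G q (Complex.I * t)) MeasureTheory.volume
  formula : ∀ (q : ℤ) (R : Polynomial ℂ),
    T (Polynomial.aeval (k c) R * e c q) =
      Complex.I * (∫ t : ℝ, R.eval (Complex.I * t) * weight c G q (Complex.I * t))
        + pointSum c q (a q) R

/-- The roots `(α_q - q - 1 / 2) / n + 1 / 2`, `0 ≤ q < n`, of the monic polynomial `P` with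
`x ^ n y ^ n e_0 = (c_0 n) ^ n P(k / n + 1 / 2) e_0`. -/
def root (q : ℕ) : ℂ := (alpha c q - q - 1 / 2) / ((2 * m : ℕ) : ℂ) + 1 / 2

open Classical in
/-- Indices of the roots of `P` in the strip `|Re z| ≤ 1 / 2`. -/
def stripIndices : Finset ℕ :=
  (Finset.range (2 * m)).filter fun q => |(root c q).re| ≤ 1 / 2

/-- `P_∘`: the polynomial `P` with the roots outside the strip `|Re z| ≤ 1 / 2` removed. -/
def polyStrip : Polynomial ℂ :=
  ∏ q ∈ stripIndices c, (Polynomial.X - Polynomial.C (root c q))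

/-- Generators of the type A algebra attached to a polynomial. -/
inductive GenA : Type
  | u : GenA
  | v : GenA
  | z : GenA

abbrev fu : FreeAlgebra ℂ GenA := FreeAlgebra.ι ℂ GenA.u
abbrev fv : FreeAlgebra ℂ GenA := FreeAlgebra.ι ℂ GenA.v
abbrev fz : FreeAlgebra ℂ GenA := FreeAlgebra.ι ℂ GenA.z

/-- The relations `[z, u] = -u`, `[z, v] = v`, `u v = P(z + 1/2)`, `v u = P(z - 1/2)`. -/
inductive RelA (P : Polynomial ℂ) : FreeAlgebra ℂ GenA → FreeAlgebra ℂ GenA → Prop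
  | zu : RelA P (fz * fu - fu * fz) (-fu)
  | zv : RelA P (fz * fv - fv * fz) fv
  | uv : RelA P (fu * fv)
      (Polynomial.aeval (fz + algebraMap ℂ (FreeAlgebra ℂ GenA) (1 / 2)) P)
  | vu : RelA P (fv * fu)
      (Polynomial.aeval (fz - algebraMap ℂ (FreeAlgebra ℂ GenA) (1 / 2)) P)

/-- The filtered deformation of the type A Kleinian singularity constructed from `P`. For `P` even
of degree `n`, the type D deformation constructed from `P` is the subalgebra of elements fixed by
the involution `z ↦ -z`, `u ↦ v`, `v ↦ u`. -/
abbrev DeformA (P : Polynomial ℂ) : Type := RingQuot (RelA P)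

/-- The image in `DeformA P` of a generator. -/
def genA (P : Polynomial ℂ) (s : GenA) : DeformA P :=
  RingQuot.mkAlgHom ℂ (RelA P) (FreeAlgebra.ι ℂ s)

/-- `T`, of weight `w_0` with numerator `G`, is equivalent to a trace of the deformation
constructed from `P_∘`: its weight is one for `P_∘`, and its values on `ℂ[k] e_0` are those of a
trace on the type A deformation of `P_∘` that is invariant under the involution and so restricts
to the type D deformation of `P_∘`. -/
def ReducesToStrip (T : H m c →ₗ[ℂ] ℂ) (G : Polynomial ℂ) : Prop :=
  (∃ G₀ : Polynomial ℂ, IsNumerator (stripIndices c).card G₀ ∧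
    G * expPoly c (stripIndices c) = G₀ * expPoly c (Finset.range (2 * m))) ∧
  ∃ (T₀ : DeformA (polyStrip c) →ₗ[ℂ] ℂ)
    (σ : DeformA (polyStrip c) ≃ₐ[ℂ] DeformA (polyStrip c)),
    IsTrace T₀ ∧
    σ (genA _ GenA.z) = -genA _ GenA.z ∧
    σ (genA _ GenA.u) = genA _ GenA.v ∧
    σ (genA _ GenA.v) = genA _ GenA.u ∧
    (∀ b, T₀ (σ b) = T₀ b) ∧
    ∀ R : Polynomial ℂ,
      T₀ (Polynomial.aeval (genA _ GenA.z) R) =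
        T (Polynomial.aeval ((((2 * m : ℕ) : ℂ)⁻¹) • k c) R * e c 0)

end TypeD

end

/-! ### Commutation relations in `H_c` and the functionals `R ↦ T(R(k) e_q)`. -/

noncomputable section
namespace TypeD
open Polynomial

variable {m : ℕ} (c : ZMod (2 * m) → ℂ)

/-! A trace `T` is studied through the functionals `tau T q : R ↦ T(R(k) e_q)`, which are
`n`-periodic in `q`. Since `k` is lowered by one when moved past `x`, `e_q x = x e_{q+1}`, and `xy`,
`yx` act on the `e_q` as linear polynomials in `k`, cyclicity of `T` gives the difference equation
`tau_sub_tau_succ`: `τ_q(R) - τ_{q+1}(R(X-1))` is `jump T q` times the value of `R` at `α_q - 1/2`.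
Conjugation by `h` gives the symmetry `tau_neg`.

Existence of a line formula. Take for `G/𝐏` the rational function whose residue at the `l`-th root
is `jump T l / n`; the jumps are antisymmetric and sum to zero over a period, which is exactly what
makes `G` palindromic (`isNumerator_numer`). By the residue theorem in the strip `-1 ≤ Re z ≤ 0` the
line integrals satisfy a difference equation of the same shape, but with the poles moved by integers
into that strip (`lineInt_sub_lineInt_succ`). A finite sum of evaluations telescopes to the
discrepancy (`pointPart_sub_pointPart_succ`). What remains solves the homogeneous equation, hence is
invariant under translation by `n`, hence is zero (`eq_zero_of_shift_family`).

Reduction to the strip. If `τ_0` is the line integral alone, compute `τ_0(Q(X+m)) - τ_0(Q(X-m))`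
twice: by the difference equation it is a combination of values of `Q` at the points `n r_q`, and by
contour integration it is a sum of residues in `|Re z| < m`. Integrability excludes poles on the
boundary lines (`reduced_denom_ne_zero`). Testing suitable `Q` shows that the poles of the reduced
weight, with multiplicity, are among the `n r_q` in the strip (`exists_strip_reduction`), so the
weight is one for `P_∘`. When `Q` is divisible by the product over those points no residue survives,
and after rescaling by `n` this is the trace condition for the type A algebra of `P_∘`; evenness of
`τ_0` gives invariance under the involution (`exists_invariant_trace`). -/

theorem isPrimitiveRoot_eps (hm : 0 < m) : IsPrimitiveRoot (eps m) (2 * m) :=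
  Complex.isPrimitiveRoot_exp (2 * m) (by omega)

theorem eps_ne_zero : eps m ≠ 0 := Complex.exp_ne_zero _

theorem eps_pow_sub_one_ne_zero (hm : 0 < m) {i : ℕ} (hi : i ∈ Finset.Ico 1 (2 * m)) :
    eps m ^ i - 1 ≠ 0 := by
  rw [Finset.mem_Ico] at hi
  exact sub_ne_zero.2 ((isPrimitiveRoot_eps hm).pow_ne_one_of_pos_of_lt (by omega) hi.2)

theorem eps_zpow_mul_period (hm : 0 < m) (i : ℤ) : eps m ^ (((2 * m : ℕ) : ℤ) * i) = 1 := by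
  rw [zpow_mul, zpow_natCast, (isPrimitiveRoot_eps hm).pow_eq_one, one_zpow]

theorem sum_Ico_one_reflect {M : Type*} [AddCommMonoid M] (n : ℕ) (f : ℕ → M) :
    ∑ i ∈ Finset.Ico 1 n, f (n - i) = ∑ i ∈ Finset.Ico 1 n, f i := by
  refine Finset.sum_nbij' (fun i => n - i) (fun i => n - i) ?_ ?_ ?_ ?_ ?_ <;>
    simp only [Finset.mem_Ico] <;> intros <;> first | omega | trivial

/-! ### The parameters `α_q` -/

theorem alpha_add_period (hm : 0 < m) (q j : ℤ) :
    alpha c (q + ((2 * m : ℕ) : ℤ) * j) = alpha c q := by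
  unfold alpha
  congr 1
  refine Finset.sum_congr rfl fun i _ => ?_
  have : -((i : ℤ) * (q + ((2 * m : ℕ) : ℤ) * j)) =
      -((i : ℤ) * q) + ((2 * m : ℕ) : ℤ) * (-(i * j)) := by ring
  rw [this, zpow_add₀ eps_ne_zero, eps_zpow_mul_period hm, mul_one]

theorem alpha_sub_alpha_succ (hm : 0 < m) (q : ℤ) :
    alpha c q - alpha c (q + 1) = (c 0)⁻¹ * ∑ i ∈ Finset.Ico 1 (2 * m),
      c (i : ZMod (2 * m)) * eps m ^ (-((i : ℤ) * (q + 1))) := by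
  unfold alpha
  rw [← mul_sub, ← Finset.sum_sub_distrib]
  congr 1
  refine Finset.sum_congr rfl fun i hi => ?_
  have h1 := eps_pow_sub_one_ne_zero hm hi
  have : -((i : ℤ) * q) = -((i : ℤ) * (q + 1)) + i := by ring
  rw [this, zpow_add₀ eps_ne_zero, zpow_natCast]
  field_simp

/-- Under `i ↦ n - i` the denominator gives `1/(ε^{-i} - 1) = -ε^i/(ε^i - 1)`, and this `ε^i`
absorbs the shift by one in the exponent `-i(q+1)`. -/
theorem alpha_neg_sub_one (hm : 0 < m) (hc_symm : ∀ i, c (-i) = c i) (q : ℤ) :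
    alpha c (-q - 1) = -alpha c q := by
  unfold alpha
  rw [← mul_neg, ← Finset.sum_neg_distrib, ← sum_Ico_one_reflect (2 * m)]
  congr 1
  refine Finset.sum_congr rfl fun i hi => ?_
  have h1 := eps_pow_sub_one_ne_zero hm hi
  rw [Finset.mem_Ico] at hi
  have h2 : ((2 * m - i : ℕ) : ZMod (2 * m)) = -(i : ZMod (2 * m)) := by
    rw [Nat.cast_sub hi.2.le, ZMod.natCast_self, zero_sub]
  have h3 : ((2 * m - i : ℕ) : ℤ) = ((2 * m : ℕ) : ℤ) - i := by
    rw [Nat.cast_sub hi.2.le]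
  have h4 : eps m ^ (2 * m - i) = (eps m ^ i)⁻¹ := by
    rw [← zpow_natCast, h3, sub_eq_add_neg, zpow_add₀ eps_ne_zero, zpow_natCast,
      (isPrimitiveRoot_eps hm).pow_eq_one, one_mul, zpow_neg, zpow_natCast]
  have h5 : -(((2 * m : ℕ) : ℤ) - i) * (-q - 1) =
      ((2 * m : ℕ) : ℤ) * (q + 1) + (-((i : ℤ) * q) + -(i : ℤ)) := by ring
  have h0 : eps m ^ i ≠ 0 := pow_ne_zero _ eps_ne_zero
  rw [h2, hc_symm, h3, h4, ← neg_mul, h5, zpow_add₀ eps_ne_zero, eps_zpow_mul_period hm, one_mul,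
    zpow_add₀ eps_ne_zero, zpow_neg _ (i : ℤ), zpow_natCast]
  have h6 : 1 - eps m ^ i ≠ 0 := by
    rw [← neg_sub]
    exact neg_ne_zero.2 h1
  have h7 : (eps m ^ i)⁻¹ - 1 = (1 - eps m ^ i) * (eps m ^ i)⁻¹ := by field_simp
  rw [h7]
  field_simp
  ring

/-! ### Commutation relations in `H_c` -/

/-- Elements `x`, `y` and `γ` of an algebra that satisfy the defining relations of `H_c`. -/
structure DicyclicRep {A : Type*} [Ring A] [Algebra ℂ A] (x y : A) (γ : QuaternionGroup m → A) :
    Prop where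
  one : γ 1 = 1
  mul : ∀ δ δ', γ δ * γ δ' = γ (δ * δ')
  gx : γ (QuaternionGroup.a 1) * x = eps m • (x * γ (QuaternionGroup.a 1))
  gy : γ (QuaternionGroup.a 1) * y = (eps m)⁻¹ • (y * γ (QuaternionGroup.a 1))
  hx : γ (QuaternionGroup.xa 0) * x = y * γ (QuaternionGroup.xa 0)
  hy : γ (QuaternionGroup.xa 0) * y = -(x * γ (QuaternionGroup.xa 0))
  comm : x * y - y * x = ∑ i ∈ Finset.range (2 * m), c (i : ZMod (2 * m)) •
    γ (QuaternionGroup.a (i : ZMod (2 * m)))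

/-- The image of a group element in `H_c`. -/
def gr (γ : QuaternionGroup m) : H m c := RingQuot.mkAlgHom ℂ (Rel m c) (fgrp γ)

theorem dicyclicRep_gr : DicyclicRep c (x c) (y c) (gr c) where
  one := by simpa [gr] using RingQuot.mkAlgHom_rel ℂ (Rel.one (m := m) (c := c))
  mul δ δ' := by simpa [gr] using RingQuot.mkAlgHom_rel ℂ (Rel.mul (m := m) (c := c) δ δ')
  gx := by simpa [gr, x] using RingQuot.mkAlgHom_rel ℂ (Rel.gx (m := m) (c := c))
  gy := by simpa [gr, y] using RingQuot.mkAlgHom_rel ℂ (Rel.gy (m := m) (c := c))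
  hx := by simpa [gr, x, y] using RingQuot.mkAlgHom_rel ℂ (Rel.hx (m := m) (c := c))
  hy := by
    refine Eq.trans ?_ ((RingQuot.mkAlgHom_rel ℂ (Rel.hy (m := m) (c := c))).trans ?_)
    · rw [map_mul]
      rfl
    · rw [map_neg, map_mul]
      rfl
  comm := by simpa [x, y, gr] using RingQuot.mkAlgHom_rel ℂ (Rel.comm (m := m) (c := c))

section DicyclicRep

variable {A : Type*} [Ring A] [Algebra ℂ A] (γ : QuaternionGroup m → A)

/-- The power `g ^ i` in a representation. -/
def gp (i : ℕ) : A := γ (QuaternionGroup.a (i : ZMod (2 * m)))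

/-- The group algebra part of `c_0 k`. -/
def kGrp : A := ∑ i ∈ Finset.Ico 1 (2 * m), (c (i : ZMod (2 * m)) / (eps m ^ i - 1)) • gp γ i

/-- The element `c` of the group algebra without its constant term. -/
def cGrp : A := ∑ i ∈ Finset.Ico 1 (2 * m), c (i : ZMod (2 * m)) • gp γ i

/-- The element `k` in a representation. -/
def kRep (x y : A) : A :=
  (c 0)⁻¹ • (x * y + kGrp c γ) - algebraMap ℂ A (1 / 2)

/-- The idempotent `e_q` in a representation. -/
def eRep (q : ℤ) : A :=
  (((2 * m : ℕ) : ℂ)⁻¹) • ∑ i ∈ Finset.range (2 * m), (eps m ^ ((i : ℤ) * q)) • gp γ i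

variable {c γ} {x y : A}

theorem kRep_eq : kRep c γ x y = (c 0)⁻¹ • (x * y + kGrp c γ) - (1 / 2 : ℂ) • (1 : A) := by
  rw [kRep, Algebra.algebraMap_eq_smul_one]

namespace DicyclicRep

theorem gp_zero (hr : DicyclicRep c x y γ) : gp γ 0 = 1 := by
  rw [gp, Nat.cast_zero, QuaternionGroup.a_zero, hr.one]

theorem gp_succ (hr : DicyclicRep c x y γ) (i : ℕ) :
    gp γ (i + 1) = γ (QuaternionGroup.a 1) * gp γ i := by
  rw [gp, gp, hr.mul, QuaternionGroup.a_mul_a, Nat.cast_succ, add_comm]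

theorem gp_period (hr : DicyclicRep c x y γ) : gp γ (2 * m) = 1 := by
  rw [← hr.gp_zero, gp, gp, ZMod.natCast_self, Nat.cast_zero]

theorem gp_mul_x (hr : DicyclicRep c x y γ) (i : ℕ) :
    gp γ i * x = eps m ^ i • (x * gp γ i) := by
  induction i with
  | zero => simp [hr.gp_zero]
  | succ i ih =>
    rw [hr.gp_succ, mul_assoc, ih, mul_smul_comm, ← mul_assoc, hr.gx, smul_mul_assoc, smul_smul,
      mul_assoc, pow_succ]

theorem gp_mul_y (hr : DicyclicRep c x y γ) (i : ℕ) :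
    gp γ i * y = (eps m ^ i)⁻¹ • (y * gp γ i) := by
  induction i with
  | zero => simp [hr.gp_zero]
  | succ i ih =>
    rw [hr.gp_succ, mul_assoc, ih, mul_smul_comm, ← mul_assoc, hr.gy, smul_mul_assoc, smul_smul,
      mul_assoc, pow_succ, mul_inv]

theorem h_mul_gp (hr : DicyclicRep c x y γ) {i : ℕ} (hi : i ≤ 2 * m) :
    γ (QuaternionGroup.xa 0) * gp γ i = gp γ (2 * m - i) * γ (QuaternionGroup.xa 0) := by
  rw [gp, gp, hr.mul, hr.mul, QuaternionGroup.xa_mul_a, QuaternionGroup.a_mul_xa, Nat.cast_sub hi,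
    ZMod.natCast_self, zero_sub, zero_sub, neg_neg, zero_add]

theorem y_mul_x (hr : DicyclicRep c x y γ) (hm : 0 < m) :
    y * x = x * y - c 0 • (1 : A) - cGrp c γ := by
  have h := hr.comm
  rw [Finset.range_eq_Ico, Finset.sum_eq_sum_Ico_succ_bot (by omega)] at h
  have h' : x * y - y * x = c 0 • (1 : A) + cGrp c γ := by
    rw [h, ← hr.gp_zero, cGrp, gp, Nat.cast_zero]
    rfl
  rw [sub_sub, ← h']
  abel

/-- The weight `a = 1/(ε^i - 1)` solves `ε^i a = a + 1`, so moving `x` across adds precisely `c_i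
g^i`. -/
theorem kGrp_mul_x (hr : DicyclicRep c x y γ) (hm : 0 < m) :
    kGrp c γ * x = x * (kGrp c γ + cGrp c γ) := by
  rw [kGrp, cGrp, ← Finset.sum_add_distrib, Finset.sum_mul, Finset.mul_sum]
  refine Finset.sum_congr rfl fun i hi => ?_
  have h1 := eps_pow_sub_one_ne_zero hm hi
  rw [smul_mul_assoc, hr.gp_mul_x, smul_smul, ← add_smul, mul_smul_comm]
  congr 1
  field_simp
  ring

/-- The `cGrp` term from `kGrp_mul_x` cancels the one in `yx = xy - c`; only `c_0` survives, and the
normalisation by `c_0` makes the step equal to one. -/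
theorem kRep_mul_x (hr : DicyclicRep c x y γ) (hm : 0 < m) (hc : c 0 ≠ 0) :
    kRep c γ x y * x = x * (kRep c γ x y - 1) := by
  rw [kRep_eq, sub_mul, smul_mul_assoc, add_mul, hr.kGrp_mul_x hm, mul_assoc x, hr.y_mul_x hm]
  have : x * (x * y - c 0 • (1 : A) - cGrp c γ) + x * (kGrp c γ + cGrp c γ) =
      x * (x * y + kGrp c γ) - c 0 • x := by
    simp only [mul_add, mul_sub, mul_smul_comm, mul_one]
    abel
  rw [this, smul_sub, smul_smul, inv_mul_cancel₀ hc, one_smul]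
  simp only [mul_sub, mul_smul_comm, mul_one, smul_mul_assoc, one_mul]
  abel

/-- Rests on `1/(ε^{-i} - 1) = -(1 + 1/(ε^i - 1))` together with `c_{-i} = c_i`. -/
theorem h_mul_kGrp (hr : DicyclicRep c x y γ) (hm : 0 < m) (hc_symm : ∀ i, c (-i) = c i) :
    γ (QuaternionGroup.xa 0) * kGrp c γ =
      -((kGrp c γ + cGrp c γ) * γ (QuaternionGroup.xa 0)) := by
  rw [kGrp, cGrp, ← Finset.sum_add_distrib, Finset.sum_mul, Finset.mul_sum,
    ← Finset.sum_neg_distrib]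
  conv_rhs => rw [← sum_Ico_one_reflect]
  refine Finset.sum_congr rfl fun i hi => ?_
  have h1 := eps_pow_sub_one_ne_zero hm hi
  rw [Finset.mem_Ico] at hi
  have h2 : ((2 * m - i : ℕ) : ZMod (2 * m)) = -(i : ZMod (2 * m)) := by
    rw [Nat.cast_sub hi.2.le, ZMod.natCast_self, zero_sub]
  have h0 : eps m ^ i ≠ 0 := pow_ne_zero _ eps_ne_zero
  have h4 : eps m ^ (2 * m - i) = (eps m ^ i)⁻¹ := by
    rw [pow_sub₀ _ eps_ne_zero hi.2.le, (isPrimitiveRoot_eps hm).pow_eq_one, one_mul]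
  rw [h2, hc_symm, h4, mul_smul_comm, hr.h_mul_gp hi.2.le, ← add_smul, smul_mul_assoc,
    ← neg_smul]
  congr 1
  have h6 : 1 - eps m ^ i ≠ 0 := by
    rw [← neg_sub]
    exact neg_ne_zero.2 h1
  have h7 : (eps m ^ i)⁻¹ - 1 = (1 - eps m ^ i) * (eps m ^ i)⁻¹ := by field_simp
  rw [h7]
  field_simp
  ring

theorem h_mul_kRep (hr : DicyclicRep c x y γ) (hm : 0 < m) (hc : c 0 ≠ 0)
    (hc_symm : ∀ i, c (-i) = c i) :
    γ (QuaternionGroup.xa 0) * kRep c γ x y = -(kRep c γ x y) * γ (QuaternionGroup.xa 0) := by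
  have h1 : γ (QuaternionGroup.xa 0) * (x * y) = -(y * x * γ (QuaternionGroup.xa 0)) := by
    rw [← mul_assoc, hr.hx, mul_assoc, hr.hy, mul_neg, mul_assoc]
  rw [kRep_eq, mul_sub, mul_smul_comm, mul_add, hr.h_mul_kGrp hm hc_symm, h1, hr.y_mul_x hm]
  generalize γ (QuaternionGroup.xa 0) = h
  have : -((x * y - c 0 • (1 : A) - cGrp c γ) * h) + -((kGrp c γ + cGrp c γ) * h) =
      -((x * y + kGrp c γ) * h) + c 0 • h := by
    simp only [add_mul, sub_mul, smul_mul_assoc, one_mul]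
    abel
  rw [this, smul_add, smul_smul, inv_mul_cancel₀ hc, one_smul]
  simp only [sub_mul, neg_mul, mul_smul_comm, mul_one, smul_mul_assoc, one_mul]
  module

theorem commute_gp_kRep (hr : DicyclicRep c x y γ) (i : ℕ) : Commute (gp γ i) (kRep c γ x y) := by
  have hg : ∀ j, Commute (gp γ i) (gp γ j) := fun j => by
    unfold Commute SemiconjBy
    rw [gp, gp, hr.mul, hr.mul, QuaternionGroup.a_mul_a, QuaternionGroup.a_mul_a, add_comm]
  have hxy : Commute (gp γ i) (x * y) := by
    unfold Commute SemiconjBy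
    rw [← mul_assoc, hr.gp_mul_x, smul_mul_assoc, mul_assoc, hr.gp_mul_y, mul_smul_comm, smul_smul,
      mul_inv_cancel₀ (pow_ne_zero _ eps_ne_zero), one_smul, mul_assoc]
  rw [kRep_eq]
  refine Commute.sub_right (Commute.smul_right (hxy.add_right ?_) _)
    ((Commute.one_right _).smul_right _)
  exact Commute.sum_right _ _ _ fun j _ => (hg j).smul_right _

theorem commute_eRep_kRep (hr : DicyclicRep c x y γ) (q : ℤ) :
    Commute (eRep γ q) (kRep c γ x y) :=
  (Commute.sum_left _ _ _ fun i _ => (hr.commute_gp_kRep i).smul_left _).smul_left _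

theorem eRep_mul_x (hr : DicyclicRep c x y γ) (q : ℤ) :
    eRep γ q * x = x * eRep γ (q + 1) := by
  rw [eRep, eRep, smul_mul_assoc, mul_smul_comm, Finset.sum_mul, Finset.mul_sum]
  congr 1
  refine Finset.sum_congr rfl fun i _ => ?_
  rw [smul_mul_assoc, hr.gp_mul_x, smul_smul, mul_smul_comm, mul_add, mul_one,
    zpow_add₀ eps_ne_zero, zpow_natCast]

theorem gp_mul_eRep (hr : DicyclicRep c x y γ) (hm : 0 < m) (i : ℕ) (q : ℤ) :
    gp γ i * eRep γ q = eps m ^ (-((i : ℤ) * q)) • eRep γ q := by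
  induction i with
  | zero => simp [hr.gp_zero]
  | succ i ih =>
    have h : γ (QuaternionGroup.a 1) * eRep γ q = eps m ^ (-q) • eRep γ q := by
      rw [eRep, mul_smul_comm, smul_comm]
      congr 1
      rw [Finset.mul_sum, Finset.smul_sum]
      have h1 : ∀ i : ℕ, γ (QuaternionGroup.a 1) * eps m ^ ((i : ℤ) * q) • gp γ i =
          eps m ^ (-q) • (eps m ^ (((i + 1 : ℕ) : ℤ) * q) • gp γ (i + 1)) := fun i => by
        rw [mul_smul_comm, ← hr.gp_succ, smul_smul, ← zpow_add₀ eps_ne_zero]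
        congr 2
        push_cast
        ring
      rw [Finset.sum_congr rfl fun i _ => h1 i, ← Finset.smul_sum, ← Finset.smul_sum]
      congr 1
      have h2 := Finset.sum_range_succ (fun i : ℕ => eps m ^ ((i : ℤ) * q) • gp γ i) (2 * m)
      rw [Finset.sum_range_succ'] at h2
      rw [eps_zpow_mul_period hm, hr.gp_period] at h2
      simpa [hr.gp_zero] using h2
    rw [hr.gp_succ, mul_assoc, ih, mul_smul_comm, h, smul_smul, ← zpow_add₀ eps_ne_zero]
    congr 2
    push_cast
    ring

theorem kGrp_mul_eRep (hr : DicyclicRep c x y γ) (hm : 0 < m) (hc : c 0 ≠ 0) (q : ℤ) :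
    kGrp c γ * eRep γ q = (c 0 * alpha c q) • eRep γ q := by
  rw [kGrp, alpha, mul_inv_cancel_left₀ hc, Finset.sum_mul, Finset.sum_smul]
  refine Finset.sum_congr rfl fun i _ => ?_
  rw [smul_mul_assoc, hr.gp_mul_eRep hm, smul_smul, div_mul_eq_mul_div]

theorem cGrp_mul_eRep (hr : DicyclicRep c x y γ) (hm : 0 < m) (hc : c 0 ≠ 0) (q : ℤ) :
    cGrp c γ * eRep γ (q + 1) = (c 0 * (alpha c q - alpha c (q + 1))) • eRep γ (q + 1) := by
  rw [cGrp, alpha_sub_alpha_succ c hm, mul_inv_cancel_left₀ hc, Finset.sum_mul, Finset.sum_smul]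
  refine Finset.sum_congr rfl fun i _ => ?_
  rw [smul_mul_assoc, hr.gp_mul_eRep hm, smul_smul]

/-- Group elements act on `e_q` by scalars, so there `xy` is linear in `k`. The companion for `yx`
on `e_{q+1}` has its root one unit higher, with the same `α_q`. -/
theorem kRep_sub_mul_eRep (hr : DicyclicRep c x y γ) (hm : 0 < m) (hc : c 0 ≠ 0) (q : ℤ) :
    (kRep c γ x y - (alpha c q - 1 / 2) • (1 : A)) * eRep γ q =
      (c 0)⁻¹ • (x * y * eRep γ q) := by
  rw [kRep_eq]
  simp only [sub_mul, smul_mul_assoc, add_mul, one_mul, hr.kGrp_mul_eRep hm hc, smul_add,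
    smul_smul, inv_mul_cancel_left₀ hc]
  module

theorem kRep_sub_mul_eRep_succ (hr : DicyclicRep c x y γ) (hm : 0 < m) (hc : c 0 ≠ 0) (q : ℤ) :
    (kRep c γ x y - (alpha c q + 1 / 2) • (1 : A)) * eRep γ (q + 1) =
      (c 0)⁻¹ • (y * x * eRep γ (q + 1)) := by
  rw [kRep_eq, hr.y_mul_x hm]
  simp only [sub_mul, smul_mul_assoc, add_mul, one_mul, hr.kGrp_mul_eRep hm hc,
    hr.cGrp_mul_eRep hm hc, smul_add, smul_smul, smul_sub, inv_mul_cancel_left₀ hc,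
    inv_mul_cancel₀ hc]
  module

theorem h_mul_eRep (hr : DicyclicRep c x y γ) (hm : 0 < m) (q : ℤ) :
    γ (QuaternionGroup.xa 0) * eRep γ q = eRep γ (-q) * γ (QuaternionGroup.xa 0) := by
  rw [eRep, eRep, smul_mul_assoc, mul_smul_comm, Finset.sum_mul, Finset.mul_sum]
  congr 1
  rw [Finset.range_eq_Ico, Finset.sum_eq_sum_Ico_succ_bot (by omega : 0 < 2 * m),
    Finset.sum_eq_sum_Ico_succ_bot (by omega : 0 < 2 * m), zero_add]
  congr 1
  · simp [hr.gp_zero]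
  rw [← sum_Ico_one_reflect (2 * m) fun i : ℕ =>
    eps m ^ ((i : ℤ) * -q) • gp γ i * γ (QuaternionGroup.xa 0)]
  refine Finset.sum_congr rfl fun i hi => ?_
  rw [Finset.mem_Ico] at hi
  rw [mul_smul_comm, hr.h_mul_gp hi.2.le, smul_mul_assoc, Nat.cast_sub hi.2.le]
  congr 1
  rw [show (((2 * m : ℕ) : ℤ) - (i : ℤ)) * -q = ((2 * m : ℕ) : ℤ) * (-q) + i * q by ring,
    zpow_add₀ eps_ne_zero, eps_zpow_mul_period hm, one_mul]

end DicyclicRep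

theorem eRep_add_period (hm : 0 < m) (q j : ℤ) :
    eRep γ (q + ((2 * m : ℕ) : ℤ) * j) = eRep γ q := by
  unfold eRep
  congr 1
  refine Finset.sum_congr rfl fun i _ => ?_
  rw [show (i : ℤ) * (q + ((2 * m : ℕ) : ℤ) * j) = i * q + ((2 * m : ℕ) : ℤ) * (i * j) by ring,
    zpow_add₀ eps_ne_zero, eps_zpow_mul_period hm, mul_one]

theorem commute_aeval {a b : A} (h : Commute a b) (R : ℂ[X]) : Commute a (aeval b R) := by
  induction R using Polynomial.induction_on' with
  | add p q hp hq => simpa using hp.add_right hq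
  | monomial n r =>
    rw [aeval_monomial]
    exact (show Commute a (algebraMap ℂ A r) from (Algebra.commutes r a).symm).mul_right
      (h.pow_right n)

theorem aeval_mul_of_semiconj {a b b' : A} (h : b * a = a * b') (R : ℂ[X]) :
    aeval b R * a = a * aeval b' R := by
  induction R using Polynomial.induction_on' with
  | add p q hp hq => simp [add_mul, mul_add, hp, hq]
  | monomial n r =>
    have hn : b ^ n * a = a * b' ^ n :=
      ((show SemiconjBy a b' b from h.symm).pow_right n).eq.symm
    rw [aeval_monomial, aeval_monomial, mul_assoc, hn, ← mul_assoc, Algebra.commutes, mul_assoc]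

/-- The linear factor on the left is `xy`, the one on the right is `yx`. Cyclicity exchanges them,
and carrying `x` past `e_q` and `R(k)` raises `q` by one and lowers `k` by one. -/
theorem DicyclicRep.trace_shift (hr : DicyclicRep c x y γ) (hm : 0 < m) (hc : c 0 ≠ 0)
    {T : A →ₗ[ℂ] ℂ} (hT : IsTrace T) (q : ℤ) (R : ℂ[X]) :
    T (aeval (kRep c γ x y) ((X - C (alpha c q - 1 / 2)) * R) * eRep γ q) =
      T (aeval (kRep c γ x y) ((X - C (alpha c q + 1 / 2)) * R.comp (X - 1)) *
        eRep γ (q + 1)) := by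
  have hR : aeval (kRep c γ x y) (R.comp (X - 1)) = aeval (kRep c γ x y - 1) R := by
    rw [aeval_comp]
    simp
  rw [mul_comm, mul_comm (X - C (alpha c q + 1 / 2)), map_mul (aeval (kRep c γ x y)),
    map_mul (aeval (kRep c γ x y)), hR]
  have hX : ∀ s : ℂ, aeval (kRep c γ x y) (X - C s) = kRep c γ x y - s • (1 : A) := fun s => by
    rw [map_sub, aeval_X, aeval_C, Algebra.algebraMap_eq_smul_one]
  rw [hX, hX]
  have hcomm : Commute (eRep γ (q + 1)) (aeval (kRep c γ x y - 1) R) :=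
    commute_aeval ((hr.commute_eRep_kRep (q + 1)).sub_right (Commute.one_right _)) R
  have hcomm' : Commute (eRep γ q) (aeval (kRep c γ x y) R) :=
    commute_aeval (hr.commute_eRep_kRep q) R
  have hs := hr.kRep_sub_mul_eRep hm hc q
  have hs' := hr.kRep_sub_mul_eRep_succ hm hc q
  have hx := aeval_mul_of_semiconj (hr.kRep_mul_x hm hc) R
  have hk : Commute (aeval (kRep c γ x y - 1) R)
      (kRep c γ x y - (alpha c q + 1 / 2) • (1 : A)) := by
    refine (commute_aeval (Commute.sub_right ?_ (Commute.one_right _)) R).symm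
    exact (Commute.refl _).sub_left ((Commute.one_left _).smul_left _)
  clear hX
  generalize kRep c γ x y = k at *
  rw [mul_assoc, hs, mul_smul_comm, map_smul, hk.eq,
    mul_assoc (k - _), ← hcomm.eq, ← mul_assoc (k - _), hs', smul_mul_assoc, map_smul]
  congr 1
  calc T (aeval k R * (x * y * eRep γ q))
      = T (aeval k R * x * (y * eRep γ q)) := by simp only [mul_assoc]
    _ = T (y * eRep γ q * (aeval k R * x)) := hT _ _
    _ = T (y * (eRep γ q * aeval k R) * x) := by simp only [mul_assoc]
    _ = T (y * (aeval k R * (eRep γ q * x))) := by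
        rw [hcomm'.eq]
        simp only [mul_assoc]
    _ = T (y * ((aeval k R * x) * eRep γ (q + 1))) := by
        rw [hr.eRep_mul_x, mul_assoc]
    _ = T (y * (x * (aeval (k - 1) R * eRep γ (q + 1)))) := by
        rw [hx, mul_assoc]
    _ = _ := by
        rw [← hcomm.eq]
        simp only [mul_assoc]

/-- Traces are invariant under conjugation by `h`, which negates `k` and takes `e_q` to `e_{-q}`. -/
theorem DicyclicRep.trace_neg (hr : DicyclicRep c x y γ) (hm : 0 < m) (hc : c 0 ≠ 0)
    (hc_symm : ∀ i, c (-i) = c i) {T : A →ₗ[ℂ] ℂ} (hT : IsTrace T) (q : ℤ) (R : ℂ[X]) :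
    T (aeval (kRep c γ x y) (R.comp (-X)) * eRep γ (-q)) =
      T (aeval (kRep c γ x y) R * eRep γ q) := by
  have hR : aeval (kRep c γ x y) (R.comp (-X)) = aeval (-kRep c γ x y) R := by
    rw [aeval_comp]
    simp
  have h1 := aeval_mul_of_semiconj (hr.h_mul_kRep hm hc hc_symm).symm R
  have h2 : γ (QuaternionGroup.xa 0)⁻¹ * γ (QuaternionGroup.xa 0) = 1 := by
    rw [hr.mul, inv_mul_cancel, hr.one]
  have h3 : γ (QuaternionGroup.xa 0) * γ (QuaternionGroup.xa 0)⁻¹ = 1 := by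
    rw [hr.mul, mul_inv_cancel, hr.one]
  rw [hR]
  calc T (aeval (-kRep c γ x y) R * eRep γ (-q))
      = T (aeval (-kRep c γ x y) R * (eRep γ (-q) * γ (QuaternionGroup.xa 0)) *
          γ (QuaternionGroup.xa 0)⁻¹) := by
        simp only [mul_assoc, h3, mul_one]
    _ = T (γ (QuaternionGroup.xa 0) * (aeval (kRep c γ x y) R * eRep γ q) *
          γ (QuaternionGroup.xa 0)⁻¹) := by
        rw [← hr.h_mul_eRep hm, ← mul_assoc, h1, mul_assoc (γ (QuaternionGroup.xa 0))]
    _ = T (γ (QuaternionGroup.xa 0)⁻¹ *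
          (γ (QuaternionGroup.xa 0) * (aeval (kRep c γ x y) R * eRep γ q))) := hT _ _
    _ = _ := by rw [← mul_assoc, h2, one_mul]

end DicyclicRep

/-! ### The functionals `R ↦ T(R(k) e_q)` -/

variable {c}

/-- The functional `R ↦ T(R(k) e_q)`. -/
def tau (T : H m c →ₗ[ℂ] ℂ) (q : ℤ) : ℂ[X] →ₗ[ℂ] ℂ :=
  T ∘ₗ LinearMap.mulRight ℂ (e c q) ∘ₗ (aeval (k c)).toLinearMap

theorem tau_apply (T : H m c →ₗ[ℂ] ℂ) (q : ℤ) (R : ℂ[X]) :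
    tau T q R = T (aeval (k c) R * e c q) := rfl

theorem tau_add_period (hm : 0 < m) (T : H m c →ₗ[ℂ] ℂ) (q j : ℤ) :
    tau T (q + ((2 * m : ℕ) : ℤ) * j) = tau T q := by
  have h : e c (q + ((2 * m : ℕ) : ℤ) * j) = e c q := eRep_add_period (γ := gr c) hm q j
  rw [tau, tau, h]

theorem tau_shift (hm : 0 < m) (hc : c 0 ≠ 0) {T : H m c →ₗ[ℂ] ℂ} (hT : IsTrace T) (q : ℤ)
    (R : ℂ[X]) :
    tau T q ((X - C (alpha c q - 1 / 2)) * R) =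
      tau T (q + 1) ((X - C (alpha c q + 1 / 2)) * R.comp (X - 1)) :=
  (dicyclicRep_gr c).trace_shift hm hc hT q R

theorem tau_neg (hm : 0 < m) (hc : c 0 ≠ 0) (hc_symm : ∀ i, c (-i) = c i)
    {T : H m c →ₗ[ℂ] ℂ} (hT : IsTrace T) (q : ℤ) (R : ℂ[X]) :
    tau T (-q) (R.comp (-X)) = tau T q R :=
  (dicyclicRep_gr c).trace_neg hm hc hc_symm hT q R

end TypeD
end

/-! ### Type A algebras: from functionals on `ℂ[z]` to invariant traces. -/

noncomputable section
namespace TypeD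
open Polynomial

/-! ### Traces on the type A deformations -/

/-- Elements of an algebra that satisfy the defining relations of `DeformA P`. -/
structure TypeARep {A : Type*} [Ring A] [Algebra ℂ A] (P : ℂ[X]) (u v z : A) : Prop where
  zu : z * u - u * z = -u
  zv : z * v - v * z = v
  uv : u * v = aeval (z + algebraMap ℂ A (1 / 2)) P
  vu : v * u = aeval (z - algebraMap ℂ A (1 / 2)) P

theorem typeARep_genA (P : ℂ[X]) :
    TypeARep P (genA P GenA.u) (genA P GenA.v) (genA P GenA.z) where
  zu := by
    refine Eq.trans ?_ ((RingQuot.mkAlgHom_rel ℂ (RelA.zu (P := P))).trans ?_)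
    · rw [map_sub, map_mul, map_mul]
      rfl
    · rw [map_neg]
      rfl
  zv := by
    refine Eq.trans ?_ ((RingQuot.mkAlgHom_rel ℂ (RelA.zv (P := P))).trans ?_)
    · rw [map_sub, map_mul, map_mul]
      rfl
    · rfl
  uv := by
    refine Eq.trans ?_ ((RingQuot.mkAlgHom_rel ℂ (RelA.uv (P := P))).trans ?_)
    · rw [map_mul]
      rfl
    · rw [← aeval_algHom_apply, map_add, AlgHom.commutes]
      rfl
  vu := by
    refine Eq.trans ?_ ((RingQuot.mkAlgHom_rel ℂ (RelA.vu (P := P))).trans ?_)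
    · rw [map_mul]
      rfl
    · rw [← aeval_algHom_apply, map_sub, AlgHom.commutes]
      rfl

/-- The images of the generators under the morphism given by `u`, `v`, `z`. -/
def genAImage {A : Type*} (u v z : A) : GenA → A
  | GenA.u => u
  | GenA.v => v
  | GenA.z => z

/-- The algebra morphism from `DeformA P` determined by a representation. -/
def TypeARep.lift {A : Type*} [Ring A] [Algebra ℂ A] {P : ℂ[X]} {u v z : A}
    (h : TypeARep P u v z) : DeformA P →ₐ[ℂ] A :=
  RingQuot.liftAlgHom ℂ ⟨FreeAlgebra.lift ℂ (genAImage u v z), by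
    intro a b hab
    induction hab with
    | zu => simpa [genAImage] using h.zu
    | zv => simpa [genAImage] using h.zv
    | uv => simpa [genAImage, ← aeval_algHom_apply] using h.uv
    | vu => simpa [genAImage, ← aeval_algHom_apply] using h.vu⟩

theorem TypeARep.lift_genA {A : Type*} [Ring A] [Algebra ℂ A] {P : ℂ[X]} {u v z : A}
    (h : TypeARep P u v z) (s : GenA) : h.lift (genA P s) = genAImage u v z s := by
  rw [TypeARep.lift, genA, RingQuot.liftAlgHom_mkAlgHom_apply, FreeAlgebra.lift_ι_apply]

/-- A linear subspace of `DeformA P` that contains `1` and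
is stable under left multiplication by the generators is everything. -/
theorem deformA_submodule_eq_top {P : ℂ[X]} (S : Submodule ℂ (DeformA P)) (h1 : 1 ∈ S)
    (hg : ∀ s, ∀ a ∈ S, genA P s * a ∈ S) : S = ⊤ := by
  have key : ∀ f : FreeAlgebra ℂ GenA, ∀ a ∈ S, RingQuot.mkAlgHom ℂ (RelA P) f * a ∈ S := by
    intro f
    induction f using FreeAlgebra.induction with
    | grade0 r =>
      intro a ha
      rw [AlgHom.commutes, ← Algebra.smul_def]
      exact S.smul_mem r ha
    | grade1 s => exact hg s
    | mul f g hf hg =>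
      intro a ha
      rw [map_mul, mul_assoc]
      exact hf _ (hg _ ha)
    | add f g hf hg =>
      intro a ha
      rw [map_add, add_mul]
      exact S.add_mem (hf _ ha) (hg _ ha)
  rw [eq_top_iff]
  intro b _
  obtain ⟨f, rfl⟩ := RingQuot.mkAlgHom_surjective ℂ (RelA P) b
  simpa using key f 1 h1

namespace TypeARep

variable {A : Type*} [Ring A] [Algebra ℂ A] {P : ℂ[X]} {u v z : A}

theorem u_mul_aeval (h : TypeARep P u v z) (i : ℕ) (b : ℂ[X]) :
    u ^ i * aeval z b = aeval z (b.comp (X + C (i : ℂ))) * u ^ i := by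
  induction i generalizing b with
  | zero => simp
  | succ i ih =>
    have h1 : (z + 1) * u = u * z := by
      rw [add_mul, one_mul, ← sub_eq_zero]
      have := h.zu
      rw [← sub_eq_zero] at this
      rw [← this]
      abel
    have h2 : aeval z (b.comp (X + C (1 : ℂ))) = aeval (z + 1) b := by
      rw [aeval_comp]
      simp
    rw [pow_succ, mul_assoc, ← aeval_mul_of_semiconj h1 b, ← h2, ← mul_assoc, ih, mul_assoc,
      comp_assoc]
    congr 3
    simp
    ring

theorem v_mul_aeval (h : TypeARep P u v z) (i : ℕ) (b : ℂ[X]) :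
    v ^ i * aeval z b = aeval z (b.comp (X - C (i : ℂ))) * v ^ i := by
  induction i generalizing b with
  | zero => simp
  | succ i ih =>
    have h1 : (z - 1) * v = v * z := by
      rw [sub_mul, one_mul, ← sub_eq_zero]
      have := h.zv
      rw [← sub_eq_zero] at this
      rw [← this]
      abel
    have h2 : aeval z (b.comp (X - C (1 : ℂ))) = aeval (z - 1) b := by
      rw [aeval_comp]
      simp
    rw [pow_succ, mul_assoc, ← aeval_mul_of_semiconj h1 b, ← h2, ← mul_assoc, ih, mul_assoc,
      comp_assoc]
    congr 3
    simp
    ring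

theorem u_mul_v (h : TypeARep P u v z) : u * v = aeval z (P.comp (X + C (1 / 2))) := by
  rw [h.uv, aeval_comp]
  simp

theorem v_mul_u (h : TypeARep P u v z) : v * u = aeval z (P.comp (X - C (1 / 2))) := by
  rw [h.vu, aeval_comp]
  simp

/-- A representation generates its algebra: a linear subspace that contains `1` and is stable
under left multiplication by `u`, `v`, `z` is everything. -/
def Generates (u v z : A) : Prop := ∀ S : Submodule ℂ A, 1 ∈ S → (∀ a ∈ S, u * a ∈ S) →
  (∀ a ∈ S, v * a ∈ S) → (∀ a ∈ S, z * a ∈ S) → ∀ a, a ∈ S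

/-- To prove a linear identity on the algebra, it is enough to check it on `b(z) u ^ i` and
`b(z) v ^ (i + 1)`. -/
theorem linear_ext (h : TypeARep P u v z) (hg : Generates u v z) {T T' : A →ₗ[ℂ] ℂ}
    (hu : ∀ (b : ℂ[X]) (i : ℕ), T (aeval z b * u ^ i) = T' (aeval z b * u ^ i))
    (hv : ∀ (b : ℂ[X]) (i : ℕ), T (aeval z b * v ^ (i + 1)) = T' (aeval z b * v ^ (i + 1)))
    (a : A) :
    T a = T' a := by
  let s : Set A := {a | ∃ (b : ℂ[X]) (i : ℕ), a = aeval z b * u ^ i} ∪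
    {a | ∃ (b : ℂ[X]) (i : ℕ), a = aeval z b * v ^ (i + 1)}
  have hs : ∀ a, a ∈ Submodule.span ℂ s := by
    have hl : ∀ w : A, (∀ a ∈ s, w * a ∈ Submodule.span ℂ s) →
        ∀ a ∈ Submodule.span ℂ s, w * a ∈ Submodule.span ℂ s := by
      intro w hw a ha
      have : Submodule.span ℂ s ≤ (Submodule.span ℂ s).comap (LinearMap.mulLeft ℂ w) :=
        Submodule.span_le.2 hw
      exact this ha
    have hU : ∀ (b : ℂ[X]) (i : ℕ), aeval z b * u ^ i ∈ Submodule.span ℂ s := fun b i =>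
      Submodule.subset_span (Or.inl ⟨b, i, rfl⟩)
    have hV : ∀ (b : ℂ[X]) (i : ℕ), aeval z b * v ^ i ∈ Submodule.span ℂ s := fun b i => by
      cases i with
      | zero => simpa using hU b 0
      | succ i => exact Submodule.subset_span (Or.inr ⟨b, i, rfl⟩)
    refine hg _ (by simpa using hU 1 0) (hl u ?_) (hl v ?_) (hl z ?_)
    · rintro a (⟨b, i, rfl⟩ | ⟨b, i, rfl⟩)
      · have := h.u_mul_aeval 1 b
        rw [pow_one] at this
        rw [← mul_assoc, this, mul_assoc, ← pow_succ']
        exact hU _ _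
      · have := h.u_mul_aeval 1 b
        rw [pow_one] at this
        rw [← mul_assoc, this, mul_assoc, pow_succ', ← mul_assoc u, h.u_mul_v, ← mul_assoc,
          ← map_mul]
        exact hV _ _
    · rintro a (⟨b, i, rfl⟩ | ⟨b, i, rfl⟩)
      · have := h.v_mul_aeval 1 b
        rw [pow_one] at this
        rw [← mul_assoc, this, mul_assoc]
        cases i with
        | zero => simpa using hV (b.comp (X - 1)) 1
        | succ i =>
          rw [pow_succ', ← mul_assoc v, h.v_mul_u, ← mul_assoc, ← map_mul]
          exact hU _ _
      · have := h.v_mul_aeval 1 b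
        rw [pow_one] at this
        rw [← mul_assoc, this, mul_assoc, ← pow_succ']
        exact hV _ _
    · have hz : ∀ b : ℂ[X], z * aeval z b = aeval z (X * b) := fun b => by rw [map_mul, aeval_X]
      rintro a (⟨b, i, rfl⟩ | ⟨b, i, rfl⟩)
      · rw [← mul_assoc, hz]
        exact hU _ _
      · rw [← mul_assoc, hz]
        exact hV _ _
  have : Submodule.span ℂ s ≤ LinearMap.eqLocus T T' := by
    refine Submodule.span_le.2 ?_
    rintro a (⟨b, i, rfl⟩ | ⟨b, i, rfl⟩)
    · exact hu b i
    · exact hv b i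
  exact this (hs a)

/-- Two traces that agree on polynomials in `z` are equal. -/
theorem trace_ext (h : TypeARep P u v z) (hg : Generates u v z) {T T' : A →ₗ[ℂ] ℂ}
    (hT : IsTrace T) (hT' : IsTrace T') (hz : ∀ b : ℂ[X], T (aeval z b) = T' (aeval z b)) (a : A) :
    T a = T' a := by
  -- Commuting with `z` multiplies an element of nonzero weight by a nonzero scalar, so every trace
  -- kills it.
  have hu : ∀ T : A →ₗ[ℂ] ℂ, IsTrace T → ∀ (b : ℂ[X]) (i : ℕ), T (aeval z b * u ^ (i + 1)) = 0 := by
    intro T hT b i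
    have h1 := hT (aeval z b * u ^ (i + 1)) z
    have h2 := h.u_mul_aeval (i + 1) X
    rw [aeval_X, X_comp] at h2
    have h3 : z * aeval z b = aeval z b * z := (commute_aeval (Commute.refl z) b).eq
    rw [mul_assoc, h2, ← mul_assoc z, h3, map_add, aeval_X, aeval_C,
      Algebra.algebraMap_eq_smul_one, add_mul, mul_add, smul_mul_assoc, one_mul, mul_smul_comm,
      map_add, map_smul, mul_assoc, add_eq_left, smul_eq_mul, mul_eq_zero] at h1
    exact h1.resolve_left (Nat.cast_ne_zero.2 i.succ_ne_zero)
  have hv : ∀ T : A →ₗ[ℂ] ℂ, IsTrace T → ∀ (b : ℂ[X]) (i : ℕ), T (aeval z b * v ^ (i + 1)) = 0 := by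
    intro T hT b i
    have h1 := hT (aeval z b * v ^ (i + 1)) z
    have h2 := h.v_mul_aeval (i + 1) X
    rw [aeval_X, X_comp] at h2
    have h3 : z * aeval z b = aeval z b * z := (commute_aeval (Commute.refl z) b).eq
    rw [mul_assoc, h2, ← mul_assoc z, h3, map_sub, aeval_X, aeval_C,
      Algebra.algebraMap_eq_smul_one, sub_mul, mul_sub, smul_mul_assoc, one_mul, mul_smul_comm,
      map_sub, map_smul, mul_assoc, sub_eq_self, smul_eq_mul, mul_eq_zero] at h1
    exact h1.resolve_left (Nat.cast_ne_zero.2 i.succ_ne_zero)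
  refine h.linear_ext hg (fun b i => ?_) (fun b i => ?_) a
  · cases i with
    | zero => simpa using hz b
    | succ i => rw [hu T hT, hu T' hT']
  · rw [hv T hT, hv T' hT']

/-- A functional of weight zero is a trace as soon as it satisfies the trace condition for `u`
and `v` in the lowest weights. -/
theorem isTrace_of_weight_zero (h : TypeARep P u v z) (hg : Generates u v z) {T : A →ₗ[ℂ] ℂ}
    (hu : ∀ (b : ℂ[X]) (i : ℕ), T (aeval z b * u ^ (i + 1)) = 0)
    (hv : ∀ (b : ℂ[X]) (i : ℕ), T (aeval z b * v ^ (i + 1)) = 0)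
    (hP : ∀ b : ℂ[X], T (aeval z (b.comp (X + C 1) * P.comp (X + C (1 / 2)))) =
      T (aeval z (b * P.comp (X - C (1 / 2))))) : IsTrace T := by
  have hzz : ∀ b : ℂ[X], z * aeval z b = aeval z b * z := fun b =>
    (commute_aeval (Commute.refl z) b).eq
  have hZ : ∀ a, T (z * a) = T (a * z) := by
    refine h.linear_ext hg (T := T ∘ₗ LinearMap.mulLeft ℂ z) (T' := T ∘ₗ LinearMap.mulRight ℂ z)
      (fun b i => ?_) (fun b i => ?_)
    · have h2 := h.u_mul_aeval i X
      rw [aeval_X] at h2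
      simp only [LinearMap.comp_apply, LinearMap.mulLeft_apply, LinearMap.mulRight_apply]
      rw [mul_assoc, h2, ← mul_assoc, ← mul_assoc, hzz, ← map_mul]
      nth_rewrite 2 [← aeval_X (R := ℂ) z]
      rw [← map_mul]
      cases i with
      | zero => simp
      | succ i => rw [hu, hu]
    · have h2 := h.v_mul_aeval (i + 1) X
      rw [aeval_X] at h2
      simp only [LinearMap.comp_apply, LinearMap.mulLeft_apply, LinearMap.mulRight_apply]
      rw [mul_assoc, h2, ← mul_assoc, ← mul_assoc, hzz, ← map_mul]
      nth_rewrite 2 [← aeval_X (R := ℂ) z]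
      rw [← map_mul, hv, hv]
  have hU : ∀ a, T (u * a) = T (a * u) := by
    refine h.linear_ext hg (T := T ∘ₗ LinearMap.mulLeft ℂ u) (T' := T ∘ₗ LinearMap.mulRight ℂ u)
      (fun b i => ?_) (fun b i => ?_)
    · have h2 := h.u_mul_aeval 1 b
      rw [pow_one] at h2
      simp only [LinearMap.comp_apply, LinearMap.mulLeft_apply, LinearMap.mulRight_apply]
      rw [← mul_assoc, h2, mul_assoc, mul_assoc, ← pow_succ', ← pow_succ, hu, hu]
    · have h2 := h.u_mul_aeval 1 b
      have h3 := h.v_mul_aeval i (P.comp (X - C (1 / 2)))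
      rw [pow_one, Nat.cast_one] at h2
      simp only [LinearMap.comp_apply, LinearMap.mulLeft_apply, LinearMap.mulRight_apply]
      rw [← mul_assoc, h2, mul_assoc, mul_assoc, pow_succ', ← mul_assoc u, h.u_mul_v, ← pow_succ',
        pow_succ, mul_assoc, h.v_mul_u, h3, ← mul_assoc, ← mul_assoc, ← map_mul, ← map_mul]
      cases i with
      -- The hypothesis `hP` enters only when the total weight is zero, here for `u` against `b(z)
      -- v`. In every other weight both sides vanish.
      | zero => simpa using hP b
      | succ i => rw [hv, hv]
  have hV : ∀ a, T (v * a) = T (a * v) := by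
    refine h.linear_ext hg (T := T ∘ₗ LinearMap.mulLeft ℂ v) (T' := T ∘ₗ LinearMap.mulRight ℂ v)
      (fun b i => ?_) (fun b i => ?_)
    · have h2 := h.v_mul_aeval 1 b
      rw [pow_one, Nat.cast_one] at h2
      simp only [LinearMap.comp_apply, LinearMap.mulLeft_apply, LinearMap.mulRight_apply]
      rw [← mul_assoc, h2, mul_assoc]
      cases i with
      | zero =>
        have h4 := hv (b.comp (X - C 1)) 0
        have h5 := hv b 0
        rw [zero_add, pow_one] at h4 h5
        rw [pow_zero, mul_one, mul_one, h4, h5]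
      | succ i =>
        have h3 := h.u_mul_aeval i (P.comp (X + C (1 / 2)))
        rw [pow_succ', ← mul_assoc v, h.v_mul_u, ← pow_succ', pow_succ, mul_assoc _ _ v,
          mul_assoc _ u v, h.u_mul_v, h3, ← mul_assoc, ← mul_assoc, ← map_mul, ← map_mul]
        cases i with
        | zero =>
          have h4 := hP (b.comp (X - C 1))
          rw [comp_assoc] at h4
          simpa using h4.symm
        | succ i => rw [hu, hu]
    · have h2 := h.v_mul_aeval 1 b
      rw [pow_one] at h2
      simp only [LinearMap.comp_apply, LinearMap.mulLeft_apply, LinearMap.mulRight_apply]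
      rw [← mul_assoc, h2, mul_assoc, mul_assoc, ← pow_succ', ← pow_succ, hv, hv]
  -- The elements on which the trace identity holds against everything are stable under left
  -- multiplication by any generator that satisfies it.
  let S : Submodule ℂ A :=
    { carrier := {a | ∀ b, T (a * b) = T (b * a)}
      add_mem' := fun {a a'} ha ha' b => by
        rw [add_mul, mul_add, map_add, map_add, ha b, ha' b]
      zero_mem' := fun b => by rw [zero_mul, mul_zero]
      smul_mem' := fun r a ha b => by
        rw [smul_mul_assoc, mul_smul_comm, map_smul, map_smul, ha b] }
  have hS : ∀ w, (∀ a, T (w * a) = T (a * w)) → ∀ a ∈ S, w * a ∈ S := fun w hw a ha b => by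
    rw [mul_assoc, hw, mul_assoc, ha, ← mul_assoc]
  have h1 : (1 : A) ∈ S := fun b => by rw [one_mul, mul_one]
  exact hg S h1 (hS u hU) (hS v hV) (hS z hZ)

/-- The involution exchanges `u` and `v` when `P` is even. -/
theorem swap (h : TypeARep P u v z) (hP : P.comp (-X) = P) : TypeARep P v u (-z) where
  zu := by
    have := h.zv
    rw [neg_mul, mul_neg]
    nth_rewrite 3 [← this]
    abel
  zv := by
    have := h.zu
    rw [neg_mul, mul_neg]
    nth_rewrite 3 [← neg_neg u]
    rw [← this]
    abel
  uv := by
    rw [h.vu]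
    nth_rewrite 1 [← hP]
    rw [aeval_comp]
    simp [sub_eq_add_neg, add_comm]
  vu := by
    rw [h.uv]
    nth_rewrite 1 [← hP]
    rw [aeval_comp]
    simp [sub_eq_add_neg, add_comm]

end TypeARep

theorem generates_genA (P : ℂ[X]) :
    TypeARep.Generates (genA P GenA.u) (genA P GenA.v) (genA P GenA.z) := by
  intro S h1 hu hv hz a
  have : S = ⊤ := deformA_submodule_eq_top S h1 fun s => by
    cases s
    · exact hu
    · exact hv
    · exact hz
  rw [this]
  trivial

/-! The representation of `DeformA P` on `⨁ ℂ[z] u ^ i` (`i ∈ ℤ`), where `u` is inverted. -/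

/-- The action of `u`. -/
def uOp : Module.End ℂ (ℤ → ℂ[X]) :=
  LinearMap.pi fun i => (aeval (X + C 1 : ℂ[X])).toLinearMap ∘ₗ LinearMap.proj (i - 1)

/-- The action of `v`. -/
def vOp (P : ℂ[X]) : Module.End ℂ (ℤ → ℂ[X]) :=
  LinearMap.pi fun i => LinearMap.mulLeft ℂ (P.comp (X - C (1 / 2))) ∘ₗ
    (aeval (X - C 1 : ℂ[X])).toLinearMap ∘ₗ LinearMap.proj (i + 1)

/-- The action of `z`. -/
def zOp : Module.End ℂ (ℤ → ℂ[X]) :=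
  LinearMap.pi fun i => LinearMap.mulLeft ℂ X ∘ₗ LinearMap.proj i

theorem uOp_apply (f : ℤ → ℂ[X]) (i : ℤ) : uOp f i = (f (i - 1)).comp (X + C 1) := rfl

theorem vOp_apply (P : ℂ[X]) (f : ℤ → ℂ[X]) (i : ℤ) :
    vOp P f i = P.comp (X - C (1 / 2)) * (f (i + 1)).comp (X - C 1) := rfl

theorem zOp_apply (f : ℤ → ℂ[X]) (i : ℤ) : zOp f i = X * f i := rfl

theorem aeval_zOp_apply (b : ℂ[X]) (f : ℤ → ℂ[X]) (i : ℤ) : aeval zOp b f i = b * f i := by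
  induction b using Polynomial.induction_on generalizing f with
  | C r => simp [Algebra.smul_def]
  | add p q hp hq => simp [add_mul, hp, hq]
  | monomial n r ih =>
    rw [pow_succ, ← mul_assoc, map_mul, aeval_X, Module.End.mul_apply, ih, zOp_apply, ← mul_assoc]

theorem typeARep_op (P : ℂ[X]) : TypeARep P uOp (vOp P) zOp where
  zu := by
    refine LinearMap.ext fun f => funext fun i => ?_
    simp only [LinearMap.sub_apply, Module.End.mul_apply, LinearMap.neg_apply, Pi.sub_apply,
      Pi.neg_apply, uOp_apply, zOp_apply, mul_comp, X_comp, map_one]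
    ring
  zv := by
    refine LinearMap.ext fun f => funext fun i => ?_
    simp only [LinearMap.sub_apply, Module.End.mul_apply, Pi.sub_apply,
      vOp_apply, zOp_apply, mul_comp, X_comp, map_one]
    ring
  uv := by
    have : aeval (zOp + algebraMap ℂ (Module.End ℂ (ℤ → ℂ[X])) (1 / 2)) P =
        aeval zOp (P.comp (X + C (1 / 2))) := by
      rw [aeval_comp]
      simp
    rw [this]
    refine LinearMap.ext fun f => funext fun i => ?_
    rw [aeval_zOp_apply, Module.End.mul_apply, uOp_apply, vOp_apply, mul_comp, comp_assoc,
      comp_assoc, sub_add_cancel]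
    congr 2
    · simp only [sub_comp, X_comp, C_comp, add_sub_assoc, ← C_sub]
      norm_num
    · simp
  vu := by
    have : aeval (zOp - algebraMap ℂ (Module.End ℂ (ℤ → ℂ[X])) (1 / 2)) P =
        aeval zOp (P.comp (X - C (1 / 2))) := by
      rw [aeval_comp]
      simp
    rw [this]
    refine LinearMap.ext fun f => funext fun i => ?_
    rw [aeval_zOp_apply, Module.End.mul_apply, vOp_apply, uOp_apply, comp_assoc,
      add_sub_cancel_right]
    simp

/-- Every functional on `ℂ[z]` extends to a functional of weight zero on `DeformA P`. -/
theorem exists_weight_zero_extension (P : ℂ[X]) (τ : ℂ[X] →ₗ[ℂ] ℂ) :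
    ∃ T : DeformA P →ₗ[ℂ] ℂ, (∀ b : ℂ[X], T (aeval (genA P GenA.z) b) = τ b) ∧
      (∀ (b : ℂ[X]) (i : ℕ), T (aeval (genA P GenA.z) b * genA P GenA.u ^ (i + 1)) = 0) ∧
      (∀ (b : ℂ[X]) (i : ℕ), T (aeval (genA P GenA.z) b * genA P GenA.v ^ (i + 1)) = 0) := by
  -- Powers of `u` and `v` move `δ` to positive and negative degrees, so reading off degree `0`
  -- kills nonzero weights. Going through a representation makes the functional well defined with no
  -- basis theorem for `DeformA P`.
  let δ : ℤ → ℂ[X] := Pi.single 0 1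
  let ev : Module.End ℂ (ℤ → ℂ[X]) →ₗ[ℂ] ℂ :=
    τ ∘ₗ LinearMap.proj 0 ∘ₗ LinearMap.applyₗ δ
  have hev : ∀ F, ev F = τ (F δ 0) := fun F => rfl
  let L := (typeARep_op P).lift
  have hz : ∀ b : ℂ[X], L (aeval (genA P GenA.z) b) = aeval zOp b := fun b => by
    rw [← aeval_algHom_apply, TypeARep.lift_genA]
    rfl
  have hu : L (genA P GenA.u) = uOp := TypeARep.lift_genA _ _
  have hv : L (genA P GenA.v) = vOp P := TypeARep.lift_genA _ _
  have hun : ∀ n : ℕ, ∀ i : ℤ, i ≠ n → (uOp ^ n) δ i = 0 := by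
    intro n
    induction n with
    | zero =>
      intro i hi
      simpa [δ] using Pi.single_eq_of_ne (by simpa using hi) _
    | succ n ih =>
      intro i hi
      rw [pow_succ', Module.End.mul_apply, uOp_apply, ih, zero_comp]
      push_cast at hi
      omega
  have hvn : ∀ n : ℕ, ∀ i : ℤ, i ≠ -n → (vOp P ^ n) δ i = 0 := by
    intro n
    induction n with
    | zero =>
      intro i hi
      simpa [δ] using Pi.single_eq_of_ne (by simpa using hi) _
    | succ n ih =>
      intro i hi
      rw [pow_succ', Module.End.mul_apply, vOp_apply, ih, zero_comp, mul_zero]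
      push_cast at hi
      omega
  refine ⟨ev ∘ₗ L.toLinearMap, fun b => ?_, fun b i => ?_, fun b i => ?_⟩
  · rw [LinearMap.comp_apply, AlgHom.toLinearMap_apply, hz, hev, aeval_zOp_apply]
    simp [δ]
  · rw [LinearMap.comp_apply, AlgHom.toLinearMap_apply, map_mul, hz, map_pow, hu, hev,
      Module.End.mul_apply, aeval_zOp_apply, hun _ _ (by omega), mul_zero, map_zero]
  · rw [LinearMap.comp_apply, AlgHom.toLinearMap_apply, map_mul, hz, map_pow, hv, hev,
      Module.End.mul_apply, aeval_zOp_apply, hvn _ _ (by omega), mul_zero, map_zero]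

/-- The involution of `DeformA P` for even `P`. -/
theorem exists_involution {P : ℂ[X]} (hP : P.comp (-X) = P) :
    ∃ σ : DeformA P ≃ₐ[ℂ] DeformA P, σ (genA P GenA.z) = -genA P GenA.z ∧
      σ (genA P GenA.u) = genA P GenA.v ∧ σ (genA P GenA.v) = genA P GenA.u := by
  let L := ((typeARep_genA P).swap hP).lift
  have hu : L (genA P GenA.u) = genA P GenA.v := TypeARep.lift_genA _ _
  have hv : L (genA P GenA.v) = genA P GenA.u := TypeARep.lift_genA _ _
  have hz : L (genA P GenA.z) = -genA P GenA.z := TypeARep.lift_genA _ _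
  have hL : L.comp L = AlgHom.id ℂ _ := by
    refine RingQuot.ringQuot_ext' _ _ _ (FreeAlgebra.hom_ext (funext fun s => ?_))
    change L (L (genA P s)) = genA P s
    cases s
    · rw [hu, hv]
    · rw [hv, hu]
    · rw [hz]
      refine (map_neg L _).trans ?_
      rw [hz]
      exact neg_neg _
  exact ⟨AlgEquiv.ofAlgHom L L hL hL, hz, hu, hv⟩

/-- Functionals on `ℂ[z]` that satisfy the trace condition and are even give invariant traces. -/
theorem exists_invariant_trace {P : ℂ[X]} (hP : P.comp (-X) = P) (τ : ℂ[X] →ₗ[ℂ] ℂ)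
    (hτ : ∀ b, τ (b.comp (X + C 1) * P.comp (X + C (1 / 2))) = τ (b * P.comp (X - C (1 / 2))))
    (hτ' : ∀ b, τ (b.comp (-X)) = τ b) :
    ∃ (T : DeformA P →ₗ[ℂ] ℂ) (σ : DeformA P ≃ₐ[ℂ] DeformA P), IsTrace T ∧
      σ (genA P GenA.z) = -genA P GenA.z ∧ σ (genA P GenA.u) = genA P GenA.v ∧
      σ (genA P GenA.v) = genA P GenA.u ∧ (∀ b, T (σ b) = T b) ∧
      ∀ b : ℂ[X], T (aeval (genA P GenA.z) b) = τ b := by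
  obtain ⟨T, hz, hu, hv⟩ := exists_weight_zero_extension P τ
  obtain ⟨σ, hσz, hσu, hσv⟩ := exists_involution hP
  have hT : IsTrace T := (typeARep_genA P).isTrace_of_weight_zero (generates_genA P) hu hv
    fun b => by rw [hz, hz, hτ]
  refine ⟨T, σ, hT, hσz, hσu, hσv, ?_, hz⟩
  -- `T ∘ σ` is again a trace, and by evenness of `τ` it agrees with `T` on polynomials in `z`.
  refine (typeARep_genA P).trace_ext (generates_genA P) (T := T ∘ₗ σ.toLinearMap) ?_ hT ?_
  · intro a b
    change T (σ (a * b)) = T (σ (b * a))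
    rw [map_mul σ, map_mul σ, hT]
  · intro b
    change T (σ (aeval (genA P GenA.z) b)) = _
    rw [← aeval_algHom_apply σ, hσz, hz, ← hτ', ← hz, aeval_comp, map_neg, aeval_X]

end TypeD
end

/-! ### A residue theorem for vertical strips. -/

noncomputable section
namespace TypeD
open MeasureTheory Filter Topology

/-! ### Contour integration over a strip -/

theorem integral_div_sq_add_sq {b : ℝ} (hb : b ≠ 0) :
    Integrable (fun t : ℝ => b / (b ^ 2 + t ^ 2)) ∧
      ∫ t : ℝ, b / (b ^ 2 + t ^ 2) = SignType.sign b * Real.pi := by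
  have h : ∀ t : ℝ, b / (b ^ 2 + t ^ 2) = b⁻¹ * (1 + (b⁻¹ * t) ^ 2)⁻¹ := fun t => by
    have h1 : b ^ 2 + t ^ 2 ≠ 0 := by positivity
    have h2 : 1 + (b⁻¹ * t) ^ 2 = (b ^ 2 + t ^ 2) * (b ^ 2)⁻¹ := by field_simp
    rw [h2]
    field_simp
  simp only [h]
  refine ⟨(integrable_inv_one_add_sq.comp_mul_left' (inv_ne_zero hb)).const_mul _, ?_⟩
  rw [integral_const_mul, Measure.integral_comp_mul_left (fun t : ℝ => (1 + t ^ 2)⁻¹),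
    integral_univ_inv_one_add_sq, inv_inv, smul_eq_mul, ← mul_assoc]
  congr 1
  rcases lt_or_gt_of_ne hb with h | h
  · rw [abs_of_neg h, sign_neg h]
    field_simp
    simp
  · rw [abs_of_pos h, sign_pos h]
    field_simp
    simp

/-- The difference of `1 / z` on two vertical lines on either side of the origin. -/
theorem integral_line_sub_line_inv {a b : ℝ} (ha : a < 0) (hb : 0 < b) :
    Integrable (fun t : ℝ => ((b : ℂ) + t * Complex.I)⁻¹ - ((a : ℂ) + t * Complex.I)⁻¹) ∧
      ∫ t : ℝ, (((b : ℂ) + t * Complex.I)⁻¹ - ((a : ℂ) + t * Complex.I)⁻¹) = 2 * Real.pi := by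
  have hne : ∀ r : ℝ, r ≠ 0 → ∀ t : ℝ, (r : ℂ) + t * Complex.I ≠ 0 := fun r hr t h => by
    have := congrArg Complex.re h
    simp at this
    exact hr this
  have hinv : ∀ r : ℝ, r ≠ 0 → ∀ t : ℝ, ((r : ℂ) + t * Complex.I)⁻¹ =
      ((r / (r ^ 2 + t ^ 2) : ℝ) : ℂ) - ((t / (r ^ 2 + t ^ 2) : ℝ) : ℂ) * Complex.I := by
    intro r hr t
    have h1 : (r ^ 2 + t ^ 2 : ℂ) ≠ 0 := by
      have : r ^ 2 + t ^ 2 ≠ 0 := by positivity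
      exact_mod_cast this
    rw [inv_eq_iff_eq_inv, eq_comm]
    apply inv_eq_of_mul_eq_one_left
    push_cast
    field_simp
    ring_nf
    rw [Complex.I_sq]
    ring
  -- Neither term is integrable alone. The difference is dominated by a multiple of `a / (a² + t²)`
  -- through `2b|t| ≤ b² + t²`.
  have hodd : Integrable (fun t : ℝ => t / (b ^ 2 + t ^ 2) - t / (a ^ 2 + t ^ 2)) := by
    have hc : Continuous (fun t : ℝ => t / (b ^ 2 + t ^ 2) - t / (a ^ 2 + t ^ 2)) := by
      refine Continuous.sub ?_ ?_ <;> refine continuous_id.div (by fun_prop) fun t => ?_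
      · positivity
      · have : 0 < a ^ 2 := by nlinarith
        positivity
    have h1 := (integral_div_sq_add_sq ha.ne).1
    refine (h1.const_mul ((a ^ 2 - b ^ 2) / (2 * a * b))).mono hc.aestronglyMeasurable
      (ae_of_all _ fun t => ?_)
    have ha2 : 0 < a ^ 2 := by nlinarith
    have hA : 0 < a ^ 2 + t ^ 2 := by positivity
    have hB : 0 < b ^ 2 + t ^ 2 := by positivity
    have h3 : t / (b ^ 2 + t ^ 2) - t / (a ^ 2 + t ^ 2) =
        (a ^ 2 - b ^ 2) * (t / (b ^ 2 + t ^ 2)) * (a ^ 2 + t ^ 2)⁻¹ := by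
      field_simp
      ring
    have h4 : (a ^ 2 - b ^ 2) / (2 * a * b) * (a / (a ^ 2 + t ^ 2)) =
        (a ^ 2 - b ^ 2) * (1 / (2 * b)) * (a ^ 2 + t ^ 2)⁻¹ := by
      have := ha.ne
      field_simp
    rw [h3, h4, norm_mul, norm_mul, norm_mul, norm_mul]
    gcongr
    rw [Real.norm_eq_abs, Real.norm_eq_abs, abs_div, abs_of_pos hB,
      abs_of_pos (by positivity : 0 < 1 / (2 * b)), div_le_div_iff₀ hB (by positivity)]
    have h5 : 2 * b * |t| ≤ b ^ 2 + |t| ^ 2 := by nlinarith [sq_nonneg (b - |t|)]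
    rw [sq_abs] at h5
    linarith
  have heq : ∀ t : ℝ, ((b : ℂ) + t * Complex.I)⁻¹ - ((a : ℂ) + t * Complex.I)⁻¹ =
      ((b / (b ^ 2 + t ^ 2) - a / (a ^ 2 + t ^ 2) : ℝ) : ℂ) -
        ((t / (b ^ 2 + t ^ 2) - t / (a ^ 2 + t ^ 2) : ℝ) : ℂ) * Complex.I := by
    intro t
    rw [hinv b hb.ne', hinv a ha.ne]
    push_cast
    ring
  have hev := (integral_div_sq_add_sq hb.ne').1.sub (integral_div_sq_add_sq ha.ne).1
  simp only [heq]
  have hI1 : Integrable (fun t : ℝ => ((b / (b ^ 2 + t ^ 2) - a / (a ^ 2 + t ^ 2) : ℝ) : ℂ)) :=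
    hev.ofReal
  have hI2 : Integrable (fun t : ℝ =>
      ((t / (b ^ 2 + t ^ 2) - t / (a ^ 2 + t ^ 2) : ℝ) : ℂ) * Complex.I) :=
    hodd.ofReal.mul_const _
  refine ⟨hI1.sub hI2, ?_⟩
  have h0 : ∫ t : ℝ, (t / (b ^ 2 + t ^ 2) - t / (a ^ 2 + t ^ 2)) = 0 := by
    have h := integral_neg_eq_self (fun t : ℝ => t / (b ^ 2 + t ^ 2) - t / (a ^ 2 + t ^ 2)) volume
    have h' : ∀ t : ℝ, -t / (b ^ 2 + (-t) ^ 2) - -t / (a ^ 2 + (-t) ^ 2) =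
        -(t / (b ^ 2 + t ^ 2) - t / (a ^ 2 + t ^ 2)) := fun t => by
      rw [neg_sq]
      ring
    simp only [h'] at h
    rw [integral_neg] at h
    linarith
  rw [integral_sub hI1 hI2, integral_mul_const, integral_complex_ofReal, integral_complex_ofReal,
    h0, integral_sub (integral_div_sq_add_sq hb.ne').1 (integral_div_sq_add_sq ha.ne).1,
    (integral_div_sq_add_sq hb.ne').2, (integral_div_sq_add_sq ha.ne).2, sign_pos hb, sign_neg ha]
  push_cast
  simp
  ring

theorem integral_line_sub_line_inv_sub {a b : ℝ} {p : ℂ} (ha : a < p.re) (hb : p.re < b) :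
    Integrable (fun t : ℝ => ((b : ℂ) + t * Complex.I - p)⁻¹ -
        ((a : ℂ) + t * Complex.I - p)⁻¹) ∧
      ∫ t : ℝ, (((b : ℂ) + t * Complex.I - p)⁻¹ - ((a : ℂ) + t * Complex.I - p)⁻¹) =
        2 * Real.pi := by
  obtain ⟨h1, h2⟩ := integral_line_sub_line_inv (sub_neg.2 ha) (sub_pos.2 hb)
  have h : ∀ r t : ℝ, (r : ℂ) + t * Complex.I - p =
      ((r - p.re : ℝ) : ℂ) + ((t - p.im : ℝ) : ℂ) * Complex.I := fun r t => by
    nth_rewrite 1 [← Complex.re_add_im p]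
    push_cast
    ring
  simp only [h]
  refine ⟨h1.comp_sub_right p.im, ?_⟩
  rw [← h2]
  exact integral_sub_right_eq_self (fun t : ℝ => (((b - p.re : ℝ) : ℂ) + t * Complex.I)⁻¹ -
    (((a - p.re : ℝ) : ℂ) + t * Complex.I)⁻¹) p.im

/-- The residue theorem for a strip and a function with simple poles in it. -/
theorem integral_strip {a b : ℝ} (hab : a < b) {ι : Type*} (s : Finset ι) (r p : ι → ℂ)
    (hp : ∀ l ∈ s, a < (p l).re ∧ (p l).re < b) {F K : ℂ → ℂ}
    (hK : DifferentiableOn ℂ K {z | a ≤ z.re ∧ z.re ≤ b})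
    (hF : ∀ z : ℂ, a ≤ z.re → z.re ≤ b → (∀ l ∈ s, z ≠ p l) →
      F z = K z + ∑ l ∈ s, r l * (z - p l)⁻¹)
    {B T₀ : ℝ} (hdecay : ∀ z : ℂ, a ≤ z.re → z.re ≤ b → T₀ ≤ |z.im| → ‖F z‖ ≤ B / (1 + |z.im|))
    (hFa : Integrable fun t : ℝ => F (a + t * Complex.I))
    (hFb : Integrable fun t : ℝ => F (b + t * Complex.I)) :
    (∫ t : ℝ, F (b + t * Complex.I)) - ∫ t : ℝ, F (a + t * Complex.I) =
      2 * Real.pi * ∑ l ∈ s, r l := by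
  have hre : ∀ (x : ℝ) (y : ℝ), ((x : ℂ) + y * Complex.I).re = x := fun x y => by simp
  have him : ∀ (x : ℝ) (y : ℝ), ((x : ℂ) + y * Complex.I).im = y := fun x y => by simp
  have hne : ∀ x : ℝ, x = a ∨ x = b → ∀ (y : ℝ), ∀ l ∈ s, (x : ℂ) + y * Complex.I ≠ p l := by
    intro x hx y l hl h
    have h1 := hp l hl
    rw [← h, hre] at h1
    rcases hx with rfl | rfl
    · exact lt_irrefl _ h1.1
    · exact lt_irrefl _ h1.2
  have hKa : ∀ y : ℝ, K (a + y * Complex.I) =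
      F (a + y * Complex.I) - ∑ l ∈ s, r l * (a + y * Complex.I - p l)⁻¹ := fun y => by
    rw [hF _ (by rw [hre]) (by rw [hre]; exact hab.le) (hne a (Or.inl rfl) y), add_sub_cancel_right]
  have hKb : ∀ y : ℝ, K (b + y * Complex.I) =
      F (b + y * Complex.I) - ∑ l ∈ s, r l * (b + y * Complex.I - p l)⁻¹ := fun y => by
    rw [hF _ (by rw [hre]; exact hab.le) (by rw [hre]) (hne b (Or.inr rfl) y), add_sub_cancel_right]
  -- The terms `1/(z - p)`, and hence `K`, need not be integrable on a single vertical line, but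
  -- their differences across the strip are; so the two lines are treated together.
  let D : ℝ → ℂ := fun y => K (b + y * Complex.I) - K (a + y * Complex.I)
  have hsum_int : ∀ l ∈ s, Integrable fun t : ℝ => r l *
      ((b + t * Complex.I - p l)⁻¹ - (a + t * Complex.I - p l)⁻¹) := fun l hl =>
    (integral_line_sub_line_inv_sub (hp l hl).1 (hp l hl).2).1.const_mul _
  have hD : D = fun y : ℝ => (F (b + y * Complex.I) - F (a + y * Complex.I)) -
      ∑ l ∈ s, r l * ((b + y * Complex.I - p l)⁻¹ - (a + y * Complex.I - p l)⁻¹) := by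
    funext y
    simp only [D, hKa, hKb, mul_sub, Finset.sum_sub_distrib]
    ring
  have hDint : Integrable D := by
    rw [hD]
    exact (hFb.sub hFa).sub (integrable_finsetSum s hsum_int)
  have hDval : ∫ t, D t = ((∫ t : ℝ, F (b + t * Complex.I)) - ∫ t : ℝ, F (a + t * Complex.I)) -
      2 * Real.pi * ∑ l ∈ s, r l := by
    have h1 := integral_sub (hFb.sub hFa) (integrable_finsetSum s hsum_int)
    have h2 := integral_sub hFb hFa
    rw [hD]
    refine h1.trans ?_
    rw [integral_finsetSum s hsum_int, Finset.mul_sum]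
    refine congrArg₂ _ h2 ?_
    refine Finset.sum_congr rfl fun l hl => ?_
    rw [integral_const_mul, (integral_line_sub_line_inv_sub (hp l hl).1 (hp l hl).2).2, mul_comm]
  suffices h0 : ∫ t, D t = 0 by
    rw [← sub_eq_zero, ← hDval, h0]
  have hlim1 : Tendsto (fun N : ℝ => ∫ t in (-N)..N, D t) atTop (𝓝 (∫ t, D t)) :=
    intervalIntegral_tendsto_integral hDint tendsto_neg_atTop_atBot tendsto_id
  refine tendsto_nhds_unique hlim1 ?_
  -- bound of the horizontal integrals
  obtain ⟨M, hM⟩ : ∃ M, ∀ l ∈ s, |(p l).im| ≤ M := by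
    refine ⟨∑ l ∈ s, |(p l).im|, fun l hl => ?_⟩
    exact Finset.single_le_sum (f := fun l => |(p l).im|) (fun _ _ => abs_nonneg _) hl
  let ε : ℝ → ℝ := fun N => B / (1 + N) + ∑ l ∈ s, ‖r l‖ * (N - M)⁻¹
  have hε : Tendsto ε atTop (𝓝 0) := by
    have h1 : Tendsto (fun N : ℝ => B / (1 + N)) atTop (𝓝 0) :=
      tendsto_const_nhds.div_atTop (tendsto_atTop_add_const_left _ _ tendsto_id)
    have h2 : ∀ l ∈ s, Tendsto (fun N : ℝ => ‖r l‖ * (N - M)⁻¹) atTop (𝓝 0) := fun l _ => by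
      have : Tendsto (fun N : ℝ => (N - M)⁻¹) atTop (𝓝 0) :=
        tendsto_inv_atTop_zero.comp (tendsto_atTop_add_const_right _ _ tendsto_id)
      simpa using this.const_mul ‖r l‖
    simpa using h1.add (tendsto_finsetSum s h2)
  have hKbound : ∀ N : ℝ, max T₀ (M + 1) ≤ N → 0 ≤ N → ∀ z : ℂ, a ≤ z.re → z.re ≤ b →
      |z.im| = N → ‖K z‖ ≤ ε N := by
    intro N hN hN0 z hz1 hz2 hz3
    have hMN : M + 1 ≤ N := (le_max_right _ _).trans hN
    have hdist : ∀ l ∈ s, N - M ≤ ‖z - p l‖ := fun l hl => by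
      calc N - M ≤ |z.im| - |(p l).im| := by rw [hz3]; linarith [hM l hl]
        _ ≤ |z.im - (p l).im| := abs_sub_abs_le_abs_sub _ _
        _ = |(z - p l).im| := by rw [Complex.sub_im]
        _ ≤ _ := Complex.abs_im_le_norm _
    have hzp : ∀ l ∈ s, z ≠ p l := fun l hl h => by
      have := hdist l hl
      rw [h, sub_self, norm_zero] at this
      linarith
    have : K z = F z - ∑ l ∈ s, r l * (z - p l)⁻¹ := by
      rw [hF z hz1 hz2 hzp, add_sub_cancel_right]
    rw [this]
    refine (norm_sub_le _ _).trans (add_le_add ?_ ?_)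
    · have := hdecay z hz1 hz2 (by rw [hz3]; exact (le_max_left _ _).trans hN)
      rwa [hz3] at this
    · refine (norm_sum_le _ _).trans (Finset.sum_le_sum fun l hl => ?_)
      rw [norm_mul, norm_inv]
      have : 0 < N - M := by linarith
      gcongr
      exact hdist l hl
  -- Cauchy's theorem for `K` on the rectangle `[a, b] × [-N, N]`; the horizontal sides vanish in
  -- the limit.
  have hrect : ∀ N : ℝ, 0 ≤ N → Complex.I * ∫ t in (-N)..N, D t =
      (∫ x : ℝ in a..b, K (x + (N : ℝ) * Complex.I)) -
        ∫ x : ℝ in a..b, K (x + ((-N : ℝ) : ℂ) * Complex.I) := by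
    intro N hN
    have hsub : Set.uIcc a b ×ℂ Set.uIcc (-N) N ⊆ {z : ℂ | a ≤ z.re ∧ z.re ≤ b} := by
      intro z hz
      have := (Complex.mem_reProdIm.1 hz).1
      rwa [Set.uIcc_of_le hab.le] at this
    have h := Complex.integral_boundary_rect_eq_zero_of_differentiableOn K ⟨a, -N⟩ ⟨b, N⟩
      (hK.mono hsub)
    have hcont : ∀ x : ℝ, a ≤ x → x ≤ b →
        IntervalIntegrable (fun y : ℝ => K (x + y * Complex.I)) volume (-N) N := by
      intro x hx1 hx2
      refine Continuous.intervalIntegrable ?_ _ _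
      refine hK.continuousOn.comp_continuous (by fun_prop) fun y => ?_
      exact ⟨by rwa [hre], by rwa [hre]⟩
    simp only [D]
    rw [intervalIntegral.integral_sub (hcont b hab.le le_rfl) (hcont a le_rfl hab.le), mul_sub]
    simp only [smul_eq_mul] at h
    linear_combination h
  have hlim2 : Tendsto (fun N : ℝ => 2 * (b - a) * ε N) atTop (𝓝 0) := by
    simpa using hε.const_mul (2 * (b - a))
  refine squeeze_zero_norm' ?_ hlim2
  filter_upwards [eventually_ge_atTop (max T₀ (M + 1)), eventually_ge_atTop 0] with N hN hN0
  have hhor : ∀ y : ℝ, |y| = N → ‖∫ x : ℝ in a..b, K (x + (y : ℝ) * Complex.I)‖ ≤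
      ε N * (b - a) := by
    intro y hy
    have := intervalIntegral.norm_integral_le_of_norm_le_const (a := a) (b := b) (C := ε N)
      (f := fun x : ℝ => K (x + (y : ℝ) * Complex.I)) fun x hx => by
        rw [Set.uIoc_of_le hab.le] at hx
        exact hKbound N hN hN0 _ (by rw [hre]; exact hx.1.le) (by rw [hre]; exact hx.2)
          (by rw [him]; exact hy)
    rwa [abs_of_pos (sub_pos.2 hab)] at this
  have h1 : ‖∫ t in (-N)..N, D t‖ = ‖Complex.I * ∫ t in (-N)..N, D t‖ := by
    rw [norm_mul, Complex.norm_I, one_mul]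
  rw [h1, hrect N hN0]
  refine (norm_sub_le _ _).trans ?_
  have := hhor N (abs_of_nonneg hN0)
  have := hhor (-N) (by rw [abs_neg, abs_of_nonneg hN0])
  linarith

end TypeD
end

/-! ### Symmetry, decay and integrability of the weights. -/

noncomputable section
namespace TypeD
open MeasureTheory Filter Topology Polynomial

/-! ### Palindromic polynomials -/

theorem reflect_prod_X_sub_C {ι : Type*} (s : Finset ι) (r : ι → ℂ) :
    reflect s.card (∏ i ∈ s, (X - C (r i))) = ∏ i ∈ s, (1 - C (r i) * X) := by
  classical
  induction s using Finset.induction_on with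
  | empty => simp [reflect_one]
  | insert i s hi ih =>
    have h1 : reflect 1 (X - C (r i)) = 1 - C (r i) * X := by
      rw [reflect_sub, reflect_C, pow_one, reflect_one_X]
    rw [Finset.prod_insert hi, Finset.prod_insert hi, Finset.card_insert_of_notMem hi, add_comm,
      reflect_mul _ _ (natDegree_X_sub_C _).le (natDegree_finsetProd_X_sub_C_eq_card _ _).le,
      ih, h1]

theorem one_sub_C_mul_X {r : ℂ} (hr : r ≠ 0) : 1 - C r * X = C (-r) * (X - C r⁻¹) := by
  rw [mul_sub, ← C_mul, neg_mul, mul_inv_cancel₀ hr, C_neg, C_neg, C_1]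
  ring

theorem eval_eq_pow_mul_eval_inv {F : ℂ[X]} {d : ℕ} (hd : F.natDegree ≤ d)
    (h : reflect d F = F) {x : ℂ} (hx : x ≠ 0) : F.eval x = x ^ d * F.eval x⁻¹ := by
  let _ : Invertible x := invertibleOfNonzero hx
  have := eval₂_reflect_mul_pow (RingHom.id ℂ) x d F hd
  rw [h, invOf_eq_inv, eval₂_id, eval₂_id] at this
  rw [← this, mul_comm]

theorem isNumerator_iff {d : ℕ} (hd : 2 ≤ d) (G : ℂ[X]) :
    IsNumerator d G ↔ G.natDegree ≤ d - 2 ∧ reflect (d - 2) G = G := by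
  constructor
  · rintro ⟨h1, h2⟩
    refine ⟨natDegree_le_iff_coeff_eq_zero.2 fun i hi => h1 i (by omega), ?_⟩
    ext i
    rw [coeff_reflect]
    rcases le_or_gt i (d - 2) with hi | hi
    · rw [revAt_le hi]
      exact h2 _ _ (by omega)
    · rw [revAt_eq_self_of_lt hi]
  · rintro ⟨h1, h2⟩
    refine ⟨fun i hi => coeff_eq_zero_of_natDegree_lt (by omega), fun i j hij => ?_⟩
    nth_rewrite 1 [← h2]
    rw [coeff_reflect, revAt_le (by omega)]
    congr 1
    omega

/-! ### The exponential with period `n` -/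

/-- The function `z ↦ exp (2πi z / n)`. -/
def ex (m : ℕ) (z : ℂ) : ℂ := Complex.exp (2 * Real.pi * Complex.I / ((2 * m : ℕ) : ℂ) * z)

variable {m : ℕ}

theorem ex_ne_zero (z : ℂ) : ex m z ≠ 0 := Complex.exp_ne_zero _

theorem ex_add (z w : ℂ) : ex m (z + w) = ex m z * ex m w := by
  rw [ex, mul_add, Complex.exp_add, ex, ex]

theorem ex_neg (z : ℂ) : ex m (-z) = (ex m z)⁻¹ := by
  rw [ex, mul_neg, Complex.exp_neg, ex]

theorem ex_sub (z w : ℂ) : ex m (z - w) = ex m z / ex m w := by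
  rw [sub_eq_add_neg, ex_add, ex_neg, div_eq_mul_inv]

theorem differentiable_ex : Differentiable ℂ (ex m) := by
  unfold ex
  fun_prop

theorem hasDerivAt_ex (z : ℂ) :
    HasDerivAt (ex m) (2 * Real.pi * Complex.I / ((2 * m : ℕ) : ℂ) * ex m z) z := by
  have := ((hasDerivAt_id z).const_mul (2 * Real.pi * Complex.I / ((2 * m : ℕ) : ℂ))).cexp
  rw [mul_one] at this
  exact this.congr_deriv (mul_comm _ _)

theorem period_ne_zero (hm : 0 < m) : ((2 * m : ℕ) : ℂ) ≠ 0 := by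
  rw [Nat.cast_ne_zero]
  omega

theorem ex_eq_ex_iff (hm : 0 < m) {z w : ℂ} :
    ex m z = ex m w ↔ ∃ j : ℤ, z = w + ((2 * m : ℕ) : ℂ) * j := by
  have hn := period_ne_zero hm
  have hp := Complex.two_pi_I_ne_zero
  rw [ex, ex, Complex.exp_eq_exp_iff_exists_int]
  refine exists_congr fun j => ?_
  constructor
  · intro h
    have h' : (2 * Real.pi * Complex.I) * z =
        (2 * Real.pi * Complex.I) * (w + ((2 * m : ℕ) : ℂ) * j) := by
      field_simp at h
      linear_combination (2 * Real.pi * Complex.I) * h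
    exact mul_left_cancel₀ hp h'
  · rintro rfl
    field_simp

theorem ex_add_period (hm : 0 < m) (z : ℂ) (j : ℤ) : ex m (z + ((2 * m : ℕ) : ℂ) * j) = ex m z :=
  (ex_eq_ex_iff hm).2 ⟨j, rfl⟩

theorem norm_ex (z : ℂ) : ‖ex m z‖ = Real.exp (-(2 * Real.pi / ((2 * m : ℕ) : ℝ)) * z.im) := by
  rw [ex, Complex.norm_exp]
  congr 1
  have : 2 * Real.pi * Complex.I / ((2 * m : ℕ) : ℂ) =
      ((2 * Real.pi / ((2 * m : ℕ) : ℝ) : ℝ) : ℂ) * Complex.I := by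
    push_cast
    ring
  rw [this, mul_assoc, Complex.re_ofReal_mul, Complex.I_mul_re]
  ring

/-! ### The polynomials `expPoly` and the weight -/

variable (c : ZMod (2 * m) → ℂ)

/-- The roots `exp ((2πi / n) (α_q - q - 1 / 2))` of `expPoly`. -/
def rho (q : ℤ) : ℂ := ex m (alpha c q - q - 1 / 2)

theorem expPoly_eq (s : Finset ℕ) : expPoly c s = ∏ q ∈ s, (X - C (rho c q)) := by
  simp [expPoly, rho, ex]

theorem rho_ne_zero (q : ℤ) : rho c q ≠ 0 := ex_ne_zero _

theorem rho_symm (hm : 0 < m) (hc_symm : ∀ i, c (-i) = c i) {q : ℕ} (hq : q < 2 * m) :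
    rho c ((2 * m - 1 - q : ℕ) : ℤ) = (rho c q)⁻¹ := by
  have h1 : ((2 * m - 1 - q : ℕ) : ℤ) = (-q - 1) + ((2 * m : ℕ) : ℤ) * 1 := by omega
  rw [rho, rho, ← ex_neg, h1, alpha_add_period c hm, alpha_neg_sub_one c hm hc_symm, eq_comm,
    ex_eq_ex_iff hm]
  refine ⟨1, ?_⟩
  push_cast
  ring

theorem natDegree_expPoly (s : Finset ℕ) : (expPoly c s).natDegree = s.card := by
  rw [expPoly_eq, natDegree_finsetProd_X_sub_C_eq_card]

theorem expPoly_monic (s : Finset ℕ) : (expPoly c s).Monic := by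
  rw [expPoly_eq]
  exact monic_prod_of_monic _ _ fun q _ => monic_X_sub_C _

theorem eval_expPoly_zero_ne_zero (s : Finset ℕ) : (expPoly c s).eval 0 ≠ 0 := by
  rw [expPoly_eq, eval_prod, Finset.prod_ne_zero_iff]
  intro q _
  simpa using rho_ne_zero c q

/-- Sets of indices that are stable under `q ↦ n - 1 - q`. -/
def SymmIndices (m : ℕ) (s : Finset ℕ) : Prop := ∀ q ∈ s, q < 2 * m ∧ 2 * m - 1 - q ∈ s

theorem symmIndices_range : SymmIndices m (Finset.range (2 * m)) := by
  intro q hq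
  rw [Finset.mem_range] at *
  omega

theorem reflect_expPoly (hm : 0 < m) (hc_symm : ∀ i, c (-i) = c i) {s : Finset ℕ}
    (hs : SymmIndices m s) : reflect s.card (expPoly c s) = expPoly c s := by
  -- As `n` is even, `q ↦ n - 1 - q` has no fixed point, and each pair of mutually inverse roots
  -- contributes `1`.
  have h1 : ∏ q ∈ s, (-rho c q) = 1 := by
    refine Finset.prod_involution (fun q _ => 2 * m - 1 - q) ?_ ?_ ?_ ?_
    · intro q hq
      rw [rho_symm c hm hc_symm (hs q hq).1, neg_mul_neg, mul_inv_cancel₀ (rho_ne_zero c q)]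
    · intro q hq _
      have := hs q hq
      omega
    · intro q hq
      exact (hs q hq).2
    · intro q hq
      have := hs q hq
      omega
  have h2 : ∏ q ∈ s, (X - C (rho c q)⁻¹) = expPoly c s := by
    rw [expPoly_eq]
    refine Finset.prod_nbij' (fun q => 2 * m - 1 - q) (fun q => 2 * m - 1 - q)
      (fun q hq => (hs q hq).2) (fun q hq => (hs q hq).2) ?_ ?_ ?_
    · intro q hq
      have := hs q hq
      omega
    · intro q hq
      have := hs q hq
      omega
    · intro q hq
      rw [rho_symm c hm hc_symm (hs q hq).1]
  nth_rewrite 1 [expPoly_eq]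
  rw [reflect_prod_X_sub_C,
    Finset.prod_congr rfl fun (q : ℕ) _ => one_sub_C_mul_X (rho_ne_zero c q),
    Finset.prod_mul_distrib, h2, ← map_prod, h1, C_1, one_mul]

theorem weightZero_eq (G : ℂ[X]) (z : ℂ) : weightZero c G z =
    ex m z * (G.eval (ex m z) / (expPoly c (Finset.range (2 * m))).eval (ex m z)) := rfl

/-- `G` is palindromic of formal degree `n - 2` and `𝐏` of degree `n`, so `x G(x)/𝐏(x)` is invariant
under `x ↦ 1/x`. -/
theorem weightZero_neg (hm : 0 < m) (hc_symm : ∀ i, c (-i) = c i) {G : ℂ[X]}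
    (hG : IsNumerator (2 * m) G) (z : ℂ) : weightZero c G (-z) = weightZero c G z := by
  obtain ⟨h1, h2⟩ := (isNumerator_iff (by omega) G).1 hG
  have hP := reflect_expPoly c hm hc_symm (symmIndices_range (m := m))
  rw [Finset.card_range] at hP
  have hx := ex_ne_zero (m := m) z
  have hG' := eval_eq_pow_mul_eval_inv h1 h2 hx
  have hP' := eval_eq_pow_mul_eval_inv
    (by rw [natDegree_expPoly, Finset.card_range]) hP hx
  rw [weightZero_eq, weightZero_eq, ex_neg, hG', hP']
  have h3 : ex m z ^ (2 * m) = ex m z ^ (2 * m - 2) * ex m z * ex m z := by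
    rw [mul_assoc, ← sq, ← pow_add]
    congr 1
    omega
  rw [h3]
  generalize eval (ex m z)⁻¹ (expPoly c (Finset.range (2 * m))) = a
  have h4 : ex m z ^ (2 * m - 2) ≠ 0 := pow_ne_zero _ hx
  rcases eq_or_ne a 0 with rfl | ha
  · simp
  · field_simp

/-- As `Im z → +∞` the exponential `x` tends to `0`, where `G/𝐏` is bounded because `𝐏(0) ≠ 0`; the
factor `x` gives the rate. Evenness covers the other end. -/
theorem weightZero_decay (hm : 0 < m) (hc_symm : ∀ i, c (-i) = c i) {G : ℂ[X]}
    (hG : IsNumerator (2 * m) G) : ∃ B T₀ : ℝ, 0 ≤ B ∧ ∀ z : ℂ, T₀ ≤ |z.im| →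
      ‖weightZero c G z‖ ≤ B * Real.exp (-(2 * Real.pi / ((2 * m : ℕ) : ℝ)) * |z.im|) := by
  set g : ℂ → ℂ := fun x => G.eval x / (expPoly c (Finset.range (2 * m))).eval x with hg
  have hcont : ContinuousAt g 0 :=
    G.continuous.continuousAt.div (Polynomial.continuous _).continuousAt
      (eval_expPoly_zero_ne_zero c _)
  have hbd : ∀ᶠ x in 𝓝 (0 : ℂ), ‖g x‖ ≤ ‖g 0‖ + 1 := by
    have := hcont.norm.eventually (eventually_le_nhds (lt_add_one ‖g 0‖))
    exact this
  obtain ⟨δ, hδ, hδ'⟩ := Metric.eventually_nhds_iff.1 hbd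
  set κ := 2 * Real.pi / ((2 * m : ℕ) : ℝ) with hκ
  have hκ0 : 0 < κ := by
    have : (0 : ℝ) < ((2 * m : ℕ) : ℝ) := by
      rw [Nat.cast_pos]
      omega
    positivity
  have hlim : Tendsto (fun y : ℝ => Real.exp (-κ * y)) atTop (𝓝 0) := by
    refine Real.tendsto_exp_atBot.comp ?_
    exact tendsto_id.const_mul_atTop_of_neg (neg_lt_zero.2 hκ0)
  obtain ⟨T₁, hT₁⟩ := eventually_atTop.1 (hlim.eventually (eventually_lt_nhds hδ))
  have hpos : ∀ z : ℂ, T₁ ≤ z.im →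
      ‖weightZero c G z‖ ≤ (‖g 0‖ + 1) * Real.exp (-κ * z.im) := by
    intro z hz
    have hn := norm_ex (m := m) z
    rw [← hκ] at hn
    have h1 := hδ' (y := ex m z) (by rw [dist_zero_right, hn]; exact hT₁ _ hz)
    rw [weightZero_eq, norm_mul, hn, mul_comm]
    gcongr
  refine ⟨‖g 0‖ + 1, T₁, by positivity, fun z hz => ?_⟩
  rcases le_total 0 z.im with h | h
  · rw [abs_of_nonneg h] at hz ⊢
    exact hpos z hz
  · rw [abs_of_nonpos h] at hz ⊢
    rw [← weightZero_neg c hm hc_symm hG]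
    have := hpos (-z) (by rwa [Complex.neg_im])
    rwa [Complex.neg_im] at this

theorem exists_eval_bound (Q : ℂ[X]) (a b : ℝ) : ∃ (K : ℝ) (N : ℕ), 0 ≤ K ∧ ∀ z : ℂ,
    a ≤ z.re → z.re ≤ b → ‖Q.eval z‖ ≤ K * (1 + |z.im|) ^ N := by
  set A := |a| + |b| + 1 with hA
  have hA1 : 1 ≤ A := by
    have := abs_nonneg a
    have := abs_nonneg b
    linarith
  refine ⟨∑ i ∈ Finset.range (Q.natDegree + 1), ‖Q.coeff i‖ * A ^ i, Q.natDegree, by positivity,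
    fun z hz1 hz2 => ?_⟩
  have hz : ‖z‖ ≤ A * (1 + |z.im|) := by
    have h1 : |z.re| ≤ |a| + |b| := by
      refine abs_le.2 ⟨?_, ?_⟩
      · have := neg_abs_le a
        have := abs_nonneg b
        linarith
      · have := le_abs_self b
        have := abs_nonneg a
        linarith
    have h2 := Complex.norm_le_abs_re_add_abs_im z
    have h3 := abs_nonneg z.im
    nlinarith
  rw [eval_eq_sum_range, Finset.sum_mul]
  refine (norm_sum_le _ _).trans (Finset.sum_le_sum fun i hi => ?_)
  rw [norm_mul, norm_pow, mul_assoc]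
  have hi' : i ≤ Q.natDegree := Nat.lt_succ_iff.1 (Finset.mem_range.1 hi)
  gcongr
  calc ‖z‖ ^ i ≤ (A * (1 + |z.im|)) ^ i := by gcongr
    _ = A ^ i * (1 + |z.im|) ^ i := mul_pow _ _ _
    _ ≤ A ^ i * (1 + |z.im|) ^ Q.natDegree := by
        gcongr
        linarith [abs_nonneg z.im]

/-- Exponential decay beats the polynomial growth of `Q` on a strip. Quadratic decay suffices for
integrability on vertical lines and for the horizontal sides of contours. -/
theorem weight_decay (hm : 0 < m) (hc_symm : ∀ i, c (-i) = c i) {G : ℂ[X]}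
    (hG : IsNumerator (2 * m) G) (Q : ℂ[X]) (q : ℤ) (a b : ℝ) :
    ∃ B T₀ : ℝ, ∀ z : ℂ, a ≤ z.re → z.re ≤ b → T₀ ≤ |z.im| →
      ‖Q.eval z * weight c G q z‖ ≤ B / (1 + |z.im|) ^ 2 := by
  obtain ⟨B, T₁, hB, hT₁⟩ := weightZero_decay c hm hc_symm hG
  obtain ⟨K, N, hK, hQ⟩ := exists_eval_bound Q a b
  set κ := 2 * Real.pi / ((2 * m : ℕ) : ℝ) with hκ
  have hκ0 : 0 < κ := by
    have : (0 : ℝ) < ((2 * m : ℕ) : ℝ) := by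
      rw [Nat.cast_pos]
      omega
    positivity
  have hlim : Tendsto (fun y : ℝ => (1 + y) ^ (N + 2) * Real.exp (-κ * y)) atTop (𝓝 0) := by
    have h1 : Tendsto (fun y : ℝ => κ * (1 + y)) atTop atTop :=
      (tendsto_atTop_add_const_left _ _ tendsto_id).const_mul_atTop hκ0
    have h2 := ((Real.tendsto_pow_mul_exp_neg_atTop_nhds_zero (N + 2)).comp h1).const_mul
      (Real.exp κ * (κ ^ (N + 2))⁻¹)
    rw [mul_zero] at h2
    refine h2.congr fun y => ?_
    have h3 : Real.exp (-κ * y) = Real.exp κ * Real.exp (-(κ * (1 + y))) := by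
      rw [← Real.exp_add]
      congr 1
      ring
    simp only [Function.comp_apply, h3]
    rw [mul_pow]
    field_simp
  obtain ⟨T₂, hT₂⟩ := eventually_atTop.1 (hlim.eventually (eventually_le_nhds zero_lt_one))
  refine ⟨K * B, max T₁ T₂, fun z h1 h2 h3 => ?_⟩
  have him : (z - q).im = z.im := by simp
  have hw := hT₁ (z - q) (by rw [him]; exact (le_max_left _ _).trans h3)
  rw [him] at hw
  have hy := hT₂ |z.im| ((le_max_right _ _).trans h3)
  have hpos : 0 < 1 + |z.im| := by positivity
  rw [norm_mul, weight, le_div_iff₀ (by positivity)]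
  calc ‖Q.eval z‖ * ‖weightZero c G (z - q)‖ * (1 + |z.im|) ^ 2
      ≤ (K * (1 + |z.im|) ^ N) * (B * Real.exp (-κ * |z.im|)) * (1 + |z.im|) ^ 2 := by
        gcongr
        exact hQ z h1 h2
    _ = K * B * ((1 + |z.im|) ^ (N + 2) * Real.exp (-κ * |z.im|)) := by ring
    _ ≤ K * B * 1 := by gcongr
    _ = K * B := mul_one _

/-- On a vertical line without poles, the weight is integrable against polynomials. -/
theorem integrable_weight_line (hm : 0 < m) (hc_symm : ∀ i, c (-i) = c i) {G : ℂ[X]}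
    (hG : IsNumerator (2 * m) G) (Q : ℂ[X]) (q : ℤ) (a : ℝ)
    (ha : ∀ t : ℝ, (expPoly c (Finset.range (2 * m))).eval
      (ex m ((a : ℂ) + t * Complex.I - q)) ≠ 0) :
    Integrable fun t : ℝ => Q.eval ((a : ℂ) + t * Complex.I) *
      weight c G q ((a : ℂ) + t * Complex.I) := by
  obtain ⟨B, T₀, h⟩ := weight_decay c hm hc_symm hG Q q a a
  have hex : Continuous (ex m) := differentiable_ex.continuous
  have hcont : Continuous fun t : ℝ => Q.eval ((a : ℂ) + t * Complex.I) *
      weight c G q ((a : ℂ) + t * Complex.I) := by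
    have h1 : Continuous fun t : ℝ => ex m ((a : ℂ) + t * Complex.I - q) :=
      hex.comp (by fun_prop)
    have h2 : Continuous fun t : ℝ => weight c G q ((a : ℂ) + t * Complex.I) := by
      simp only [weight, weightZero_eq]
      exact h1.mul ((G.continuous.comp h1).div
        ((expPoly c (Finset.range (2 * m))).continuous.comp h1) ha)
    exact (Q.continuous.comp (by fun_prop)).mul h2
  refine LocallyIntegrable.integrable_of_isBigO_atBot_atTop (g := fun t : ℝ => (1 + t ^ 2)⁻¹)
    (g' := fun t : ℝ => (1 + t ^ 2)⁻¹) hcont.locallyIntegrable ?_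
    (integrable_inv_one_add_sq.integrableAtFilter _) ?_
    (integrable_inv_one_add_sq.integrableAtFilter _)
  all_goals
    refine Asymptotics.IsBigO.of_bound |B| ?_
    have key : ∀ t : ℝ, T₀ ≤ |t| → ‖Q.eval ((a : ℂ) + t * Complex.I) *
        weight c G q ((a : ℂ) + t * Complex.I)‖ ≤ |B| * ‖(1 + t ^ 2)⁻¹‖ := fun t ht => by
      have := h ((a : ℂ) + t * Complex.I) (by simp) (by simp) (by simpa using ht)
      refine this.trans ?_
      have hpos : 0 < 1 + t ^ 2 := by positivity
      have h3 : (((a : ℂ) + t * Complex.I).im) = t := by simp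
      rw [h3, Real.norm_eq_abs, abs_of_pos (inv_pos.2 hpos), ← div_eq_mul_inv]
      have h4 : 1 + t ^ 2 ≤ (1 + |t|) ^ 2 := by
        rw [← sq_abs t]
        nlinarith [abs_nonneg t]
      have := le_abs_self B
      gcongr
  · filter_upwards [eventually_le_atBot (-T₀)] with t ht
    exact key t ((le_neg_of_le_neg ht).trans (neg_le_abs t))
  · filter_upwards [eventually_ge_atTop T₀] with t ht
    exact key t (ht.trans (le_abs_self t))

end TypeD
end

/-! ### Polar parts in a strip, and numerators with prescribed residues. -/

noncomputable section
namespace TypeD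
open MeasureTheory Filter Topology Polynomial

variable {m : ℕ}

/-! ### Simple poles of the weight -/

/-- In a strip of width at most `n`, `exp (2πi z / n)` takes the value at an interior point `p`
only once, with multiplicity one. -/
theorem exists_ex_sub_factor (hm : 0 < m) {a b : ℝ} (hab : b - a ≤ ((2 * m : ℕ) : ℝ)) {p : ℂ}
    (ha : a < p.re) (hb : p.re < b) :
    ∃ D : ℂ → ℂ, Differentiable ℂ D ∧ (∀ z, ex m z - ex m p = (z - p) * D z) ∧
      D p = 2 * Real.pi * Complex.I / ((2 * m : ℕ) : ℂ) * ex m p ∧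
      ∀ z : ℂ, a ≤ z.re → z.re ≤ b → D z ≠ 0 := by
  let E : ℂ → ℂ := fun z => ex m z - ex m p
  have hE : Differentiable ℂ E := differentiable_ex.sub_const _
  have hn := period_ne_zero hm
  have hp := Complex.two_pi_I_ne_zero
  have hD : Differentiable ℂ (dslope E p) := by
    rw [← differentiableOn_univ, Complex.differentiableOn_dslope univ_mem]
    exact hE.differentiableOn
  have hDp : dslope E p p = 2 * Real.pi * Complex.I / ((2 * m : ℕ) : ℂ) * ex m p := by
    rw [dslope_same]
    exact ((hasDerivAt_ex p).sub_const _).deriv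
  have hEp : E p = 0 := sub_self _
  have hmul : ∀ z, E z = (z - p) * dslope E p z := fun z => by
    have := sub_smul_dslope E p z
    rw [hEp, sub_zero, smul_eq_mul] at this
    exact this.symm
  -- The zero at `p` is simple since the derivative is nonzero. The others are `p + nj`, at
  -- horizontal distance at least `n` from `p`, so a closed strip of width at most `n` with `p`
  -- inside misses them.
  refine ⟨dslope E p, hD, hmul, hDp, fun z hz1 hz2 h0 => ?_⟩
  rcases eq_or_ne z p with rfl | hzp
  · rw [hDp] at h0
    exact mul_ne_zero (div_ne_zero hp hn) (ex_ne_zero _) h0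
  · have h1 : ex m z = ex m p := by
      rw [← sub_eq_zero]
      change E z = 0
      rw [hmul, h0, mul_zero]
    obtain ⟨j, hj⟩ := (ex_eq_ex_iff hm).1 h1
    have hre := congrArg Complex.re hj
    have hj' : (p + ((2 * m : ℕ) : ℂ) * j).re = p.re + ((2 * m : ℕ) : ℝ) * j := by simp
    rw [hj'] at hre
    have hn0 : (0 : ℝ) < ((2 * m : ℕ) : ℝ) := by
      rw [Nat.cast_pos]
      omega
    have hj1 : (j : ℝ) < 1 := by
      have : ((2 * m : ℕ) : ℝ) * j < ((2 * m : ℕ) : ℝ) * 1 := by linarith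
      exact lt_of_mul_lt_mul_left this hn0.le
    have hj2 : (-1 : ℝ) < (j : ℝ) := by
      have : ((2 * m : ℕ) : ℝ) * (-1) < ((2 * m : ℕ) : ℝ) * j := by linarith
      exact lt_of_mul_lt_mul_left this hn0.le
    have hj0 : j = 0 := by
      have h1 : j < 1 := by exact_mod_cast hj1
      have h2 : -1 < j := by exact_mod_cast hj2
      omega
    rw [hj0] at hj
    exact hzp (by simpa using hj)

/-- The polar part of a quotient with a simple pole in the interior of a strip. -/
theorem exists_simple_polar_part {a b : ℝ} {p : ℂ} (ha : a < p.re) (hb : p.re < b) {M : ℂ → ℂ}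
    (hM : DifferentiableOn ℂ M {z | a ≤ z.re ∧ z.re ≤ b}) :
    ∃ K : ℂ → ℂ, DifferentiableOn ℂ K {z | a ≤ z.re ∧ z.re ≤ b} ∧
      ∀ z : ℂ, z ≠ p → M z * (z - p)⁻¹ = K z + M p * (z - p)⁻¹ := by
  have hS' : {z : ℂ | a ≤ z.re ∧ z.re ≤ b} ∈ 𝓝 p := by
    refine mem_of_superset (x := Complex.re ⁻¹' Set.Ioo a b) ?_ fun z hz => ⟨hz.1.le, hz.2.le⟩
    exact Complex.continuous_re.continuousAt.preimage_mem_nhds (Ioo_mem_nhds ha hb)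
  refine ⟨dslope M p, (Complex.differentiableOn_dslope hS').2 hM, fun z hz => ?_⟩
  have hzp : z - p ≠ 0 := sub_ne_zero.2 hz
  have hsl := sub_smul_dslope M p z
  rw [smul_eq_mul] at hsl
  have h2 : dslope M p z = (M z - M p) * (z - p)⁻¹ := by
    rw [← hsl]
    field_simp
  rw [h2]
  ring

/-- Polar part of `Q(z) / (1 - exp (2πi (p - z) / n))` in a strip of width at most `n`. -/
theorem exists_polar_part (hm : 0 < m) {a b : ℝ} (hab : b - a ≤ ((2 * m : ℕ) : ℝ)) {p : ℂ}
    (ha : a < p.re) (hb : p.re < b) (Q : ℂ[X]) :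
    ∃ K : ℂ → ℂ, DifferentiableOn ℂ K {z | a ≤ z.re ∧ z.re ≤ b} ∧
      ∀ z : ℂ, z ≠ p → Q.eval z * (ex m z / (ex m z - ex m p)) =
        K z + (Q.eval p * (((2 * m : ℕ) : ℂ) / (2 * Real.pi * Complex.I))) * (z - p)⁻¹ := by
  have hn := period_ne_zero hm
  have hp := Complex.two_pi_I_ne_zero
  obtain ⟨D, hD, hmul, hDp, hD0⟩ := exists_ex_sub_factor hm hab ha hb
  have hM : DifferentiableOn ℂ (fun z => Q.eval z * ex m z / D z) {z | a ≤ z.re ∧ z.re ≤ b} :=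
    ((Q.differentiable.mul differentiable_ex).differentiableOn).div hD.differentiableOn
      fun z hz => hD0 z hz.1 hz.2
  obtain ⟨K, hK, hK'⟩ := exists_simple_polar_part ha hb hM
  refine ⟨K, hK, fun z hz => ?_⟩
  -- The residue of `x/(x - ex m p)` at `p` is `n/(2πi)`, whatever `p` is.
  have hMp : Q.eval p * ex m p / D p =
      Q.eval p * (((2 * m : ℕ) : ℂ) / (2 * Real.pi * Complex.I)) := by
    have := ex_ne_zero (m := m) p
    rw [hDp]
    field_simp
  have h1 := hK' z hz
  rw [hMp] at h1
  rw [← h1, hmul z, ← mul_div_assoc, mul_comm (z - p), ← div_div, div_eq_mul_inv _ (z - p)]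

/-! ### Numerators with prescribed residues -/

/-- The polynomial `G` with `G / 𝐏 = ∑ A_l / (X - ρ_l)`. -/
def numer (c : ZMod (2 * m) → ℂ) (A : ℕ → ℂ) : ℂ[X] :=
  ∑ l ∈ Finset.range (2 * m), C (A l) * expPoly c ((Finset.range (2 * m)).erase l)

variable {c : ZMod (2 * m) → ℂ}

theorem X_sub_mul_expPoly_erase {l : ℕ} (hl : l < 2 * m) :
    (X - C (rho c l)) * expPoly c ((Finset.range (2 * m)).erase l) =
      expPoly c (Finset.range (2 * m)) := by
  rw [expPoly_eq, expPoly_eq]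
  exact Finset.mul_prod_erase _ (fun q : ℕ => X - C (rho c q)) (Finset.mem_range.2 hl)

theorem eval_numer_div (A : ℕ → ℂ) {x : ℂ}
    (hx : ∀ l < 2 * m, x ≠ rho c l) :
    (numer c A).eval x / (expPoly c (Finset.range (2 * m))).eval x =
      ∑ l ∈ Finset.range (2 * m), A l / (x - rho c l) := by
  rw [numer, eval_finsetSum, Finset.sum_div]
  refine Finset.sum_congr rfl fun l hl => ?_
  rw [Finset.mem_range] at hl
  rw [← X_sub_mul_expPoly_erase hl, eval_mul, eval_mul, eval_C, eval_sub, eval_X, eval_C]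
  have h1 : x - rho c l ≠ 0 := sub_ne_zero.2 (hx l hl)
  have h2 : (expPoly c ((Finset.range (2 * m)).erase l)).eval x ≠ 0 := by
    rw [expPoly_eq, eval_prod, Finset.prod_ne_zero_iff]
    intro q hq
    rw [Finset.mem_erase, Finset.mem_range] at hq
    rw [eval_sub, eval_X, eval_C]
    exact sub_ne_zero.2 (hx q hq.2)
  field_simp

/-- Divide the palindromic identity for `𝐏` by the reflection of `X - ρ_l`, which is `-ρ_l (X -
ρ_l⁻¹)` with `ρ_l⁻¹` the root of index `n - 1 - l`. -/
theorem reflect_expPoly_erase (hm : 0 < m) (hc_symm : ∀ i, c (-i) = c i) {l : ℕ}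
    (hl : l < 2 * m) :
    reflect (2 * m - 1) (expPoly c ((Finset.range (2 * m)).erase l)) =
      C (-rho c ((2 * m - 1 - l : ℕ) : ℤ)) *
        expPoly c ((Finset.range (2 * m)).erase (2 * m - 1 - l)) := by
  have hl' : 2 * m - 1 - l < 2 * m := by omega
  have hne : ∀ q, (X - C (rho c q) : ℂ[X]) ≠ 0 := fun q => X_sub_C_ne_zero _
  have h1 : reflect (1 + (2 * m - 1)) (expPoly c (Finset.range (2 * m))) =
      reflect 1 (X - C (rho c l)) *
        reflect (2 * m - 1) (expPoly c ((Finset.range (2 * m)).erase l)) := by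
    rw [← X_sub_mul_expPoly_erase hl]
    refine reflect_mul _ _ (natDegree_X_sub_C _).le ?_
    rw [natDegree_expPoly, Finset.card_erase_of_mem (Finset.mem_range.2 hl), Finset.card_range]
  have h2 := reflect_expPoly c hm hc_symm (symmIndices_range (m := m))
  rw [Finset.card_range] at h2
  rw [show 1 + (2 * m - 1) = 2 * m by omega, h2, reflect_sub, reflect_C, pow_one, reflect_one_X,
    one_sub_C_mul_X (rho_ne_zero c l), ← rho_symm c hm hc_symm hl,
    ← X_sub_mul_expPoly_erase hl'] at h1
  have h3 : rho c l * rho c ((2 * m - 1 - l : ℕ) : ℤ) = 1 := by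
    rw [rho_symm c hm hc_symm hl, mul_inv_cancel₀ (rho_ne_zero c l)]
  refine mul_left_cancel₀ (hne ((2 * m - 1 - l : ℕ) : ℤ)) ?_
  rw [mul_left_comm, h1]
  have h4 : C (rho c ((2 * m - 1 - l : ℕ) : ℤ)) * C (rho c l) = (1 : ℂ[X]) := by
    rw [← C_mul, mul_comm, h3, C_1]
  rw [C_neg, C_neg]
  linear_combination -((X - C (rho c ((2 * m - 1 - l : ℕ) : ℤ))) *
    reflect (2 * m - 1) (expPoly c ((Finset.range (2 * m)).erase l))) * h4

/-- Let `E_l` be `𝐏` without its `l`-th factor, so `X E_l = ρ_l E_l + 𝐏`. Antisymmetry of `A` makes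
the reflection of `G` in degree `n - 1` equal to `∑ A_l ρ_l E_l`, and `∑ A_l = 0` identifies this
with `X G`. Comparing coefficients gives both the degree bound and the symmetry. -/
theorem isNumerator_numer (hm : 0 < m) (hc_symm : ∀ i, c (-i) = c i) {A : ℕ → ℂ}
    (hA : ∀ l < 2 * m, A (2 * m - 1 - l) = -A l)
    (hsum : ∑ l ∈ Finset.range (2 * m), A l = 0) : IsNumerator (2 * m) (numer c A) := by
  have hXG : reflect (2 * m - 1) (numer c A) = X * numer c A := by
    have h1 : reflect (2 * m - 1) (numer c A) = ∑ l ∈ Finset.range (2 * m),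
        C (A (2 * m - 1 - l)) * (C (rho c ((2 * m - 1 - l : ℕ) : ℤ)) *
          expPoly c ((Finset.range (2 * m)).erase (2 * m - 1 - l))) := by
      have hsum' : ∀ s : Finset ℕ, ∀ f : ℕ → ℂ[X], reflect (2 * m - 1) (∑ l ∈ s, f l) =
          ∑ l ∈ s, reflect (2 * m - 1) (f l) := fun s f =>
        map_sum (⟨⟨reflect (2 * m - 1), reflect_zero⟩, fun f g => reflect_add f g _⟩ :
          ℂ[X] →+ ℂ[X]) f s
      rw [numer, hsum']
      refine Finset.sum_congr rfl fun l hl => ?_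
      rw [Finset.mem_range] at hl
      rw [reflect_C_mul, reflect_expPoly_erase hm hc_symm hl, hA l hl, C_neg, C_neg]
      ring
    have h2 := Finset.sum_range_reflect (fun l : ℕ => C (A l) * (C (rho c (l : ℤ)) *
      expPoly c ((Finset.range (2 * m)).erase l))) (2 * m)
    rw [h1, h2]
    have h3 : ∑ l ∈ Finset.range (2 * m), C (A l) * expPoly c (Finset.range (2 * m)) = 0 := by
      rw [← Finset.sum_mul, ← map_sum, hsum, C_0, zero_mul]
    rw [numer, Finset.mul_sum, ← sub_eq_zero, ← Finset.sum_sub_distrib]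
    rw [← neg_eq_zero, ← Finset.sum_neg_distrib, ← h3]
    refine Finset.sum_congr rfl fun l hl => ?_
    rw [← X_sub_mul_expPoly_erase (Finset.mem_range.1 hl)]
    ring
  have hdeg : ∀ i, 2 * m ≤ i → (numer c A).coeff i = 0 := by
    intro i hi
    rw [numer, finsetSum_coeff]
    refine Finset.sum_eq_zero fun l hl => ?_
    rw [coeff_C_mul, coeff_eq_zero_of_natDegree_lt, mul_zero]
    rw [natDegree_expPoly, Finset.card_erase_of_mem hl, Finset.card_range]
    omega
  have hcoeff : ∀ i, i ≤ 2 * m - 1 → (numer c A).coeff (2 * m - 1 - i) =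
      (X * numer c A).coeff i := fun i hi => by
    rw [← hXG, coeff_reflect, revAt_le hi]
  refine ⟨fun i hi => ?_, fun i j hij => ?_⟩
  -- The constant coefficient of `X G` is zero, and it equals the coefficient of degree `n - 1` of
  -- `G`.
  · rcases Nat.lt_or_ge i (2 * m) with h | h
    · have := hcoeff 0 (by omega)
      rw [coeff_X_mul_zero] at this
      rw [show i = 2 * m - 1 - 0 by omega, this]
    · exact hdeg i h
  · have := hcoeff (j + 1) (by omega)
    rw [coeff_X_mul] at this
    rw [← this]
    congr 1
    omega

end TypeD
end

/-! ### Difference equations for the trace functionals and for the line integrals. -/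

noncomputable section
namespace TypeD
open MeasureTheory Filter Topology Polynomial

/-! ### Uniqueness for difference equations -/

/-- Invariance on `X^{d+1}` reads `-a (d+1) δ(X^d)` plus values on lower powers equals zero, so
strong induction on `d` applies. -/
theorem eq_zero_of_shift_invariant {δ : ℂ[X] →ₗ[ℂ] ℂ} {a : ℂ} (ha : a ≠ 0)
    (h : ∀ R : ℂ[X], δ (R.comp (X - C a)) = δ R) : δ = 0 := by
  have key : ∀ d : ℕ, δ (X ^ d) = 0 := by
    intro d
    induction d using Nat.strong_induction_on with
    | _ d ih =>
      have h1 := h (X ^ (d + 1))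
      have h2 : ∀ j : ℕ, δ (X ^ j * C (-a) ^ (d + 1 - j) * ((d + 1).choose j : ℂ[X])) =
          (-a) ^ (d + 1 - j) * ((d + 1).choose j : ℂ) * δ (X ^ j) := fun j => by
        have h3 : X ^ j * C (-a) ^ (d + 1 - j) * ((d + 1).choose j : ℂ[X]) =
            ((-a) ^ (d + 1 - j) * ((d + 1).choose j : ℂ)) • X ^ j := by
          rw [smul_eq_C_mul, C_mul, C_pow, map_natCast]
          ring
        rw [h3, map_smul, smul_eq_mul]
      rw [X_pow_comp, sub_eq_add_neg, ← C_neg, add_pow, map_sum,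
        Finset.sum_congr rfl fun j _ => h2 j, Finset.sum_range_succ, Finset.sum_range_succ,
        Finset.sum_eq_zero fun j hj => by rw [ih j (Finset.mem_range.1 hj), mul_zero]] at h1
      have h3 : -a * ((d : ℂ) + 1) * δ (X ^ d) = 0 := by
        simpa using h1
      refine (mul_eq_zero.1 h3).resolve_left (mul_ne_zero (neg_ne_zero.2 ha) ?_)
      exact_mod_cast d.succ_ne_zero
  refine Polynomial.lhom_ext' fun d => LinearMap.ext_ring ?_
  simpa [monomial_one_right_eq_X_pow] using key d

/-- After `n` steps the family returns to the same functional, which is therefore invariant under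
translation by `n`. -/
theorem eq_zero_of_shift_family {δ : ℤ → ℂ[X] →ₗ[ℂ] ℂ} {n : ℕ} (hn : n ≠ 0)
    (hper : ∀ q, δ (q + n) = δ q)
    (h : ∀ q (R : ℂ[X]), δ q R = δ (q + 1) (R.comp (X - 1))) (q : ℤ) : δ q = 0 := by
  have hit : ∀ j : ℕ, ∀ R : ℂ[X], δ (q + j) (R.comp (X - C (j : ℂ))) = δ q R := by
    intro j
    induction j with
    | zero => simp
    | succ j ih =>
      intro R
      rw [← ih R, h (q + j), comp_assoc, Nat.cast_succ, ← add_assoc]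
      congr 2
      simp
      ring
  refine eq_zero_of_shift_invariant (a := (n : ℂ)) (Nat.cast_ne_zero.2 hn) fun R => ?_
  rw [← hit n R, hper]

variable {m : ℕ} {c : ZMod (2 * m) → ℂ}

/-! ### The jumps of the functionals of a trace -/

/-- The jump `T(e_q) - T(e_{q + 1})`. -/
def jump (T : H m c →ₗ[ℂ] ℂ) (q : ℤ) : ℂ := tau T q 1 - tau T (q + 1) 1

/-- Divide `R` by `X - (α_q - 1/2)`: the quotient part cancels by `tau_shift`, and the remainder is
the value of `R`. -/
theorem tau_sub_tau_succ (hm : 0 < m) (hc : c 0 ≠ 0) {T : H m c →ₗ[ℂ] ℂ} (hT : IsTrace T) (q : ℤ)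
    (R : ℂ[X]) :
    tau T q R - tau T (q + 1) (R.comp (X - 1)) = jump T q * R.eval (alpha c q - 1 / 2) := by
  set β := alpha c q - 1 / 2 with hβ
  obtain ⟨S, hS⟩ : X - C β ∣ R - C (R.eval β) := X_sub_C_dvd_sub_C_eval
  have hR : R = R.eval β • 1 + (X - C β) * S := by
    rw [← hS, smul_eq_C_mul, mul_one]
    ring
  have h2 : R.comp (X - 1) = R.eval β • 1 + (X - C (alpha c q + 1 / 2)) * S.comp (X - 1) := by
    nth_rewrite 1 [hR]
    simp only [add_comp, mul_comp, sub_comp, X_comp, C_comp, smul_comp, one_comp, hβ, C_sub, C_add]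
    have : (C (1 / 2) : ℂ[X]) + C (1 / 2) = 1 := by
      rw [← C_add]
      norm_num
    linear_combination (S.comp (X - 1)) * this
  rw [h2]
  nth_rewrite 1 [hR]
  rw [map_add, map_add, map_smul, map_smul, tau_shift hm hc hT, jump, smul_eq_mul, smul_eq_mul]
  ring

theorem jump_symm (hm : 0 < m) (hc : c 0 ≠ 0) (hc_symm : ∀ i, c (-i) = c i)
    {T : H m c →ₗ[ℂ] ℂ} (hT : IsTrace T) (q : ℤ) : jump T (-q - 1) = -jump T q := by
  have h := fun q => tau_neg hm hc hc_symm hT q 1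
  simp only [one_comp] at h
  rw [jump, jump, sub_add_cancel, h, show -q - 1 = -(q + 1) by ring, h]
  ring

theorem jump_add_period (hm : 0 < m) (T : H m c →ₗ[ℂ] ℂ) (q j : ℤ) :
    jump T (q + ((2 * m : ℕ) : ℤ) * j) = jump T q := by
  rw [jump, jump, tau_add_period hm, show q + ((2 * m : ℕ) : ℤ) * j + 1 =
    q + 1 + ((2 * m : ℕ) : ℤ) * j by ring, tau_add_period hm]

theorem sum_jump (hm : 0 < m) (T : H m c →ₗ[ℂ] ℂ) :
    ∑ l ∈ Finset.range (2 * m), jump T l = 0 := by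
  have h := Finset.sum_range_sub' (fun l : ℕ => tau T (l : ℤ) 1) (2 * m)
  have h1 := tau_add_period hm T 0 1
  rw [zero_add, mul_one] at h1
  rw [h1, Nat.cast_zero, sub_self] at h
  rw [← h]
  refine Finset.sum_congr rfl fun l _ => ?_
  rw [jump, Nat.cast_succ]

/-- The numerator of the weight of a trace. -/
def traceNumer (T : H m c →ₗ[ℂ] ℂ) : ℂ[X] :=
  -- The factor `1/n` compensates the residue `n/(2πi)` of `x/(x - ρ_l)`, so that `2πi` times each
  -- residue of the weight is a jump.
  numer c fun l => jump T l / ((2 * m : ℕ) : ℂ)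

theorem isNumerator_traceNumer (hm : 0 < m) (hc : c 0 ≠ 0) (hc_symm : ∀ i, c (-i) = c i)
    {T : H m c →ₗ[ℂ] ℂ} (hT : IsTrace T) : IsNumerator (2 * m) (traceNumer T) := by
  refine isNumerator_numer hm hc_symm (fun l hl => ?_) ?_
  · have h1 : ((2 * m - 1 - l : ℕ) : ℤ) = (-l - 1) + ((2 * m : ℕ) : ℤ) * 1 := by omega
    rw [h1, jump_add_period hm, jump_symm hm hc hc_symm hT, neg_div]
  · rw [← Finset.sum_div, sum_jump hm, zero_div]

/-! ### Positions of the poles -/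

variable (c) in
/-- The integer that moves `α_l` into the strip `|Re z| ≤ 1 / 2`. -/
def stripShift (l : ℤ) : ℤ := -round (alpha c l).re

theorem stripShift_spec (hα : ∀ i j : ℤ, (alpha c i).re ≠ j + 1 / 2) (l : ℤ) :
    -(1 / 2 : ℝ) < (alpha c l).re + stripShift c l ∧
      (alpha c l).re + stripShift c l < 1 / 2 := by
  have h := abs_le.1 (abs_sub_round (alpha c l).re)
  rw [stripShift, Int.cast_neg, ← sub_eq_add_neg]
  refine ⟨lt_of_le_of_ne h.1 fun he => hα l (round (alpha c l).re - 1) ?_,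
    lt_of_le_of_ne h.2 fun he => hα l (round (alpha c l).re) (by linarith)⟩
  push_cast
  linarith

theorem stripShift_unique (hα : ∀ i j : ℤ, (alpha c i).re ≠ j + 1 / 2) {l e : ℤ}
    (h1 : -(1 / 2 : ℝ) ≤ (alpha c l).re + e) (h2 : (alpha c l).re + e ≤ 1 / 2) :
    e = stripShift c l := by
  obtain ⟨h3, h4⟩ := stripShift_spec hα l
  have h5 : (e : ℝ) < stripShift c l + 1 := by linarith
  have h6 : (stripShift c l : ℝ) < e + 1 := by linarith
  have h7 : e < stripShift c l + 1 := by exact_mod_cast h5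
  have h8 : stripShift c l < e + 1 := by exact_mod_cast h6
  omega

theorem stripShift_add_period (hm : 0 < m) (l j : ℤ) :
    stripShift c (l + ((2 * m : ℕ) : ℤ) * j) = stripShift c l := by
  rw [stripShift, stripShift, alpha_add_period c hm]

theorem exists_stripShift_bound (hm : 0 < m) : ∃ D : ℤ, 0 ≤ D ∧ ∀ l, |stripShift c l| ≤ D := by
  refine ⟨∑ i ∈ Finset.range (2 * m), |stripShift c i|,
    Finset.sum_nonneg fun _ _ => abs_nonneg _, fun l => ?_⟩
  have hn : (0 : ℤ) < ((2 * m : ℕ) : ℤ) := by omega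
  have h1 := Int.emod_add_mul_ediv l ((2 * m : ℕ) : ℤ)
  have h2 := Int.emod_nonneg l hn.ne'
  have h3 := Int.emod_lt_of_pos l hn
  rw [← h1, stripShift_add_period hm]
  have h4 : l % ((2 * m : ℕ) : ℤ) = ((l % ((2 * m : ℕ) : ℤ)).toNat : ℤ) :=
    (Int.toNat_of_nonneg h2).symm
  rw [h4]
  exact Finset.single_le_sum (f := fun i : ℕ => |stripShift c i|) (fun _ _ => abs_nonneg _)
    (Finset.mem_range.2 (by omega))

/-- The pole of the class of `α_l` in the strip `-1 ≤ Re z ≤ 0`. -/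
def stripPole (c : ZMod (2 * m) → ℂ) (l : ℤ) : ℂ := alpha c l + stripShift c l - 1 / 2

theorem stripPole_re (l : ℤ) :
    (stripPole c l).re = (alpha c l).re + stripShift c l - 1 / 2 := by
  simp [stripPole]

/-- The candidate poles are `α_l + (q - l + nj) - 1/2`. In the strip the integer in brackets can
only be `stripShift c l`, so each class `l` gives at most one pole, under a congruence mod `n`. -/
theorem eq_stripPole (hm : 0 < m) (hα : ∀ i j : ℤ, (alpha c i).re ≠ j + 1 / 2) {q l : ℤ} {z : ℂ}
    (h1 : -1 ≤ z.re) (h2 : z.re ≤ 0) (hz : ex m (z - q) = rho c l) :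
    ((2 * m : ℕ) : ℤ) ∣ q - l - stripShift c l ∧ z = stripPole c l := by
  obtain ⟨j, hj⟩ := (ex_eq_ex_iff hm).1 hz
  have hz' : z = alpha c l + ((q - l + ((2 * m : ℕ) : ℤ) * j : ℤ) : ℂ) - 1 / 2 := by
    push_cast at hj ⊢
    linear_combination hj
  have hre : z.re = (alpha c l).re + ((q - l + ((2 * m : ℕ) : ℤ) * j : ℤ) : ℝ) - 1 / 2 := by
    rw [hz', Complex.sub_re, Complex.add_re, Complex.intCast_re]
    norm_num
  have he := stripShift_unique hα (l := l) (e := q - l + ((2 * m : ℕ) : ℤ) * j) (by linarith)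
    (by linarith)
  refine ⟨⟨-j, ?_⟩, ?_⟩
  · rw [← he]
    ring
  · rw [stripPole, ← he]
    exact hz'

theorem ex_stripPole (hm : 0 < m) {q l : ℤ}
    (h : ((2 * m : ℕ) : ℤ) ∣ q - l - stripShift c l) :
    ex m (stripPole c l) = ex m q * rho c l := by
  obtain ⟨j, hj⟩ := h
  rw [rho, ← ex_add, ex_eq_ex_iff hm]
  refine ⟨-j, ?_⟩
  have : (q : ℂ) - l - stripShift c l = ((2 * m : ℕ) : ℂ) * j := by exact_mod_cast hj
  rw [stripPole]
  push_cast at this ⊢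
  linear_combination -this

theorem exists_polar_part_term (hm : 0 < m) (hα : ∀ i j : ℤ, (alpha c i).re ≠ j + 1 / 2)
    (q l : ℤ) (R : ℂ[X]) :
    ∃ K : ℂ → ℂ, DifferentiableOn ℂ K {z | -1 ≤ z.re ∧ z.re ≤ 0} ∧ ∀ z : ℂ,
      (((2 * m : ℕ) : ℤ) ∣ q - l - stripShift c l → z ≠ stripPole c l) →
      R.eval z * (ex m (z - q) / (ex m (z - q) - rho c l)) = K z +
        if ((2 * m : ℕ) : ℤ) ∣ q - l - stripShift c l then
          (R.eval (stripPole c l) * (((2 * m : ℕ) : ℂ) / (2 * Real.pi * Complex.I))) *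
            (z - stripPole c l)⁻¹ else 0 := by
  by_cases h : ((2 * m : ℕ) : ℤ) ∣ q - l - stripShift c l
  · obtain ⟨h1, h2⟩ := stripShift_spec hα l
    have h3 := stripPole_re (c := c) l
    obtain ⟨K, hK, hK'⟩ := exists_polar_part hm (a := -1) (b := 0) (p := stripPole c l)
      (by
        have : (1 : ℝ) ≤ ((2 * m : ℕ) : ℝ) := by
          have : 1 ≤ 2 * m := by omega
          exact_mod_cast this
        linarith) (by linarith) (by linarith) R
    refine ⟨K, hK, fun z hz => ?_⟩
    rw [if_pos h, ← hK' z (hz h), ex_stripPole hm h, ex_sub]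
    have hq := ex_ne_zero (m := m) q
    congr 1
    rw [div_sub' hq, div_div_div_cancel_right₀ hq]
  · refine ⟨fun z => R.eval z * (ex m (z - q) / (ex m (z - q) - rho c l)), ?_, fun z _ => ?_⟩
    · have hex : Differentiable ℂ fun z : ℂ => ex m (z - q) :=
        differentiable_ex.comp (differentiable_id.sub_const _)
      refine R.differentiable.differentiableOn.mul (hex.differentiableOn.div
        (hex.sub_const _).differentiableOn fun z hz h0 => h ?_)
      exact (eq_stripPole hm hα hz.1 hz.2 (sub_eq_zero.1 h0)).1
    · rw [if_neg h, add_zero]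

/-! ### The functionals given by integrals -/

variable (c) in
/-- The functional `R ↦ ∫_{iℝ} R(z) w_q(z) dz`. -/
def lineInt (G : ℂ[X]) (q : ℤ) (R : ℂ[X]) : ℂ :=
  Complex.I * ∫ t : ℝ, R.eval (Complex.I * t) * weight c G q (Complex.I * t)

theorem weight_add_period (hm : 0 < m) (G : ℂ[X]) (q j : ℤ) (z : ℂ) :
    weight c G (q + ((2 * m : ℕ) : ℤ) * j) z = weight c G q z := by
  have h : z - ((q + ((2 * m : ℕ) : ℤ) * j : ℤ) : ℂ) =
      z - q + ((2 * m : ℕ) : ℂ) * ((-j : ℤ) : ℂ) := by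
    push_cast
    ring
  rw [weight, weight, weightZero_eq, weightZero_eq, h, ex_add_period hm]

theorem lineInt_eq (G : ℂ[X]) (q : ℤ) (R : ℂ[X]) : lineInt c G q R =
    Complex.I * ∫ t : ℝ, R.eval (((0 : ℝ) : ℂ) + t * Complex.I) *
      weight c G q (((0 : ℝ) : ℂ) + t * Complex.I) := by
  simp only [lineInt, Complex.ofReal_zero, zero_add, mul_comm Complex.I]

theorem weight_succ (G : ℂ[X]) (q : ℤ) (z : ℂ) : weight c G (q + 1) z = weight c G q (z - 1) := by
  rw [weight, weight]
  congr 1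
  push_cast
  ring

theorem lineInt_succ_comp (G : ℂ[X]) (q : ℤ) (R : ℂ[X]) :
    lineInt c G (q + 1) (R.comp (X - 1)) =
      Complex.I * ∫ t : ℝ, R.eval (((-1 : ℝ) : ℂ) + t * Complex.I) *
        weight c G q (((-1 : ℝ) : ℂ) + t * Complex.I) := by
  rw [lineInt_eq]
  congr 2
  funext t
  rw [weight_succ, eval_comp]
  have : ((0 : ℝ) : ℂ) + t * Complex.I - 1 = ((-1 : ℝ) : ℂ) + t * Complex.I := by
    push_cast
    ring
  simp only [eval_sub, eval_X, eval_one, this]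

/-- A zero with integral real part would put some `Re α_l` in `1/2 + ℤ`. Both edges of the strip are
thus free of poles. -/
theorem expPoly_eval_ne_zero_of_int_re (hm : 0 < m)
    (hα : ∀ i j : ℤ, (alpha c i).re ≠ j + 1 / 2) (q : ℤ) {z : ℂ} {j : ℤ} (hz : z.re = j) :
    (expPoly c (Finset.range (2 * m))).eval (ex m (z - q)) ≠ 0 := by
  rw [expPoly_eq, eval_prod, Finset.prod_ne_zero_iff]
  intro l _
  rw [eval_sub, eval_X, eval_C, sub_ne_zero]
  intro h
  obtain ⟨i, hi⟩ := (ex_eq_ex_iff hm).1 h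
  have hre := congrArg Complex.re hi
  have h1 : (z - q).re = z.re - q := by simp
  have h2 : (alpha c l - (l : ℤ) - 1 / 2 + ((2 * m : ℕ) : ℂ) * i).re =
      (alpha c l).re - (l : ℤ) - 1 / 2 + ((2 * m : ℕ) : ℝ) * i := by
    simp
  rw [h1, h2, hz] at hre
  refine hα l (j - q + l - ((2 * m : ℕ) : ℤ) * i) ?_
  push_cast at hre ⊢
  linarith

theorem integrable_traceWeight (hm : 0 < m) (hc_symm : ∀ i, c (-i) = c i)
    (hα : ∀ i j : ℤ, (alpha c i).re ≠ j + 1 / 2) {G : ℂ[X]} (hG : IsNumerator (2 * m) G)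
    (q j : ℤ) (R : ℂ[X]) :
    Integrable fun t : ℝ => R.eval (((j : ℝ) : ℂ) + t * Complex.I) *
      weight c G q (((j : ℝ) : ℂ) + t * Complex.I) :=
  integrable_weight_line c hm hc_symm hG R q j fun t =>
    expPoly_eval_ne_zero_of_int_re hm hα q (j := j) (by simp)

/-- Passing to `q + 1` and `R(X - 1)` amounts to moving the contour to `Re z = -1`, so the
difference is the sum of the residues in between, one for each partial fraction of `G/𝐏` with a pole
there. -/
theorem lineInt_sub_lineInt_succ (hm : 0 < m) (hc : c 0 ≠ 0) (hc_symm : ∀ i, c (-i) = c i)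
    (hα : ∀ i j : ℤ, (alpha c i).re ≠ j + 1 / 2) {T : H m c →ₗ[ℂ] ℂ} (hT : IsTrace T)
    (q : ℤ) (R : ℂ[X]) :
    lineInt c (traceNumer T) q R - lineInt c (traceNumer T) (q + 1) (R.comp (X - 1)) =
      ∑ l ∈ (Finset.range (2 * m)).filter
        (fun l : ℕ => ((2 * m : ℕ) : ℤ) ∣ q - l - stripShift c l),
        jump T l * R.eval (stripPole c l) := by
  have hG := isNumerator_traceNumer hm hc hc_symm hT
  choose K hK hK' using fun l : ℕ => exists_polar_part_term hm hα q l R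
  obtain ⟨B, T₀, hdecay⟩ := weight_decay c hm hc_symm hG R q (-1) 0
  set s := (Finset.range (2 * m)).filter
    (fun l : ℕ => ((2 * m : ℕ) : ℤ) ∣ q - l - stripShift c l) with hs
  have hn := period_ne_zero hm
  have hp := Complex.two_pi_I_ne_zero
  have hmem : ∀ l, l < 2 * m → ∀ z : ℂ, -1 ≤ z.re → z.re ≤ 0 → ex m (z - q) = rho c l →
      l ∈ s ∧ z = stripPole c l := by
    intro l hl z h1 h2 h3
    obtain ⟨h4, h5⟩ := eq_stripPole hm hα h1 h2 h3
    exact ⟨Finset.mem_filter.2 ⟨Finset.mem_range.2 hl, h4⟩, h5⟩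
  have key := integral_strip (a := -1) (b := 0) (by norm_num) s
    (fun l => jump T l / ((2 * m : ℕ) : ℂ) *
      (R.eval (stripPole c l) * (((2 * m : ℕ) : ℂ) / (2 * Real.pi * Complex.I))))
    (fun l => stripPole c l)
    (fun l _ => by
      obtain ⟨h1, h2⟩ := stripShift_spec hα l
      rw [stripPole_re]
      constructor <;> linarith)
    (F := fun z => R.eval z * weight c (traceNumer T) q z)
    (K := fun z => ∑ l ∈ Finset.range (2 * m), jump T l / ((2 * m : ℕ) : ℂ) * K l z)
    (DifferentiableOn.fun_sum fun l _ => (hK l).const_mul _)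
    (fun z h1 h2 hz => by
      have hne : ∀ l < 2 * m, ex m (z - q) ≠ rho c l := fun l hl h => by
        obtain ⟨h3, h4⟩ := hmem l hl z h1 h2 h
        exact hz l h3 h4
      rw [weight, weightZero_eq, traceNumer, eval_numer_div _ hne, hs, Finset.sum_filter,
        ← Finset.sum_add_distrib, Finset.mul_sum, Finset.mul_sum]
      refine Finset.sum_congr rfl fun l hl => ?_
      have h3 := hK' l z fun hd => hz l (Finset.mem_filter.2 ⟨hl, hd⟩)
      have h4 : eval z R * (ex m (z - q) * (jump T l / ((2 * m : ℕ) : ℂ) /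
          (ex m (z - q) - rho c l))) = jump T l / ((2 * m : ℕ) : ℂ) *
            (R.eval z * (ex m (z - q) / (ex m (z - q) - rho c l))) := by ring
      rw [h4, h3]
      split_ifs <;> ring)
    (B := |B|) (T₀ := T₀)
    (fun z h1 h2 h3 => (hdecay z h1 h2 h3).trans (by
      have h4 := abs_nonneg z.im
      have h5 := le_abs_self B
      have h6 : 1 + |z.im| ≤ (1 + |z.im|) ^ 2 := by nlinarith
      gcongr))
    (by simpa using integrable_traceWeight hm hc_symm hα hG q (-1) R)
    (by simpa using integrable_traceWeight hm hc_symm hα hG q 0 R)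
  rw [lineInt_eq, lineInt_succ_comp, ← mul_sub, key, Finset.mul_sum, Finset.mul_sum]
  refine Finset.sum_congr rfl fun l _ => ?_
  field_simp

end TypeD
end

/-! ### Point evaluations, and existence of the line formula. -/

noncomputable section
namespace TypeD
open MeasureTheory Filter Topology Polynomial

variable {m : ℕ} {c : ZMod (2 * m) → ℂ}

/-! ### The point evaluations in the line formula -/

theorem pointSum_add (q : ℤ) (b b' : ℤ × ℤ →₀ ℂ) (R : ℂ[X]) :
    pointSum c q (b + b') R = pointSum c q b R + pointSum c q b' R :=
  Finsupp.sum_add_index' (fun _ => zero_mul _) fun _ _ _ => add_mul _ _ _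

theorem pointSum_zero (q : ℤ) (R : ℂ[X]) : pointSum c q 0 R = 0 := Finsupp.sum_zero_index

theorem pointSum_single (q : ℤ) (p : ℤ × ℤ) (s : ℂ) (R : ℂ[X]) :
    pointSum c q (Finsupp.single p s) R =
      s * R.eval (alpha c p.1 + q - p.1 + ((2 * m : ℕ) : ℂ) * p.2 - 1 / 2) :=
  Finsupp.sum_single_index (zero_mul _)

theorem pointSum_sum {ι : Type*} (q : ℤ) (s : Finset ι) (b : ι → ℤ × ℤ →₀ ℂ) (R : ℂ[X]) :
    pointSum c q (∑ l ∈ s, b l) R = ∑ l ∈ s, pointSum c q (b l) R :=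
  map_sum (⟨⟨fun b => pointSum c q b R, pointSum_zero q R⟩, fun b b' => pointSum_add q b b' R⟩ :
    (ℤ × ℤ →₀ ℂ) →+ ℂ) b s

/-- The coefficient of the evaluation at `α_l - l + q - 1 / 2`. -/
def pointCoeff (T : H m c →ₗ[ℂ] ℂ) (q l : ℤ) : ℂ :=
  -- Going from `q` to `q + 1`, the first indicator changes only at `q = l`, giving the jump term of
  -- `tau`; the second only at `q = l + stripShift c l`, removing the residue found in the strip.
  -- The two agree unless `l` is close to `q`, which keeps the sum finite.
  jump T l * ((if q ≤ l then 1 else 0) - if q ≤ l + stripShift c l then 1 else 0)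

/-- The sum of point evaluations in the line formula of a trace, over a window of radius `D`. -/
def pointPart (T : H m c →ₗ[ℂ] ℂ) (D q : ℤ) (R : ℂ[X]) : ℂ :=
  ∑ l ∈ Finset.Icc (q - D) (q + D), pointCoeff T q l * R.eval (alpha c l - l + q - 1 / 2)

/-- An index `(i, j)` with `i ≠ q` of the point `α_l - l + q - 1 / 2`. -/
def pointIndex (m : ℕ) (q l : ℤ) : ℤ × ℤ :=
  -- The index `i = q` is not allowed, but `(q + n, 1)` names the same point as `(q, 0)` because `α`
  -- is `n`-periodic.
  if l = q then (q + ((2 * m : ℕ) : ℤ) * 1, 1) else (l, 0)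

/-- The coefficients of the line formula of a trace. -/
def pointData (T : H m c →ₗ[ℂ] ℂ) (D q : ℤ) : ℤ × ℤ →₀ ℂ :=
  ∑ l ∈ Finset.Icc (q - D) (q + D), Finsupp.single (pointIndex m q l) (pointCoeff T q l)

theorem pointData_apply (hm : 0 < m) (T : H m c →ₗ[ℂ] ℂ) (D q j : ℤ) :
    pointData T D q (q, j) = 0 := by
  rw [pointData, Finsupp.finsetSum_apply]
  refine Finset.sum_eq_zero fun l _ => Finsupp.single_eq_of_ne ?_
  rw [pointIndex]
  intro h
  split_ifs at h with hl
  · have := congrArg Prod.fst h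
    dsimp only at this
    omega
  · exact hl (congrArg Prod.fst h).symm

theorem pointSum_pointData (hm : 0 < m) (T : H m c →ₗ[ℂ] ℂ) (D q : ℤ) (R : ℂ[X]) :
    pointSum c q (pointData T D q) R = pointPart T D q R := by
  rw [pointData, pointSum_sum, pointPart]
  refine Finset.sum_congr rfl fun l _ => ?_
  rw [pointSum_single, pointIndex]
  split_ifs with h
  · rw [alpha_add_period c hm, h]
    push_cast
    ring_nf
  · push_cast
    ring_nf

theorem pointCoeff_eq_zero {D : ℤ} (hD' : ∀ l, |stripShift c l| ≤ D)
    (T : H m c →ₗ[ℂ] ℂ) {q l : ℤ} (hl : l ∉ Finset.Icc (q - D) (q + D)) :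
    pointCoeff T q l = 0 := by
  have := abs_le.1 (hD' l)
  rw [Finset.mem_Icc, not_and_or, not_le, not_le] at hl
  rw [pointCoeff]
  rcases hl with hl | hl
  · rw [if_neg (by omega), if_neg (by omega), sub_self, mul_zero]
  · rw [if_pos (by omega), if_pos (by omega), sub_self, mul_zero]

theorem pointPart_eq_sum {D : ℤ} (hD' : ∀ l, |stripShift c l| ≤ D)
    (T : H m c →ₗ[ℂ] ℂ) (q : ℤ) (R : ℂ[X]) {s : Finset ℤ}
    (hs : Finset.Icc (q - D) (q + D) ⊆ s) :
    pointPart T D q R = ∑ l ∈ s, pointCoeff T q l * R.eval (alpha c l - l + q - 1 / 2) :=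
  Finset.sum_subset hs fun l _ hl => by rw [pointCoeff_eq_zero hD' T hl, zero_mul]

theorem pointPart_add_period (hm : 0 < m) (T : H m c →ₗ[ℂ] ℂ) (D q : ℤ) (R : ℂ[X]) :
    pointPart T D (q + ((2 * m : ℕ) : ℤ) * 1) R = pointPart T D q R := by
  rw [pointPart, pointPart]
  refine Finset.sum_nbij' (fun l => l + ((2 * m : ℕ) : ℤ) * (-1))
    (fun l => l + ((2 * m : ℕ) : ℤ) * 1) ?_ ?_ ?_ ?_ ?_
  · intro l hl
    rw [Finset.mem_Icc] at *
    omega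
  · intro l hl
    rw [Finset.mem_Icc] at *
    omega
  · intro l _
    omega
  · intro l _
    omega
  · intro l _
    rw [pointCoeff, pointCoeff, jump_add_period hm, stripShift_add_period hm,
      alpha_add_period c hm]
    congr 2
    · congr 1
      · congr 1
        apply propext
        omega
      · congr 1
        apply propext
        omega
    · push_cast
      ring

/-- A class `l` mod `n` with `n ∣ q - l - stripShift c l` has exactly one representative satisfying
equality, namely `q - stripShift c l`, and it lies within `D` of `q`. -/
theorem sum_strip_eq (hm : 0 < m) {D : ℤ} (hD' : ∀ l, |stripShift c l| ≤ D)
    (f : ℤ → ℂ) (hf : ∀ l j, f (l + ((2 * m : ℕ) : ℤ) * j) = f l) (q : ℤ) {s : Finset ℤ}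
    (hs : Finset.Icc (q - D) (q + D) ⊆ s) :
    ∑ l ∈ s.filter (fun l => q = l + stripShift c l), f l =
      ∑ l ∈ (Finset.range (2 * m)).filter
        (fun l : ℕ => ((2 * m : ℕ) : ℤ) ∣ q - l - stripShift c l), f l := by
  have hn : (0 : ℤ) < ((2 * m : ℕ) : ℤ) := by omega
  have hmod : ∀ l : ℤ, ((l % ((2 * m : ℕ) : ℤ)).toNat : ℤ) =
      l + ((2 * m : ℕ) : ℤ) * (-(l / ((2 * m : ℕ) : ℤ))) := fun l => by
    rw [Int.toNat_of_nonneg (Int.emod_nonneg l hn.ne'), Int.emod_def]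
    ring
  refine Finset.sum_nbij' (fun l => (l % ((2 * m : ℕ) : ℤ)).toNat)
    (fun l => q - stripShift c l) ?_ ?_ ?_ ?_ ?_
  · intro l hl
    rw [Finset.mem_filter] at hl
    rw [Finset.mem_filter, Finset.mem_range]
    have h3 := Int.emod_lt_of_pos l hn
    refine ⟨by omega, ?_⟩
    rw [hmod, stripShift_add_period hm]
    refine ⟨l / ((2 * m : ℕ) : ℤ), ?_⟩
    linear_combination hl.2
  · intro l hl
    obtain ⟨j, hj⟩ := (Finset.mem_filter.1 hl).2
    have h1 := abs_le.1 (hD' l)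
    refine Finset.mem_filter.2 ⟨hs (Finset.mem_Icc.2 ⟨by omega, by omega⟩), ?_⟩
    have h2 : q - stripShift c l = l + ((2 * m : ℕ) : ℤ) * j := by linarith
    rw [h2, stripShift_add_period hm, ← h2]
    ring
  · intro l hl
    have hl' := (Finset.mem_filter.1 hl).2
    rw [hmod, stripShift_add_period hm]
    linarith
  · intro l hl
    obtain ⟨hl1, j, hj⟩ := Finset.mem_filter.1 hl
    rw [Finset.mem_range] at hl1
    have h2 : q - stripShift c l = l + ((2 * m : ℕ) : ℤ) * j := by linarith
    rw [h2, Int.add_mul_emod_self_left, Int.emod_eq_of_lt (by omega) (by omega), Int.toNat_natCast]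
  · intro l _
    rw [hmod, hf]

theorem pointPart_sub_pointPart_succ (hm : 0 < m) {D : ℤ} (hD : 0 ≤ D)
    (hD' : ∀ l, |stripShift c l| ≤ D) (T : H m c →ₗ[ℂ] ℂ) (q : ℤ) (R : ℂ[X]) :
    pointPart T D q R - pointPart T D (q + 1) (R.comp (X - 1)) =
      jump T q * R.eval (alpha c q - 1 / 2) - ∑ l ∈ (Finset.range (2 * m)).filter
        (fun l : ℕ => ((2 * m : ℕ) : ℤ) ∣ q - l - stripShift c l),
        jump T l * R.eval (stripPole c l) := by
  have hs1 : Finset.Icc (q - D) (q + D) ⊆ Finset.Icc (q - D) (q + D + 1) :=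
    Finset.Icc_subset_Icc le_rfl (by omega)
  have hs2 : Finset.Icc (q + 1 - D) (q + 1 + D) ⊆ Finset.Icc (q - D) (q + D + 1) :=
    Finset.Icc_subset_Icc (by omega) (by omega)
  rw [pointPart_eq_sum hD' T q R hs1, pointPart_eq_sum hD' T (q + 1) _ hs2,
    ← Finset.sum_sub_distrib]
  have h1 : ∀ l : ℤ, pointCoeff T q l * R.eval (alpha c l - l + q - 1 / 2) -
      pointCoeff T (q + 1) l * (R.comp (X - 1)).eval (alpha c l - l + ((q + 1 : ℤ) : ℂ) - 1 / 2) =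
      (if q = l then jump T l * R.eval (alpha c l - 1 / 2) else 0) -
        if q = l + stripShift c l then jump T l * R.eval (stripPole c l) else 0 := by
    intro l
    have h2 : alpha c l - l + ((q + 1 : ℤ) : ℂ) - 1 / 2 - 1 = alpha c l - l + q - 1 / 2 := by
      push_cast
      ring
    rw [eval_comp, eval_sub, eval_X, eval_one, h2, ← sub_mul, pointCoeff, pointCoeff, ← mul_sub]
    have h3 : ((if q ≤ l then (1 : ℂ) else 0) - if q ≤ l + stripShift c l then 1 else 0) -
        ((if q + 1 ≤ l then 1 else 0) - if q + 1 ≤ l + stripShift c l then 1 else 0) =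
        (if q = l then 1 else 0) - if q = l + stripShift c l then 1 else 0 := by
      have h4 : ∀ a : ℤ, (if q ≤ a then (1 : ℂ) else 0) - (if q + 1 ≤ a then 1 else 0) =
          if q = a then 1 else 0 := fun a => by
        split_ifs <;> first | omega | simp
      rw [← h4 l, ← h4 (l + stripShift c l)]
      ring
    rw [h3, mul_sub, sub_mul]
    congr 1
    · split_ifs with h
      · rw [h]
        ring_nf
      · ring
    · split_ifs with h
      · rw [stripPole]
        have h5 : alpha c l - l + (q : ℂ) - 1 / 2 = alpha c l + stripShift c l - 1 / 2 := by
          have : (q : ℂ) = l + stripShift c l := by exact_mod_cast h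
          rw [this]
          ring
        rw [h5, mul_one]
      · ring
  rw [Finset.sum_congr rfl fun l _ => h1 l, Finset.sum_sub_distrib, ← Finset.sum_filter
    (fun l => q = l + stripShift c l), Finset.sum_ite_eq,
    if_pos (Finset.mem_Icc.2 ⟨by omega, by omega⟩),
    sum_strip_eq hm hD' (fun l => jump T l * R.eval (stripPole c l)) _ q hs1]
  intro l j
  simp only [stripPole, jump_add_period hm, stripShift_add_period hm, alpha_add_period c hm]

/-- Every trace has a line formula when no pole of the weights lies on the line of integration. -/
theorem exists_hasLineFormula (hm : 0 < m) (hc : c 0 ≠ 0) (hc_symm : ∀ i, c (-i) = c i)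
    (hα : ∀ i j : ℤ, (alpha c i).re ≠ j + 1 / 2) {T : H m c →ₗ[ℂ] ℂ} (hT : IsTrace T) :
    ∃ (G : ℂ[X]) (a : ℤ → ℤ × ℤ →₀ ℂ), HasLineFormula c T G a := by
  obtain ⟨D, hD, hD'⟩ := exists_stripShift_bound (c := c) hm
  have hG := isNumerator_traceNumer hm hc hc_symm hT
  have hint : ∀ (q : ℤ) (R : ℂ[X]), Integrable
      (fun t : ℝ => R.eval (Complex.I * t) * weight c (traceNumer T) q (Complex.I * t)) := by
    intro q R
    have := integrable_traceWeight hm hc_symm hα hG q 0 R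
    simpa [mul_comm Complex.I] using this
  -- The error of the proposed formula. In its difference equation the jump terms and the strip
  -- residues cancel, so `eq_zero_of_shift_family` applies.
  let δ : ℤ → ℂ[X] →ₗ[ℂ] ℂ := fun q =>
    { toFun := fun R => tau T q R - (lineInt c (traceNumer T) q R + pointPart T D q R)
      map_add' := fun R S => by
        have h1 : lineInt c (traceNumer T) q (R + S) =
            lineInt c (traceNumer T) q R + lineInt c (traceNumer T) q S := by
          simp only [lineInt]
          rw [← mul_add, ← integral_add (hint q R) (hint q S)]
          simp only [eval_add, add_mul]
        have h2 : pointPart T D q (R + S) = pointPart T D q R + pointPart T D q S := by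
          simp only [pointPart, eval_add, mul_add, Finset.sum_add_distrib]
        rw [h1, h2, map_add]
        ring
      map_smul' := fun r R => by
        have h1 : lineInt c (traceNumer T) q (r • R) = r * lineInt c (traceNumer T) q R := by
          simp only [lineInt]
          simp only [eval_smul, smul_eq_mul, mul_assoc]
          rw [integral_const_mul, mul_left_comm]
        have h2 : pointPart T D q (r • R) = r * pointPart T D q R := by
          simp only [pointPart, eval_smul, smul_eq_mul, Finset.mul_sum]
          exact Finset.sum_congr rfl fun l _ => by ring
        rw [h1, h2, map_smul, smul_eq_mul, RingHom.id_apply, smul_eq_mul]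
        ring }
  have hδ : ∀ q R, δ q R =
      tau T q R - (lineInt c (traceNumer T) q R + pointPart T D q R) := fun q R => rfl
  have hzero : ∀ q, δ q = 0 := by
    refine eq_zero_of_shift_family (n := 2 * m) (by omega) (fun q => ?_) (fun q R => ?_)
    · refine LinearMap.ext fun R => ?_
      have h1 := tau_add_period hm T q 1
      have h2 := pointPart_add_period hm T D q R
      have h3 : lineInt c (traceNumer T) (q + ((2 * m : ℕ) : ℤ) * 1) R =
          lineInt c (traceNumer T) q R := by
        simp only [lineInt, weight_add_period hm]
      rw [mul_one] at h1 h2 h3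
      rw [hδ, hδ, h1, h2, h3]
    · rw [← sub_eq_zero, hδ, hδ]
      linear_combination tau_sub_tau_succ hm hc hT q R -
        lineInt_sub_lineInt_succ hm hc hc_symm hα hT q R -
        pointPart_sub_pointPart_succ hm hD hD' T q R
  refine ⟨traceNumer T, pointData T D, hG, fun q j => pointData_apply hm T D q j, hint,
    fun q R => ?_⟩
  have := LinearMap.congr_fun (hzero q) R
  rw [hδ, LinearMap.zero_apply, sub_eq_zero] at this
  rw [pointSum_pointData hm, ← tau_apply, this]
  rfl

end TypeD
end

/-! ### Poles of an integrable weight, and its factorisation over the strip `|Re z| < n/2`. -/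

noncomputable section
namespace TypeD
open MeasureTheory Filter Topology Polynomial

variable {m : ℕ} {c : ZMod (2 * m) → ℂ}

/-! ### Poles of an integrable weight -/

theorem ex_line_injective (hm : 0 < m) :
    Function.Injective fun t : ℝ => ex m ((t : ℂ) * Complex.I) := by
  intro t s h
  have h1 := congrArg norm h
  simp only [norm_ex, Complex.im_ofReal_mul, Complex.I_im, mul_one] at h1
  have h2 := Real.exp_injective h1
  have hn : ((2 * m : ℕ) : ℝ) ≠ 0 := by
    rw [Nat.cast_ne_zero]
    omega
  have h3 : -(2 * Real.pi / ((2 * m : ℕ) : ℝ)) ≠ 0 :=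
    neg_ne_zero.2 (div_ne_zero Real.two_pi_pos.ne' hn)
  exact mul_left_cancel₀ h3 h2

theorem finite_line_zeros (hm : 0 < m) {P : ℂ[X]} (hP : P ≠ 0) :
    {t : ℝ | P.eval (ex m ((t : ℂ) * Complex.I)) = 0}.Finite := by
  have h1 : {x : ℂ | P.IsRoot x}.Finite := finite_setOfPred_isRoot hP
  exact h1.preimage (ex_line_injective hm).injOn

/-- If a quotient in `exp (2πi z / n)` is integrable on the line `iℝ`, then its reduced denominator
has no zero there. -/
theorem reduced_denom_ne_zero (hm : 0 < m) {G₁ P₁ D : ℂ[X]} (hP : P₁ * D ≠ 0)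
    (hcop : IsCoprime G₁ P₁)
    (hint : Integrable fun t : ℝ => ex m ((t : ℂ) * Complex.I) *
      ((G₁ * D).eval (ex m ((t : ℂ) * Complex.I)) /
        (P₁ * D).eval (ex m ((t : ℂ) * Complex.I)))) (t₀ : ℝ) :
    P₁.eval (ex m ((t₀ : ℂ) * Complex.I)) ≠ 0 := by
  -- At such a zero the integrand is `v/u` with `v(t₀) ≠ 0` and `u = O(t - t₀)`. It is then at least
  -- of order `1/|t - t₀|`, which is not integrable.
  intro h0
  let w : ℝ → ℂ := fun t => ex m ((t : ℂ) * Complex.I)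
  have hw : Differentiable ℝ w := by
    refine ((differentiable_ex (m := m)).restrictScalars ℝ).comp ?_
    exact Complex.ofRealCLM.differentiable.mul_const _
  let u : ℝ → ℂ := fun t => P₁.eval (w t)
  let v : ℝ → ℂ := fun t => w t * G₁.eval (w t)
  let f : ℝ → ℂ := fun t => w t * ((G₁ * D).eval (w t) / (P₁ * D).eval (w t))
  have hu : Differentiable ℝ u := (P₁.differentiable.restrictScalars ℝ).comp hw
  have hv : Continuous v := hw.continuous.mul (G₁.continuous.comp hw.continuous)
  have hv0 : v t₀ ≠ 0 := by
    refine mul_ne_zero (ex_ne_zero _) fun h => ?_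
    obtain ⟨A, B, hAB⟩ := hcop
    have := congrArg (eval (w t₀)) hAB
    rw [eval_add, eval_mul, eval_mul, h, eval_one] at this
    simp [w, h0] at this
  have hne : ∀ᶠ t in 𝓝[≠] t₀, (P₁ * D).eval (w t) ≠ 0 := by
    have hfin := (finite_line_zeros hm hP).subset
      (Set.sdiff_subset (t := {t₀}))
    have h1 : ({t : ℝ | (P₁ * D).eval (w t) = 0} \ {t₀})ᶜ ∈ 𝓝 t₀ :=
      hfin.isClosed.isOpen_compl.mem_nhds fun h => h.2 rfl
    filter_upwards [mem_nhdsWithin_of_mem_nhds h1, self_mem_nhdsWithin] with t ht ht' h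
    exact ht ⟨h, ht'⟩
  have hu1 : u =O[𝓝[≠] t₀] fun t => t - t₀ := by
    have h1 := (hu t₀).isBigO_sub
    have h2 : u t₀ = 0 := h0
    simp only [h2, sub_zero] at h1
    exact h1.mono nhdsWithin_le_nhds
  have hu2 : (fun t => (t - t₀)⁻¹) =O[𝓝[≠] t₀] fun t => (u t)⁻¹ := by
    refine hu1.inv_rev ?_
    filter_upwards [hne] with t ht h
    rw [eval_mul] at ht
    exact absurd h (left_ne_zero_of_mul ht)
  have hv1 : (fun t => (v t)⁻¹) =O[𝓝[≠] t₀] fun _ => (1 : ℝ) :=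
    ((hv.continuousAt.inv₀ hv0).tendsto.mono_left nhdsWithin_le_nhds).isBigO_one ℝ
  have hvne : ∀ᶠ t in 𝓝[≠] t₀, v t ≠ 0 :=
    (hv.continuousAt.eventually_ne hv0).filter_mono nhdsWithin_le_nhds
  have huf : (fun t => (u t)⁻¹) =ᶠ[𝓝[≠] t₀] fun t => (v t)⁻¹ * f t := by
    filter_upwards [hne, hvne] with t ht hvt
    rw [eval_mul] at ht
    have h1 := left_ne_zero_of_mul ht
    have h2 := right_ne_zero_of_mul ht
    have h3 : f t = v t / u t := by
      simp only [f, v, u, eval_mul]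
      rw [mul_div_mul_right _ _ h2, mul_div_assoc]
    rw [h3]
    field_simp
  have hfin : (fun t => (t - t₀)⁻¹) =O[𝓝[≠] t₀] f := by
    refine hu2.trans (huf.trans_isBigO ?_)
    have := hv1.mul (Asymptotics.isBigO_refl f (𝓝[≠] t₀)).norm_right
    simp only [one_mul] at this
    exact Asymptotics.isBigO_norm_right.1 this
  refine not_intervalIntegrable_of_sub_inv_isBigO_punctured hfin (a := t₀ - 1) (b := t₀ + 1)
    (by linarith) ?_ hint.intervalIntegrable
  rw [Set.uIcc_of_le (by linarith)]
  exact ⟨by linarith, by linarith⟩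

theorem differentiable_multiset_prod {ι : Type*} (s : Multiset ι) {D : ι → ℂ → ℂ}
    (hD : ∀ i ∈ s, Differentiable ℂ (D i)) :
    Differentiable ℂ fun z => (s.map fun i => D i z).prod := by
  induction s using Multiset.induction_on with
  | empty => simp
  | cons i s ih =>
    simp only [Multiset.map_cons, Multiset.prod_cons]
    exact (hD i (Multiset.mem_cons_self i s)).mul
      (ih fun j hj => hD j (Multiset.mem_cons_of_mem hj))

/-- The point of the strip `|Re z| < n / 2` at which `exp (2πi (z - n / 2) / n)` takes a given
value. -/
theorem exists_strip_point (hm : 0 < m) {x : ℂ} (hx : x ≠ 0)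
    (hx' : ∀ t : ℝ, ex m ((t : ℂ) * Complex.I) ≠ x) :
    ∃ p : ℂ, -(m : ℝ) < p.re ∧ p.re < m ∧ ex m (p - m) = x := by
  have hn := period_ne_zero hm
  have hp := Complex.two_pi_I_ne_zero
  have hn0 : (0 : ℝ) < ((2 * m : ℕ) : ℝ) := by
    rw [Nat.cast_pos]
    omega
  set y : ℂ := ((2 * m : ℕ) : ℂ) / (2 * Real.pi * Complex.I) * Complex.log x with hy
  have hexy : ex m y = x := by
    rw [ex, hy, ← mul_assoc, div_mul_div_cancel₀ hn, div_self hp, one_mul, Complex.exp_log hx]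
  set j : ℤ := ⌊y.re / ((2 * m : ℕ) : ℝ)⌋ with hj
  have h1 : (j : ℝ) * ((2 * m : ℕ) : ℝ) ≤ y.re := (le_div_iff₀ hn0).1 (Int.floor_le _)
  have h2 : y.re < (j + 1 : ℝ) * ((2 * m : ℕ) : ℝ) := (div_lt_iff₀ hn0).1 (Int.lt_floor_add_one _)
  have hre : (y - ((2 * m : ℕ) : ℂ) * j).re = y.re - ((2 * m : ℕ) : ℝ) * j := by simp
  have hex : ex m (y - ((2 * m : ℕ) : ℂ) * j) = x := by
    rw [← hexy, ex_eq_ex_iff hm]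
    refine ⟨-j, ?_⟩
    push_cast
    ring
  have hexm : ex m (y - ((2 * m : ℕ) : ℂ) * j - m - m) = x := by
    rw [← hex, ex_eq_ex_iff hm]
    refine ⟨-1, ?_⟩
    push_cast
    ring
  refine ⟨y - ((2 * m : ℕ) : ℂ) * j - m, ?_, ?_, hexm⟩
  · rw [Complex.sub_re, hre, Complex.natCast_re]
    -- The floor only gives a half-open strip. Its left edge is excluded because there `x` would be
    -- a value of the exponential on `iℝ`.
    have h3 : y.re - ((2 * m : ℕ) : ℝ) * j ≠ 0 := by
      intro h3
      rw [← hre] at h3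
      refine hx' (y - ((2 * m : ℕ) : ℂ) * j).im ?_
      rw [← hex]
      congr 1
      refine Complex.ext ?_ ?_
      · simpa using h3.symm
      · simp
    have h4 : 0 ≤ y.re - ((2 * m : ℕ) : ℝ) * j := by linarith
    have := lt_of_le_of_ne h4 h3.symm
    linarith
  · rw [Complex.sub_re, hre, Complex.natCast_re]
    push_cast at *
    linarith

/-- The reduced weight is the quotient of a holomorphic function by a polynomial in the strip. -/
theorem exists_strip_quotient (hm : 0 < m) {G₁ P₁ : ℂ[X]} (hP₁ : P₁.eval 0 ≠ 0)
    (hcop : IsCoprime G₁ P₁)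
    (hline : ∀ t : ℝ, P₁.eval (ex m ((t : ℂ) * Complex.I)) ≠ 0) :
    ∃ (p N : ℂ → ℂ), (∀ x ∈ P₁.roots, (-(m : ℝ) < (p x).re ∧ (p x).re < m) ∧
        ex m (p x - m) = x ∧ N (p x) ≠ 0) ∧
      DifferentiableOn ℂ N {z | -(m : ℝ) ≤ z.re ∧ z.re ≤ m} ∧
      ∀ z : ℂ, ex m (z - m) * (G₁.eval (ex m (z - m)) / P₁.eval (ex m (z - m))) =
        N z / ((P₁.roots.map fun x => X - C (p x)).prod).eval z := by
  have hP₁' : P₁ ≠ 0 := fun h => hP₁ (by rw [h, eval_zero])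
  have hpt : ∀ x : ℂ, ∃ p : ℂ, x ∈ P₁.roots →
      -(m : ℝ) < p.re ∧ p.re < m ∧ ex m (p - m) = x := by
    intro x
    by_cases hx : x ∈ P₁.roots
    · have hr := (mem_roots hP₁').1 hx
      obtain ⟨p, hp⟩ := exists_strip_point hm (x := x)
        (fun h => hP₁ (by rw [h] at hr; exact hr)) (fun t ht => hline t (by rw [ht]; exact hr))
      exact ⟨p, fun _ => hp⟩
    · exact ⟨0, fun h => absurd h hx⟩
  choose p hp using hpt
  have hfac : ∀ x : ℂ, ∃ D : ℂ → ℂ, x ∈ P₁.roots → Differentiable ℂ D ∧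
      (∀ z, ex m (z - m) - x = (z - p x) * D z) ∧
      ∀ z : ℂ, -(m : ℝ) ≤ z.re → z.re ≤ m → D z ≠ 0 := by
    intro x
    by_cases hx : x ∈ P₁.roots
    · obtain ⟨h1, h2, h3⟩ := hp x hx
      obtain ⟨D, hD, hmul, -, hD0⟩ := exists_ex_sub_factor hm (a := -(2 * m : ℝ)) (b := 0)
        (p := p x - m) (by push_cast; linarith)
        (by rw [Complex.sub_re, Complex.natCast_re]; linarith)
        (by rw [Complex.sub_re, Complex.natCast_re]; linarith)
      refine ⟨fun z => D (z - m), fun _ => ⟨hD.comp (differentiable_id.sub_const _),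
        fun z => ?_, fun z h4 h5 => ?_⟩⟩
      · have := hmul (z - m)
        rw [h3] at this
        rw [this]
        ring
      · refine hD0 _ ?_ ?_ <;> rw [Complex.sub_re, Complex.natCast_re] <;> linarith
    · exact ⟨0, fun h => absurd h hx⟩
  choose D hD using hfac
  -- Each factor `ex m (z - m) - x` is `z - p x` times a function without zeros in the strip; `E`
  -- collects these functions, and the linear factors form the polynomial denominator,
  -- multiplicities included.
  set E : ℂ → ℂ := fun z => (P₁.roots.map fun x => D x z).prod with hE
  have hEd : Differentiable ℂ E := differentiable_multiset_prod _ fun x hx => (hD x hx).1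
  have hE0 : ∀ z : ℂ, -(m : ℝ) ≤ z.re → z.re ≤ m → E z ≠ 0 := by
    intro z h1 h2
    refine Multiset.prod_ne_zero fun h => ?_
    obtain ⟨x, hx, hx0⟩ := Multiset.mem_map.1 h
    exact (hD x hx).2.2 z h1 h2 hx0
  have hlc : P₁.leadingCoeff ≠ 0 := leadingCoeff_ne_zero.2 hP₁'
  have hex : Differentiable ℂ fun z : ℂ => ex m (z - m) :=
    differentiable_ex.comp (differentiable_id.sub_const _)
  refine ⟨p, fun z => ex m (z - m) * G₁.eval (ex m (z - m)) / (P₁.leadingCoeff * E z),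
    fun x hx => ⟨⟨(hp x hx).1, (hp x hx).2.1⟩, (hp x hx).2.2, ?_⟩, ?_, fun z => ?_⟩
  · obtain ⟨h1, h2, h3⟩ := hp x hx
    refine div_ne_zero (mul_ne_zero (ex_ne_zero _) fun h => ?_)
      (mul_ne_zero hlc (hE0 _ h1.le h2.le))
    rw [h3] at h
    obtain ⟨A, B, hAB⟩ := hcop
    have := congrArg (eval x) hAB
    have hr : P₁.eval x = 0 := (mem_roots hP₁').1 hx
    rw [eval_add, eval_mul, eval_mul, h, hr, eval_one] at this
    simp at this
  · exact (hex.mul (G₁.differentiable.comp hex)).differentiableOn.div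
      (hEd.const_mul _).differentiableOn fun z hz => mul_ne_zero hlc (hE0 z hz.1 hz.2)
  · have h1 : P₁.eval (ex m (z - m)) = P₁.leadingCoeff *
        (((P₁.roots.map fun x => X - C (p x)).prod).eval z * E z) := by
      rw [(IsAlgClosed.splits P₁).eval_eq_prod_roots, hE, eval_multiset_prod, Multiset.map_map,
        ← Multiset.prod_map_mul]
      congr 2
      refine Multiset.map_congr rfl fun x hx => ?_
      rw [(hD x hx).2.1 z]
      simp
    rw [h1, div_div, ← mul_div_assoc]
    congr 1
    ring

end TypeD
end

/-! ### Residues in the large strip, and divisibility tests. -/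

noncomputable section
namespace TypeD
open MeasureTheory Filter Topology Polynomial

variable {m : ℕ} {c : ZMod (2 * m) → ℂ}

/-! ### Residues of the weight in the strip -/

theorem exists_abs_im_bound (s : Finset ℂ) : ∃ T₀ : ℝ, ∀ z ∈ s, |z.im| < T₀ := by
  obtain ⟨B, hB⟩ := (s.image fun z => |z.im|).bddAbove
  exact ⟨B + 1, fun z hz => (hB (Finset.mem_coe.2 (Finset.mem_image_of_mem _ hz))).trans_lt
    (lt_add_one B)⟩

theorem eval_expPoly_ne_zero_of_im {s : Finset ℕ} {z : ℂ} (hm : 0 < m)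
    (hz : ∀ q ∈ s, (alpha c q).im ≠ z.im) : (expPoly c s).eval (ex m z) ≠ 0 := by
  rw [expPoly_eq, eval_prod, Finset.prod_ne_zero_iff]
  intro q hq h
  rw [eval_sub, eval_X, eval_C, sub_eq_zero, rho, ex_eq_ex_iff hm] at h
  obtain ⟨j, hj⟩ := h
  refine hz q hq ?_
  rw [hj]
  simp

/-- Since `Q/L = S/(X - p)`, the function `Q(z) w_0(z - m)` becomes `S N/(z - p)`, with at most one
simple pole. As `w_0` has period `n = 2m`, the lines `Re z = ±m` carry the same values of the
weight, so the two line integrals bound one strip. -/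
theorem strip_residue (hm : 0 < m) (hc_symm : ∀ i, c (-i) = c i) {G : ℂ[X]}
    (hG : IsNumerator (2 * m) G)
    (hint : ∀ R : ℂ[X], Integrable fun t : ℝ =>
      R.eval (Complex.I * t) * weight c G 0 (Complex.I * t))
    {G₁ P₁ D L : ℂ[X]} {N : ℂ → ℂ} (hGD : G = G₁ * D)
    (hPD : expPoly c (Finset.range (2 * m)) = P₁ * D) (hL : L ≠ 0)
    (hroots : ∀ z, L.IsRoot z → -(m : ℝ) < z.re ∧ z.re < m)
    (hN : DifferentiableOn ℂ N {z | -(m : ℝ) ≤ z.re ∧ z.re ≤ m})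
    (hw : ∀ z : ℂ, ex m (z - m) * (G₁.eval (ex m (z - m)) / P₁.eval (ex m (z - m))) =
      N z / L.eval z)
    {p : ℂ} (hp : -(m : ℝ) < p.re ∧ p.re < m) {Q S : ℂ[X]} (hQ : Q * (X - C p) = L * S) :
    lineInt c G 0 (Q.comp (X + C (m : ℂ))) - lineInt c G 0 (Q.comp (X - C (m : ℂ))) =
      2 * Real.pi * Complex.I * (S.eval p * N p) := by
  set P := expPoly c (Finset.range (2 * m)) with hPdef
  have hP0 : P ≠ 0 := (expPoly_monic c _).ne_zero
  set F : ℂ → ℂ := fun z => S.eval z * N z * (z - p)⁻¹ with hF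
  have hFw : ∀ z : ℂ, z ≠ p → ¬L.IsRoot z → P.eval (ex m (z - m)) ≠ 0 →
      F z = Q.eval z * weightZero c G (z - m) := by
    intro z hz hLz hPz
    have hD : D.eval (ex m (z - m)) ≠ 0 := by
      rw [hPD, eval_mul] at hPz
      exact right_ne_zero_of_mul hPz
    have hwz : weightZero c G (z - m) = N z / L.eval z := by
      rw [← hw, weightZero_eq, ← hPdef, hPD, hGD, eval_mul, eval_mul, mul_div_mul_right _ _ hD]
    have h1 := congrArg (eval z) hQ
    rw [eval_mul, eval_mul, eval_sub, eval_X, eval_C] at h1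
    have h2 : z - p ≠ 0 := sub_ne_zero.2 hz
    have h3 : L.eval z ≠ 0 := hLz
    rw [hwz, hF]
    field_simp
    linear_combination -N z * h1
  -- The equality is only almost everywhere: the finitely many zeros of `P` on the line are
  -- discarded, since at a zero of the cancelled factor `D` the unreduced quotient is a division by
  -- zero with value `0`.
  have hline : ∀ s : ℝ, s = -m ∨ s = m →
      (fun t : ℝ => F (s + t * Complex.I)) =ᵐ[volume] fun t : ℝ =>
        (Q.comp (X + C (s : ℂ))).eval (Complex.I * t) * weight c G 0 (Complex.I * t) := by
    intro s hs
    have hm' : (0 : ℝ) < m := Nat.cast_pos.2 hm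
    filter_upwards [(finite_line_zeros hm hP0).countable.ae_notMem volume] with t ht
    have hre : ((s : ℂ) + t * Complex.I).re = s := by simp
    have hex : ex m ((s : ℂ) + t * Complex.I - m) = ex m (t * Complex.I) := by
      rw [ex_eq_ex_iff hm]
      rcases hs with rfl | rfl
      · refine ⟨-1, ?_⟩
        push_cast
        ring
      · refine ⟨0, ?_⟩
        push_cast
        ring
    have h1 : (s : ℂ) + t * Complex.I ≠ p := by
      intro h
      have := congrArg Complex.re h
      rw [hre] at this
      rcases hs with h | h <;> linarith [hp.1, hp.2]
    have h2 : ¬L.IsRoot ((s : ℂ) + t * Complex.I) := by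
      intro h
      have := hroots _ h
      rw [hre] at this
      rcases hs with h | h <;> linarith [this.1, this.2]
    rw [hFw _ h1 h2 (by rw [hex]; exact ht), weight, weightZero_eq, weightZero_eq, hex,
      eval_comp]
    simp only [eval_add, eval_X, eval_C, Int.cast_zero, sub_zero, mul_comm Complex.I,
      add_comm (s : ℂ)]
  have hFint : ∀ s : ℝ, s = -m ∨ s = m → Integrable fun t : ℝ => F (s + t * Complex.I) :=
    fun s hs => (hint _).congr (hline s hs).symm
  obtain ⟨K, hK, hK'⟩ := exists_simple_polar_part hp.1 hp.2
    ((S.differentiable.differentiableOn (s := {z : ℂ | -(m : ℝ) ≤ z.re ∧ z.re ≤ m})).mul hN)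
  obtain ⟨B, T₁, hdecay⟩ := weight_decay c hm hc_symm hG Q m (-(m : ℝ)) m
  obtain ⟨T₂, hT₂⟩ := exists_abs_im_bound
    (insert p (L.roots.toFinset ∪ (Finset.range (2 * m)).image fun q : ℕ => alpha c q))
  have key := integral_strip (a := -(m : ℝ)) (b := m)
    (by linarith [hp.1, hp.2]) {()} (fun _ => S.eval p * N p) (fun _ => p) (fun _ _ => hp)
    (F := F) hK (fun z _ _ hz => by
      rw [Finset.sum_singleton]
      exact hK' z (hz () (Finset.mem_singleton_self _)))
    (B := |B|) (T₀ := max T₁ T₂)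
    (fun z h1 h2 h3 => by
      have hne : ∀ w ∈ insert p (L.roots.toFinset ∪
          (Finset.range (2 * m)).image fun q : ℕ => alpha c q), w.im ≠ z.im := by
        intro w hw h
        have := hT₂ w hw
        rw [h] at this
        exact absurd ((le_max_right _ _).trans h3) this.not_ge
      rw [hFw z (fun h => hne p (Finset.mem_insert_self _ _) (by rw [h]))
        (fun h => hne z (Finset.mem_insert_of_mem (Finset.mem_union_left _
          (Multiset.mem_toFinset.2 ((mem_roots hL).2 h)))) rfl)
        (eval_expPoly_ne_zero_of_im hm fun q hq h => hne _ (Finset.mem_insert_of_mem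
          (Finset.mem_union_right _ (Finset.mem_image_of_mem _ hq))) (by simpa using h))]
      have h4 := hdecay z h1 h2 ((le_max_left _ _).trans h3)
      rw [weight, Int.cast_natCast] at h4
      refine h4.trans ?_
      have h5 := abs_nonneg z.im
      have h6 := le_abs_self B
      have h7 : 1 + |z.im| ≤ (1 + |z.im|) ^ 2 := by nlinarith
      gcongr)
    (hFint _ (Or.inl rfl)) (hFint _ (Or.inr rfl))
  have hR : ∀ s : ℝ, s = -m ∨ s = m → lineInt c G 0 (Q.comp (X + C (s : ℂ))) =
      Complex.I * ∫ t : ℝ, F (s + t * Complex.I) := by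
    intro s hs
    rw [lineInt, integral_congr_ae (hline s hs)]
  have h1 := hR m (Or.inr rfl)
  have h2 := hR (-m) (Or.inl rfl)
  rw [Complex.ofReal_natCast] at h1
  rw [Complex.ofReal_neg, Complex.ofReal_natCast, C_neg, ← sub_eq_add_neg] at h2
  rw [Finset.sum_singleton, Complex.ofReal_natCast] at key
  rw [h1, h2, ← mul_sub]
  push_cast at key ⊢
  rw [key]
  ring

/-! ### Divisibility from residues -/

theorem exists_coprime_factors {p : ℂ[X]} (hp : p ≠ 0) (q : ℂ[X]) :
    ∃ p' q' d : ℂ[X], p = p' * d ∧ q = q' * d ∧ IsCoprime p' q' := by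
  classical
  obtain ⟨p', hp'⟩ := EuclideanDomain.gcd_dvd_left p q
  obtain ⟨q', hq'⟩ := EuclideanDomain.gcd_dvd_right p q
  have hab := EuclideanDomain.gcd_eq_gcd_ab p q
  set g := EuclideanDomain.gcd p q
  have hg0 : g ≠ 0 := fun h0 => hp (by rw [hp', h0, zero_mul])
  refine ⟨p', q', g, hp'.trans (mul_comm _ _), hq'.trans (mul_comm _ _),
    EuclideanDomain.gcdA p q, EuclideanDomain.gcdB p q, mul_left_cancel₀ hg0 ?_⟩
  linear_combination -hab - EuclideanDomain.gcdA p q * hp' - EuclideanDomain.gcdB p q * hq'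

/-- After cancelling the gcd, `L = L' g` and `R = R' g` with `L'` nonconstant. Take a root `p` of
`L'`, `Q = R L'/(X - p)` and `S = R'`; coprimality gives `R'(p) ≠ 0`. -/
theorem exists_residue_of_not_dvd {L R : ℂ[X]} (hL : L ≠ 0) (h : ¬L ∣ R) :
    ∃ (p : ℂ) (Q S : ℂ[X]), L.IsRoot p ∧ R ∣ Q ∧ Q * (X - C p) = L * S ∧ S.eval p ≠ 0 := by
  obtain ⟨L', R', g, hL', hR', hcop⟩ := exists_coprime_factors hL R
  have hdeg : L'.degree ≠ 0 := by
    intro h0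
    rw [← isUnit_iff_degree_eq_zero] at h0
    refine h ?_
    rw [hL', hR']
    exact mul_dvd_mul_right h0.dvd _
  obtain ⟨p, hp⟩ := IsAlgClosed.exists_root L' hdeg
  obtain ⟨L'', hL''⟩ := dvd_iff_isRoot.2 hp
  refine ⟨p, R * L'', R', ?_, dvd_mul_right _ _, ?_, ?_⟩
  · rw [hL', IsRoot.def, eval_mul, hp.eq_zero, zero_mul]
  · linear_combination L'' * (X - C p) * hR' - R' * hL' - R' * g * hL''
  · intro h0
    obtain ⟨a, b, hab⟩ := hcop
    have := congrArg (eval p) hab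
    rw [eval_add, eval_mul, eval_mul, h0, hp.eq_zero] at this
    simp at this

end TypeD
end

/-! ### Traces given by the line integral alone, and the reduction to `P_∘`. -/

noncomputable section
namespace TypeD
open MeasureTheory Filter Topology Polynomial

variable {m : ℕ} {c : ZMod (2 * m) → ℂ}

/-! ### Traces given by an integral over the imaginary axis -/

theorem tau_sub_tau_comp (hm : 0 < m) (hc : c 0 ≠ 0) {T : H m c →ₗ[ℂ] ℂ} (hT : IsTrace T)
    (R : ℂ[X]) (d : ℕ) :
    tau T 0 R - tau T d (R.comp (X - C (d : ℂ))) =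
      ∑ q ∈ Finset.range d, jump T q * R.eval (alpha c q - q - 1 / 2) := by
  induction d with
  | zero => simp
  | succ d ih =>
    have h := tau_sub_tau_succ hm hc hT d (R.comp (X - C (d : ℂ)))
    have h1 : (R.comp (X - C (d : ℂ))).comp (X - 1) = R.comp (X - C ((d + 1 : ℕ) : ℂ)) := by
      rw [comp_assoc, sub_comp, X_comp, C_comp, Nat.cast_succ, C_add, C_1, sub_sub,
        add_comm (1 : ℂ[X])]
    have h2 : (R.comp (X - C (d : ℂ))).eval (alpha c d - 1 / 2) =
        R.eval (alpha c d - d - 1 / 2) := by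
      rw [eval_comp, eval_sub, eval_X, eval_C]
      congr 1
      ring
    rw [h1, h2] at h
    rw [Finset.sum_range_succ, ← ih, ← h, Nat.cast_succ]
    ring

variable (c) in
/-- The rescaled root `n * root c q`. -/
def stripPt (q : ℕ) : ℂ := alpha c q - q - 1 / 2 + m

theorem stripPt_eq (hm : 0 < m) (q : ℕ) : stripPt c q = ((2 * m : ℕ) : ℂ) * root c q := by
  have := period_ne_zero hm
  rw [stripPt, root, mul_add, mul_div_cancel₀ _ this]
  push_cast
  ring

theorem root_symm (hm : 0 < m) (hc_symm : ∀ i, c (-i) = c i) {q : ℕ} (hq : q < 2 * m) :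
    root c (2 * m - 1 - q) = -root c q := by
  have h1 : ((2 * m - 1 - q : ℕ) : ℤ) = (-q - 1) + ((2 * m : ℕ) : ℤ) * 1 := by omega
  have h2 : ((2 * m - 1 - q : ℕ) : ℂ) = -q - 1 + ((2 * m : ℕ) : ℂ) := by
    have := congrArg (Int.cast : ℤ → ℂ) h1
    push_cast at this ⊢
    rw [this]
    ring
  have hn := period_ne_zero hm
  rw [root, root, h1, alpha_add_period c hm, alpha_neg_sub_one c hm hc_symm, h2]
  field_simp
  ring

theorem symmIndices_stripIndices (hm : 0 < m) (hc_symm : ∀ i, c (-i) = c i) :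
    SymmIndices m (stripIndices c) := by
  intro q hq
  rw [stripIndices, Finset.mem_filter, Finset.mem_range] at hq
  refine ⟨hq.1, ?_⟩
  rw [stripIndices, Finset.mem_filter, Finset.mem_range, root_symm hm hc_symm hq.1, Complex.neg_re,
    abs_neg]
  exact ⟨by omega, hq.2⟩

theorem polyStrip_comp_neg (hm : 0 < m) (hc_symm : ∀ i, c (-i) = c i) :
    (polyStrip c).comp (-X) = polyStrip c := by
  have hs := symmIndices_stripIndices (c := c) hm hc_symm
  have h1 : ∏ q ∈ stripIndices c, (-1 : ℂ[X]) = 1 := by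
    refine Finset.prod_involution (fun q _ => 2 * m - 1 - q) ?_ ?_ ?_ ?_
    · intro q _
      norm_num
    · intro q hq _
      have := hs q hq
      omega
    · intro q hq
      exact (hs q hq).2
    · intro q hq
      have := hs q hq
      omega
  have h2 : ∏ q ∈ stripIndices c, (X + C (root c q)) = polyStrip c := by
    rw [polyStrip]
    refine Finset.prod_nbij' (fun q => 2 * m - 1 - q) (fun q => 2 * m - 1 - q)
      (fun q hq => (hs q hq).2) (fun q hq => (hs q hq).2) ?_ ?_ ?_
    · intro q hq
      have := hs q hq
      omega
    · intro q hq
      have := hs q hq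
      omega
    · intro q hq
      rw [root_symm hm hc_symm (hs q hq).1, C_neg, sub_neg_eq_add]
  nth_rewrite 1 [polyStrip]
  rw [prod_comp, ← h2, ← one_mul (∏ q ∈ stripIndices c, (X + C (root c q))), ← h1,
    ← Finset.prod_mul_distrib]
  refine Finset.prod_congr rfl fun q _ => ?_
  rw [sub_comp, X_comp, C_comp]
  ring

/-- Sum the difference equation over a full period, after which `tau` is back at index `0`. -/
theorem tau_comp_add_sub (hm : 0 < m) (hc : c 0 ≠ 0) {T : H m c →ₗ[ℂ] ℂ} (hT : IsTrace T)
    (Q : ℂ[X]) :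
    tau T 0 (Q.comp (X + C (m : ℂ))) - tau T 0 (Q.comp (X - C (m : ℂ))) =
      ∑ q ∈ Finset.range (2 * m), jump T q * Q.eval (stripPt c q) := by
  have h := tau_sub_tau_comp hm hc hT (Q.comp (X + C (m : ℂ))) (2 * m)
  have h1 := tau_add_period hm T 0 1
  rw [zero_add, mul_one] at h1
  have h2 : (Q.comp (X + C (m : ℂ))).comp (X - C ((2 * m : ℕ) : ℂ)) = Q.comp (X - C (m : ℂ)) := by
    rw [comp_assoc, add_comp, X_comp, C_comp, Nat.cast_mul, Nat.cast_two, C_mul]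
    congr 1
    rw [show (C 2 : ℂ[X]) = 2 from rfl]
    ring
  rw [h1, h2] at h
  rw [h]
  refine Finset.sum_congr rfl fun q _ => ?_
  rw [eval_comp, eval_add, eval_X, eval_C, stripPt]

theorem filter_range_eq_stripIndices (hm : 0 < m) :
    (Finset.range (2 * m)).filter (fun q => |(stripPt c q).re| ≤ m) = stripIndices c := by
  ext q
  rw [stripIndices, Finset.mem_filter, Finset.mem_filter]
  refine and_congr_right fun _ => ?_
  have h : (stripPt c q).re = ((2 * m : ℕ) : ℝ) * (root c q).re := by
    rw [stripPt_eq hm, ← Complex.ofReal_natCast, Complex.re_ofReal_mul]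
  have hm' : (0 : ℝ) < m := Nat.cast_pos.2 hm
  rw [h, abs_mul, Nat.abs_cast]
  push_cast
  constructor <;> intro h1 <;> nlinarith

theorem roots_prod_X_sub_C_comp {ι : Type*} (s : Finset ι) (f : ι → ℂ) :
    (∏ q ∈ s, (X - C (f q))).roots = s.val.map f := by
  have h : ∏ q ∈ s, (X - C (f q)) = ((s.val.map f).map fun x => X - C x).prod := by
    rw [Multiset.map_map]
    rfl
  rw [h, roots_multiset_prod_X_sub_C]

theorem le_map_filter_of_le_map {ι α : Type*} {s : Finset ι} {f : ι → α} {A : Multiset α}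
    {p : α → Prop} [DecidablePred p] (h : A ≤ s.val.map f) (hA : ∀ z ∈ A, p z) :
    A ≤ (s.filter fun q => p (f q)).val.map f := by
  have h2 := Multiset.filter_le_filter p h
  rwa [Multiset.filter_eq_self.2 hA, Multiset.filter_map] at h2

theorem prod_X_sub_C_stripPt_dvd (hm : 0 < m) :
    ∏ q ∈ stripIndices c, (X - C (stripPt c q)) ∣
      (polyStrip c).comp (C (((2 * m : ℕ) : ℂ)⁻¹) * X) := by
  rw [polyStrip, prod_comp]
  refine Finset.prod_dvd_prod_of_dvd _ _ fun q _ => ⟨C (((2 * m : ℕ) : ℂ)⁻¹), ?_⟩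
  rw [sub_comp, X_comp, C_comp, sub_mul, ← C_mul, stripPt_eq hm, mul_comm _ (_⁻¹),
    inv_mul_cancel_left₀ (period_ne_zero hm), mul_comm X]

/-- The part of the weight that survives the reduction has only poles in the strip. -/
theorem exists_strip_reduction (hm : 0 < m) (hc : c 0 ≠ 0) (hc_symm : ∀ i, c (-i) = c i)
    {T : H m c →ₗ[ℂ] ℂ} (hT : IsTrace T) {G : ℂ[X]} (hG : IsNumerator (2 * m) G)
    (hint : ∀ R : ℂ[X], Integrable fun t : ℝ =>
      R.eval (Complex.I * t) * weight c G 0 (Complex.I * t))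
    (hτ : ∀ R, tau T 0 R = lineInt c G 0 R) :
    (∃ G₁ P₁ D : ℂ[X], G = G₁ * D ∧ expPoly c (Finset.range (2 * m)) = P₁ * D ∧
      P₁ ∣ expPoly c (stripIndices c)) ∧
    ∀ Q : ℂ[X], ∏ q ∈ stripIndices c, (X - C (stripPt c q)) ∣ Q →
      tau T 0 (Q.comp (X + C (m : ℂ))) = tau T 0 (Q.comp (X - C (m : ℂ))) := by
  obtain ⟨P₁, G₁, D, hPD, hGD, hcop⟩ :=
    exists_coprime_factors (expPoly_monic c (Finset.range (2 * m))).ne_zero G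
  have hP₁ : P₁.eval 0 ≠ 0 := by
    have := eval_expPoly_zero_ne_zero c (Finset.range (2 * m))
    rw [hPD, eval_mul] at this
    exact left_ne_zero_of_mul this
  have hline := reduced_denom_ne_zero hm (hPD ▸ (expPoly_monic c _).ne_zero) hcop.symm (by
    rw [← hPD, ← hGD]
    refine (hint 1).congr (Eventually.of_forall fun t => ?_)
    simp only [eval_one, one_mul, weight, weightZero_eq, Int.cast_zero, sub_zero,
      mul_comm Complex.I])
  obtain ⟨p, N, hp, hN, hw⟩ := exists_strip_quotient hm hP₁ hcop.symm hline
  set L := (P₁.roots.map fun x => X - C (p x)).prod with hLdef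
  have hL : L ≠ 0 := (monic_multiset_prod_of_monic _ _ fun x _ => monic_X_sub_C _).ne_zero
  have hLroots : L.roots = P₁.roots.map p := by
    have : L = ((P₁.roots.map p).map fun x => X - C x).prod := by
      rw [Multiset.map_map]
      rfl
    rw [this, roots_multiset_prod_X_sub_C]
  have hstrip : ∀ z, L.IsRoot z → (-(m : ℝ) < z.re ∧ z.re < m) ∧ N z ≠ 0 := by
    intro z hz
    have : z ∈ L.roots := (mem_roots hL).2 hz
    rw [hLroots] at this
    obtain ⟨x, hx, rfl⟩ := Multiset.mem_map.1 this
    exact ⟨(hp x hx).1, (hp x hx).2.2⟩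
  have hres : ∀ {p : ℂ}, -(m : ℝ) < p.re ∧ p.re < m → ∀ {Q S : ℂ[X]}, Q * (X - C p) = L * S →
      tau T 0 (Q.comp (X + C (m : ℂ))) - tau T 0 (Q.comp (X - C (m : ℂ))) =
        2 * Real.pi * Complex.I * (S.eval p * N p) := by
    intro p hp Q S hQ
    rw [hτ, hτ]
    exact strip_residue hm hc_symm hG hint hGD hPD hL (fun z hz => (hstrip z hz).1) hN hw hp hQ
  -- Otherwise some multiple `Q` of the product has a nonzero residue, while the difference equation
  -- gives zero because `Q` vanishes at every `stripPt`.
  have hdvd : L ∣ ∏ q ∈ Finset.range (2 * m), (X - C (stripPt c q)) := by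
    by_contra h
    obtain ⟨z, Q, S, hz, hQ, hQS, hS⟩ := exists_residue_of_not_dvd hL h
    have h1 := hres (hstrip z hz).1 hQS
    rw [tau_comp_add_sub hm hc hT, Finset.sum_eq_zero] at h1
    · exact mul_ne_zero Complex.two_pi_I_ne_zero (mul_ne_zero hS (hstrip z hz).2) h1.symm
    · intro q hq
      have h2 : (X - C (stripPt c q)) ∣ Q :=
        (Finset.dvd_prod_of_mem (fun q : ℕ => X - C (stripPt c q)) hq).trans hQ
      rw [(dvd_iff_isRoot.1 h2).eq_zero, mul_zero]
  -- The poles lie in the open strip, so as a multiset they are already contained in the points with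
  -- `|Re| ≤ m`.
  have hle : P₁.roots.map p ≤ (stripIndices c).val.map (stripPt c) := by
    have h0 : ∏ q ∈ Finset.range (2 * m), (X - C (stripPt c q)) ≠ 0 :=
      Finset.prod_ne_zero_iff.2 fun q _ => X_sub_C_ne_zero _
    have h1 := roots.le_of_dvd h0 hdvd
    rw [hLroots, roots_prod_X_sub_C_comp] at h1
    rw [← filter_range_eq_stripIndices hm]
    refine le_map_filter_of_le_map (p := fun z : ℂ => |z.re| ≤ m) h1 fun z hz => ?_
    rw [← hLroots] at hz
    have := (hstrip z ((mem_roots hL).1 hz)).1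
    exact abs_le.2 ⟨this.1.le, this.2.le⟩
  refine ⟨⟨G₁, P₁, D, hGD, hPD, ?_⟩, fun Q hQ => ?_⟩
  · refine (IsAlgClosed.splits P₁).dvd_of_roots_le_roots (fun h => hP₁ (by rw [h, eval_zero])) ?_
    have h1 := Multiset.map_le_map (f := fun z => ex m (z - m)) hle
    rw [Multiset.map_map, Multiset.map_map] at h1
    have h2 : P₁.roots.map ((fun z => ex m (z - m)) ∘ p) = P₁.roots :=
      (Multiset.map_congr rfl fun x hx => (hp x hx).2.1).trans (Multiset.map_id' _)
    rw [h2] at h1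
    rw [expPoly_eq, roots_prod_X_sub_C_comp]
    refine h1.trans (le_of_eq (Multiset.map_congr rfl fun q _ => ?_))
    simp only [Function.comp_apply, stripPt, add_sub_cancel_right, rho, Int.cast_natCast]
  · have h1 : L ∣ ∏ q ∈ stripIndices c, (X - C (stripPt c q)) := by
      refine (IsAlgClosed.splits L).dvd_of_roots_le_roots hL ?_
      rw [hLroots, roots_prod_X_sub_C_comp]
      exact hle
    obtain ⟨S, hS⟩ := h1.trans hQ
    have hm' : (0 : ℝ) < m := Nat.cast_pos.2 hm
    -- With no pole left, the residue formula is used at the artificial point `0`, where the extra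
    -- factor `X` makes the residue vanish.
    have h2 := hres (p := 0) (Q := Q) (S := S * X) (by simpa using hm') (by
      rw [hS, C_0, sub_zero, mul_assoc])
    rwa [eval_mul, eval_X, mul_zero, zero_mul, mul_zero, sub_eq_zero] at h2

/-- For `G ≠ 0` a degree count in `G 𝐏_∘ = G_∘ 𝐏` forces `n_∘ ≥ 2` and the degree bound. Reflection
is multiplicative and fixes `G`, `𝐏` and `𝐏_∘`, so cancelling `𝐏` shows that it fixes `G_∘`. -/
theorem exists_strip_numerator (hm : 0 < m) (hc_symm : ∀ i, c (-i) = c i) {G G₁ P₁ D : ℂ[X]}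
    (hG : IsNumerator (2 * m) G) (hGD : G = G₁ * D)
    (hPD : expPoly c (Finset.range (2 * m)) = P₁ * D) (hP₁ : P₁ ∣ expPoly c (stripIndices c)) :
    ∃ G₀ : ℂ[X], IsNumerator (stripIndices c).card G₀ ∧
      G * expPoly c (stripIndices c) = G₀ * expPoly c (Finset.range (2 * m)) := by
  rcases eq_or_ne G 0 with h0 | h0
  · exact ⟨0, ⟨fun _ _ => coeff_zero _, fun _ _ _ => by rw [coeff_zero, coeff_zero]⟩, by
      rw [h0, zero_mul, zero_mul]⟩
  obtain ⟨K, hK⟩ := hP₁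
  have heq : G * expPoly c (stripIndices c) = G₁ * K * expPoly c (Finset.range (2 * m)) := by
    rw [hK, hPD, hGD]
    ring
  refine ⟨G₁ * K, ?_, heq⟩
  have hP0 := (expPoly_monic c (Finset.range (2 * m))).ne_zero
  have hs0 := (expPoly_monic c (stripIndices c)).ne_zero
  obtain ⟨hG1, hG2⟩ := (isNumerator_iff (by omega) G).1 hG
  have hG₀ : G₁ * K ≠ 0 := by
    intro h
    rw [h, zero_mul] at heq
    exact mul_ne_zero h0 hs0 heq
  have hdeg := congrArg natDegree heq
  rw [natDegree_mul h0 hs0, natDegree_mul hG₀ hP0, natDegree_expPoly, natDegree_expPoly,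
    Finset.card_range] at hdeg
  rw [isNumerator_iff (by omega)]
  refine ⟨by omega, mul_right_cancel₀ hP0 ?_⟩
  have hP := reflect_expPoly c hm hc_symm (symmIndices_range (m := m))
  have hs := reflect_expPoly c hm hc_symm (symmIndices_stripIndices hm hc_symm)
  rw [Finset.card_range] at hP
  have h1 := reflect_mul G (expPoly c (stripIndices c)) hG1 (natDegree_expPoly c _).le
  have h2 := reflect_mul (G₁ * K) (expPoly c (Finset.range (2 * m)))
    (F := (stripIndices c).card - 2) (by omega)
    ((natDegree_expPoly c _).trans (Finset.card_range _)).le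
  rw [hG2, hs] at h1
  rw [hP] at h2
  rw [← h2, ← heq, ← h1]
  congr 1
  omega

theorem reducesToStrip (hm : 0 < m) (hc : c 0 ≠ 0) (hc_symm : ∀ i, c (-i) = c i)
    {T : H m c →ₗ[ℂ] ℂ} (hT : IsTrace T) {G : ℂ[X]} {a : ℤ → ℤ × ℤ →₀ ℂ}
    (hL : HasLineFormula c T G a) (hΦ : ∀ R : ℂ[X], pointSum c 0 (a 0) R = 0) :
    ReducesToStrip c T G := by
  have hτ : ∀ R, tau T 0 R = lineInt c G 0 R := fun R => by
    rw [tau_apply, hL.formula 0 R, hΦ, add_zero, lineInt]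
  obtain ⟨⟨G₁, P₁, D, hGD, hPD, hP₁⟩, hinv⟩ :=
    exists_strip_reduction hm hc hc_symm hT hL.numerator (hL.integrable 0) hτ
  have hn := period_ne_zero hm
  set n : ℂ := ((2 * m : ℕ) : ℂ) with hndef
  have hC : C n⁻¹ * C (m : ℂ) = (C (1 / 2) : ℂ[X]) := by
    have : (m : ℂ) = n * (1 / 2) := by
      rw [hndef]
      push_cast
      ring
    rw [← C_mul, this, inv_mul_cancel_left₀ hn]
  have hC1 : (C 1 : ℂ[X]) = C (1 / 2) + C (1 / 2) := by
    rw [← C_add, add_halves]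
  refine ⟨exists_strip_numerator hm hc_symm hL.numerator hGD hPD hP₁, ?_⟩
  obtain ⟨T₀, σ, h1, h2, h3, h4, h5, h6⟩ := exists_invariant_trace
    (polyStrip_comp_neg hm hc_symm) (tau T 0 ∘ₗ (aeval (C n⁻¹ * X : ℂ[X])).toLinearMap)
    (fun b => by
      -- The scaling by `1/n` turns the shifts by `±m` into `±1/2`. The extra half-shift of `b`
      -- makes its two arguments `X + 1` and `X`, as the type A condition requires.
      have h := hinv ((b.comp (X + C (1 / 2)) * polyStrip c).comp (C n⁻¹ * X)) (by
        rw [mul_comp]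
        exact (prod_X_sub_C_stripPt_dvd hm).mul_left _)
      simp only [LinearMap.comp_apply, AlgHom.toLinearMap_apply, ← comp_eq_aeval, mul_comp,
        comp_assoc, add_comp, sub_comp, X_comp, C_comp, mul_add, mul_sub, hC,
        sub_add_cancel] at h ⊢
      rw [hC1, ← add_assoc]
      exact h)
    (fun b => by
      have h := tau_neg hm hc hc_symm hT 0 (b.comp (C n⁻¹ * X))
      simp only [LinearMap.comp_apply, AlgHom.toLinearMap_apply, ← comp_eq_aeval, comp_assoc,
        neg_comp, mul_comp, X_comp, C_comp, mul_neg, neg_zero] at h ⊢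
      exact h)
  refine ⟨T₀, σ, h1, h2, h3, h4, h5, fun R => ?_⟩
  rw [h6, LinearMap.comp_apply, AlgHom.toLinearMap_apply, ← comp_eq_aeval, tau_apply, aeval_comp,
    map_mul (aeval (k c)), aeval_C, aeval_X, ← Algebra.smul_def]

end TypeD
end

theorem mainTheorem7 (m : ℕ) (hm : 0 < m) (c : ZMod (2 * m) → ℂ)
    (hc_zero : c 0 ≠ 0) (hc_symm : ∀ i, c (-i) = c i) :
    ((∀ (i j : ℤ), (TypeD.alpha c i).re ≠ j + 1 / 2) →
      ∀ T : TypeD.H m c →ₗ[ℂ] ℂ, TypeD.IsTrace T →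
        ∃ (G : Polynomial ℂ) (a : ℤ → ℤ × ℤ →₀ ℂ), TypeD.HasLineFormula c T G a) ∧
    (∀ T : TypeD.H m c →ₗ[ℂ] ℂ, TypeD.IsTrace T →
      ∀ (G : Polynomial ℂ) (a : ℤ → ℤ × ℤ →₀ ℂ), TypeD.HasLineFormula c T G a →
        (∀ R : Polynomial ℂ, TypeD.pointSum c 0 (a 0) R = 0) →
        TypeD.ReducesToStrip c T G) :=
  ⟨fun hα _ hT => TypeD.exists_hasLineFormula hm hc_zero hc_symm hα hT,
    fun _ hT _ _ hL hΦ => TypeD.reducesToStrip hm hc_zero hc_symm hT hL hΦ⟩
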